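/- **Theorem (IDS in globally observable games).** *Game.* A linear partial monitoring game consists of a nonempty compact action set $\mathcal A$, reward features $\phi_a\in\mathbb R^d$ and observation maps $M_a\in\mathbb R^{m\times d}$, both continuous in $a\in\mathcal A$, and a convex parameter set $\Theta\subset\mathbb R^d$. Assume $\|\phi_a\|\le 1$ and $\|M_a\|^2\le L$ (spectral norm) for all $a$, and $\|\theta-\theta_0\|\le B$ for all $\theta\in\Theta$, where $\theta_0\in\Theta$. In round $t=1,\dots,n$ ($n\ge1$) the learner plays $a_t$ and observes $y_t=M_{a_t}\theta^*+\epsilon_t$, with $\theta^*\in\Theta$ unknown. Let $\mathcal F_{t}=\sigma(a_1,y_1,\dots,a_{t},y_{t})$. The noise is $\rho$-sub-Gaussian given the past and the current action: $\mathbb E[e^{u^\top\epsilon_t}\mid\mathcal F_{t-1},a_t]\le e^{\rho^2\|u\|^2/2}$ for all $u\in\mathbb R^m$, where $\rho\ge0$. The regret is $\mathfrak R_n=\max_{a}\mathbb E\sum_{t=1}^n\langle\phi_a-\phi_{a_t},\theta^*\rangle$, and $\Delta_{\max}=\max_{a,b}\langle\phi_a-\phi_b,\theta^*\rangle$. *Observability.*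 Let $\mathcal C_a=\{\theta\in\Theta:\langle\phi_a,\theta\rangle=\max_b\langle\phi_b,\theta\rangle\}$. An action $a$ is Pareto optimal, $a\in\mathcal P$, if $\mathcal C_a\ne\emptyset$ and the affine hulls of $\mathcal C_a$ and $\Theta$ have the same dimension. Assume that $\mathcal A$ is finite or, more generally, that every $\theta\in\Theta$ lies in $\mathcal C_a$ for some $a\in\mathcal P$. Let $\mathcal V=\mathrm{span}\{\theta-\nu:\theta,\nu\in\Theta\}$, with orthogonal projection $\mathrm{Proj}_{\mathcal V}$. The game is globally observable if $\mathrm{Proj}_{\mathcal V}(\phi_a-\phi_b)$ lies in the span of the images of all $\mathrm{Proj}_{\mathcal V}M_c^\top$, $c\in\mathcal A$, for all $a,b\in\mathcal P$. The global alignment constant is $$\alpha=\sup_{\nu\in\mathcal V}\ \sup_{a,b\in\mathcal P}\ \inf_{c\in\mathcal A}\frac{\langle\phi_a-\phi_b,\nu\rangle^2}{\|M_c\nu\|^2}\qquad(0/0=0,\ x/0=\infty \text{ for } x>0).$$ *Algorithm.* Fix $\lambda>0$ and $W\in\mathbb R^{d\times r}$ with $W^\top W=I_r$ and $M_a(\theta-\nu)=M_aWW^\top(\theta-\nu)$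 for all $a\in\mathcal A$ and $\theta,\nu\in\Theta$. Put $V_t=\lambda I_d+\sum_{s<t}M_{a_s}^\top M_{a_s}$ and $W_t=W^\top V_tW$, let $\hat\theta_t$ be a minimizer over $\Theta$ of $\sum_{s<t}\|M_{a_s}\theta-y_s\|^2+\lambda\|\theta-\theta_0\|^2$, and put $$\beta_t=\Big(\rho\sqrt{2\log t^2+\log\det W_t-\log\det(\lambda I_r)}+\sqrt\lambda B\Big)^2,\qquad \mathcal E_t=\{\theta\in\Theta:\|\theta-\hat\theta_t\|_{V_t}^2\le\beta_t\},$$ $$\hat\Delta_t(a)=\sup_{\theta\in\mathcal E_t,\,b\in\mathcal A}\langle\phi_b-\phi_a,\theta\rangle,\qquad I_t(a)=\tfrac12\log\det(W_t+W^\top M_a^\top M_aW)-\tfrac12\log\det W_t .$$ IDS samples $a_t$, given $\mathcal F_{t-1}$, from a distribution $\mu_t$ that is determined by the past and minimizes $\hat\Delta_t(\mu)^2/I_t(\mu)$ over all probability distributions $\mu$ on $\mathcal A$ (conventions as above), where $f(\mu)=\mathbb E_{a\sim\mu}f(a)$. Let $\gamma_n=\sum_{t=1}^nI_t(a_t)$.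 *Claim.* There are a universal constant $C$ and a constant $K$ that depends only on $\rho,\lambda,B,\Delta_{\max}$ such that for every globally observable game as above and every $\lambda\ge L$, $\lambda>0$, one has $\alpha<\infty$, $$\mathfrak R_n\le n^{2/3}\Big(54\,\alpha\,\mathbb E[\beta_n]\,\mathbb E\big[\gamma_n(\Delta_{\max}+4B)\big]\Big)^{1/3}+C\,\Delta_{\max},$$ and consequently $$\mathfrak R_n\le K\,\alpha^{1/3}\,r\,\log(1+n)\,n^{2/3}.$$ -/

import Mathlib

open MeasureTheory
open scoped ENNReal

noncomputable section

/-- Euclidean space `ℝⁿ`. -/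
abbrev Euc (n : ℕ) : Type := EuclideanSpace ℝ (Fin n)

/-- A linear partial monitoring game: reward features `φ_a ∈ ℝᵈ`, linear observation maps
`M_a : ℝᵈ → ℝᵐ` (with their operator norm, i.e. the spectral norm of the matrix) and a parameter
set `Θ ⊆ ℝᵈ`. -/
structure LinearPM (A : Type*) (d m : ℕ) where
  feat : A → Euc d
  obs : A → Euc d →L[ℝ] Euc m
  params : Set (Euc d)

namespace LinearPM

variable {A : Type*} {d m r : ℕ} (G : LinearPM A d m)

/-! ### Standing assumptions -/

/-- Convexity and boundedness. Compactness of the action set is a type class on `A`; here its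
features and observation maps are continuous. The bound `L` is on the squared spectral norm. -/
structure Bounded [TopologicalSpace A] (θ₀ : Euc d) (L B : ℝ) : Prop where
  continuous_feat : Continuous G.feat
  continuous_obs : Continuous G.obs
  convex_params : Convex ℝ G.params
  prior_mem : θ₀ ∈ G.params
  obs_bound : ∀ a, ‖G.obs a‖ ^ 2 ≤ L
  feat_bound : ∀ a, ‖G.feat a‖ ≤ 1
  params_bound : ∀ θ ∈ G.params, ‖θ - θ₀‖ ≤ B

/-- `W ∈ ℝ^{d × r}` is a valid basis: `Wᵀ W = I_r` and `M_a (θ - ν) = M_a W Wᵀ (θ - ν)` for all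
actions `a` and all parameters `θ, ν`. -/
structure ValidBasis (W : Euc r →L[ℝ] Euc d) : Prop where
  orthonormal : W.adjoint ∘L W = ContinuousLinearMap.id ℝ (Euc r)
  obs_eq : ∀ a, ∀ θ ∈ G.params, ∀ ν ∈ G.params,
    G.obs a (θ - ν) = G.obs a (W (W.adjoint (θ - ν)))

/-! ### Observability -/

/-- The cell of `a`: the parameters for which `a` is an optimal action. -/
def cell (a : A) : Set (Euc d) :=
  {θ ∈ G.params | ∀ b, inner ℝ (G.feat b) θ ≤ inner ℝ (G.feat a) θ}

/-- The linear span of the parameter differences. -/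
def diffSpan : Submodule ℝ (Euc d) :=
  Submodule.span ℝ {v | ∃ θ ∈ G.params, ∃ ν ∈ G.params, v = θ - ν}

/-- `a` is Pareto optimal: its cell has the same (affine) dimension as the parameter set. The
empty cell of a dominated action does not count, even if the parameter set is a point. -/
def Pareto (a : A) : Prop :=
  (G.cell a).Nonempty ∧
    Module.finrank ℝ (vectorSpan ℝ (G.cell a)) = Module.finrank ℝ (vectorSpan ℝ G.params)

/-- Every parameter admits an optimal action that is Pareto optimal. -/
def ParetoCovers : Prop :=
  ∀ θ ∈ G.params, ∃ a, G.Pareto a ∧ θ ∈ G.cell a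

/-- Global observability: for Pareto optimal `a, b` the projection of `φ_a - φ_b` to the span of
parameter differences lies in the span of the projected images of all `M_cᵀ`. -/
def GloballyObservable : Prop :=
  ∀ a b, G.Pareto a → G.Pareto b →
    G.diffSpan.starProjection (G.feat a - G.feat b) ∈
      Submodule.span ℝ {v | ∃ c, ∃ w : Euc m,
        v = G.diffSpan.starProjection ((G.obs c).adjoint w)}

/-- The global alignment constant. Division in `ℝ≥0∞` follows the conventions
`0 / 0 = 0` and `x / 0 = ∞` for `x > 0`. -/
def alignment : ℝ≥0∞ :=
  ⨆ (ν ∈ G.diffSpan) (a : A) (_ : G.Pareto a) (b : A) (_ : G.Pareto b), ⨅ c : A,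
    ENNReal.ofReal (inner ℝ (G.feat a - G.feat b) ν ^ 2) / ENNReal.ofReal (‖G.obs c ν‖ ^ 2)

/-- The maximum gap `Δ_max` under the parameter `θ`. -/
def maxGap (θ : Euc d) : ℝ :=
  ⨆ p : A × A, inner ℝ (G.feat p.1 - G.feat p.2) θ

/-! ### The quantities computed by the algorithm
Rounds are `t = 1, 2, …`. The functions below take the whole sequence of actions `act` and
feedback vectors `fb`, but depend only on the rounds `1, …, t - 1`. -/

/-- `V_t = λ I + ∑_{s < t} M_{a_s}ᵀ M_{a_s}`. -/
def covV (lam : ℝ) (act : ℕ → A) (t : ℕ) : Euc d →L[ℝ] Euc d :=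
  lam • ContinuousLinearMap.id ℝ (Euc d) +
    ∑ s ∈ Finset.Ico 1 t, (G.obs (act s)).adjoint ∘L G.obs (act s)

/-- `W_t = Wᵀ V_t W`. -/
def covW (W : Euc r →L[ℝ] Euc d) (lam : ℝ) (act : ℕ → A) (t : ℕ) : Euc r →L[ℝ] Euc r :=
  W.adjoint ∘L G.covV lam act t ∘L W

/-- The regularized least-squares objective of round `t`. -/
def lsLoss (θ₀ : Euc d) (lam : ℝ) (act : ℕ → A) (fb : ℕ → Euc m) (t : ℕ) (θ : Euc d) : ℝ :=
  ∑ s ∈ Finset.Ico 1 t, ‖G.obs (act s) θ - fb s‖ ^ 2 + lam * ‖θ - θ₀‖ ^ 2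

/-- The confidence coefficient
`β_{t,δ} = (ρ √(2 log (1/δ) + log det W_t - log det (λ I_r)) + √λ B)²`. -/
def betaConf (W : Euc r →L[ℝ] Euc d) (lam ρ B : ℝ) (act : ℕ → A) (t : ℕ) (δ : ℝ) : ℝ :=
  (ρ * √(2 * Real.log (1 / δ) + Real.log (G.covW W lam act t).det
      - Real.log (lam • ContinuousLinearMap.id ℝ (Euc r)).det) + √lam * B) ^ 2

/-- `β_t = β_{t, 1/t²}`. -/
def beta (W : Euc r →L[ℝ] Euc d) (lam ρ B : ℝ) (act : ℕ → A) (t : ℕ) : ℝ :=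
  G.betaConf W lam ρ B act t (1 / (t : ℝ) ^ 2)

/-- The confidence set `E_t = {θ ∈ Θ : ‖θ - θ̂_t‖²_{V_t} ≤ β_t}`, with centre `θhat`. -/
def confSet (W : Euc r →L[ℝ] Euc d) (lam ρ B : ℝ) (act : ℕ → A) (t : ℕ) (θhat : Euc d) :
    Set (Euc d) :=
  {θ ∈ G.params | inner ℝ (θ - θhat) (G.covV lam act t (θ - θhat)) ≤ G.beta W lam ρ B act t}

/-- The gap estimate `max_{θ ∈ E} max_b ⟨φ_b - φ_a, θ⟩`. -/
def gapEst (E : Set (Euc d)) (a : A) : ℝ :=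
  sSup {x | ∃ θ ∈ E, ∃ b, x = inner ℝ (G.feat b - G.feat a) θ}

/-- The information gain
`I_t(a) = ½ log det (W_t + Wᵀ M_aᵀ M_a W) - ½ log det W_t`. -/
def infoGain (W : Euc r →L[ℝ] Euc d) (lam : ℝ) (act : ℕ → A) (t : ℕ) (a : A) : ℝ :=
  1 / 2 * Real.log (G.covW W lam act t
      + W.adjoint ∘L (G.obs a).adjoint ∘L G.obs a ∘L W).det
    - 1 / 2 * Real.log (G.covW W lam act t).det

/-- The total information gain `γ_n = ∑_{t=1}^n I_t(a_t)`. -/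
def totalInfo (W : Euc r →L[ℝ] Euc d) (lam : ℝ) (act : ℕ → A) (n : ℕ) : ℝ :=
  ∑ t ∈ Finset.Icc 1 n, G.infoGain W lam act t (act t)

end LinearPM

/-- The information ratio `Ψ(μ) = Δ(μ)² / I(μ)` of a sampling distribution, in `[0, ∞]` with the
conventions `0 / 0 = 0` and `x / 0 = ∞` for `x > 0`. -/
def infoRatio {A : Type*} [MeasurableSpace A] (gap info : A → ℝ) (μ : Measure A) : ℝ≥0∞ :=
  ENNReal.ofReal ((∫ a, gap a ∂μ) ^ 2) / ENNReal.ofReal (∫ a, info a ∂μ)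

/-- `μ` is an IDS distribution: a probability measure that minimizes the information ratio among
all probability measures on the actions. -/
def IsIDS {A : Type*} [MeasurableSpace A] (gap info : A → ℝ) (μ : Measure A) : Prop :=
  IsProbabilityMeasure μ ∧
    ∀ ν : Measure A, IsProbabilityMeasure ν → infoRatio gap info μ ≤ infoRatio gap info ν

namespace LinearPM

variable {A : Type*} [MeasurableSpace A] {d m r : ℕ} (G : LinearPM A d m)
variable {Ω : Type*} [MeasurableSpace Ω]

/-- The σ-algebra `F_{t-1}` generated by the actions and feedback of the rounds `1, …, t - 1`. -/
@[reducible] def past (act : ℕ → Ω → A) (fb : ℕ → Ω → Euc m) (t : ℕ) : MeasurableSpace Ω :=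
  ⨆ s ∈ Finset.Ico 1 t,
    MeasurableSpace.comap (act s) inferInstance ⊔ MeasurableSpace.comap (fb s) inferInstance

/-- The σ-algebra generated by the rounds `1, …, t - 1` and the action of round `t`. -/
@[reducible] def pastAct (act : ℕ → Ω → A) (fb : ℕ → Ω → Euc m) (t : ℕ) : MeasurableSpace Ω :=
  past act fb t ⊔ MeasurableSpace.comap (act t) inferInstance

/-- The interaction of the algorithm with the environment during the rounds `1, …, n`, on a
probability space `(Ω, P)`: the actions `act`, the feedback `fb`, the least-squares estimates
`θhat` and the sampling distributions `μ`. -/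
structure IDSRun (P : Measure Ω) (n : ℕ) (W : Euc r →L[ℝ] Euc d) (lam ρ B : ℝ)
    (θ₀ θstar : Euc d) (act : ℕ → Ω → A) (fb : ℕ → Ω → Euc m)
    (θhat : ℕ → Ω → Euc d) (μ : ℕ → Ω → Measure A) : Prop where
  measurable_act : ∀ t ∈ Finset.Icc 1 n, Measurable (act t)
  measurable_fb : ∀ t ∈ Finset.Icc 1 n, Measurable (fb t)
  /-- The noise `y_t - M_{a_t} θ*` is conditionally `ρ`-sub-Gaussian, hence of mean zero, given
  the past and the current action. -/
  noise_integrable : ∀ t ∈ Finset.Icc 1 n, ∀ u : Euc m,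
    Integrable (fun ω => Real.exp (inner ℝ u (fb t ω - G.obs (act t ω) θstar))) P
  noise_subGaussian : ∀ t ∈ Finset.Icc 1 n, ∀ u : Euc m,
    P[fun ω => Real.exp (inner ℝ u (fb t ω - G.obs (act t ω) θstar)) | pastAct act fb t]
      ≤ᵐ[P] fun _ => Real.exp (‖u‖ ^ 2 * ρ ^ 2 / 2)
  /-- `θ̂_t` minimizes the least-squares objective over the parameter set. -/
  estimate : ∀ t ∈ Finset.Icc 1 n, ∀ ω, θhat t ω ∈ G.params ∧
    IsMinOn (G.lsLoss θ₀ lam (fun s => act s ω) (fun s => fb s ω) t) G.params (θhat t ω)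
  /-- `μ_t` minimizes the information ratio. -/
  ids : ∀ t ∈ Finset.Icc 1 n, ∀ ω, IsIDS
    (G.gapEst (G.confSet W lam ρ B (fun s => act s ω) t (θhat t ω)))
    (G.infoGain W lam (fun s => act s ω) t) (μ t ω)
  /-- `μ_t` is determined by the past. -/
  predictable : ∀ t ∈ Finset.Icc 1 n, Measurable[past act fb t] (μ t)
  /-- Given the past, `a_t` is sampled from `μ_t`. -/
  sample : ∀ t ∈ Finset.Icc 1 n, ∀ S : Set A, MeasurableSet S →
    P[(act t ⁻¹' S).indicator (fun _ => (1 : ℝ)) | past act fb t]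
      =ᵐ[P] fun ω => (μ t ω).real S

/-- The expected regret `max_a E[∑_{t=1}^n ⟨φ_a - φ_{a_t}, θ*⟩]`. -/
def regret (P : Measure Ω) (n : ℕ) (θstar : Euc d) (act : ℕ → Ω → A) : ℝ :=
  ⨆ a : A, ∫ ω, ∑ t ∈ Finset.Icc 1 n, inner ℝ (G.feat a - G.feat (act t ω)) θstar ∂P

end LinearPM

end

noncomputable section

/-! ### Positive operators on Euclidean space -/

section PositiveOperators

variable {r : ℕ} {T S : Euc r →L[ℝ] Euc r}

/-! One round is a comparison of the IDS distribution with explicit competitors. Let `a` be a Pareto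
optimal action that is optimal for the estimate `θ̂`, with estimated gap `D`, and let `c` be the
most informative action. For `θ` in the confidence set, pass from its best action to a Pareto
optimal one and subtract `θ̂`, where `a` is optimal: `D` is at most `⟨φ_b - φ_a, θ - θ̂⟩` for some
Pareto optimal `b` and some `θ`, up to taking suprema. The alignment constant and the determinant
inequality for the information gain give `D² ≤ 4 α β I(c)`. Mixing `a` with a small amount of `c`,
and mixing IDS itself with `a`, shows that the IDS gap `Δ` is at most `2D` and that `Δ³ ≤ 32 α
(Δ_max + 4B) β I` (`IsIDS.integral_gap_le`, `integral_gapEst_le_of_isIDS`).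

Instead of Hölder's inequality, the cube bound is linearized by the weighted inequality of
arithmetic and geometric means with fixed weights. The result can be summed and integrated term by
term, the information gains telescope, and the weights are optimized only at the end
(`le_rpow_of_forall_weights`).

The true parameter misses the confidence set of round `t` with probability at most `1/t²`. This
follows from the method of mixtures in the `r` coordinates of `W`
(`exists_measurableSet_selfNormalized_le`) and from first-order optimality of the constrained
estimate (`mem_confSet_of_selfNormalized_le`). Charging `Δ_max` to each failure costs `2 Δ_max` in
total.

The explicit bound needs more, because `C Δ_max` has no factor `α^{1/3}` and `α` may be small. A
deterministic estimate (`gapEst_true_le`) bounds the true gap of IDS by a multiple of `B √(α λ t)`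
even when the confidence set fails. Since `∑ √t / t²` converges, failures then cost `O(B √(α λ))`,
which is of order `α^{1/3}` when `α ≤ 1`. -/

lemma finrank_euc (r : ℕ) : Module.finrank ℝ (Euc r) = r := by simp

lemma inner_map_self_eq_sum_eigenvalues (hT : (T : Euc r →ₗ[ℝ] Euc r).IsSymmetric) (x : Euc r) :
    inner ℝ x (T x) = ∑ i, hT.eigenvalues (finrank_euc r) i *
      ((hT.eigenvectorBasis (finrank_euc r)).repr x i) ^ 2 := by
  set b := hT.eigenvectorBasis (finrank_euc r)
  rw [← b.repr.inner_map_map, PiLp.inner_apply]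
  refine Finset.sum_congr rfl fun i _ => ?_
  have h : b.repr (T x) i = hT.eigenvalues (finrank_euc r) i * b.repr x i :=
    hT.eigenvectorBasis_apply_self_apply (finrank_euc r) x i
  rw [h]
  simp
  ring

lemma eigenvalues_eq_inner (hT : (T : Euc r →ₗ[ℝ] Euc r).IsSymmetric) (i : Fin r) :
    hT.eigenvalues (finrank_euc r) i = inner ℝ (hT.eigenvectorBasis (finrank_euc r) i)
      (T (hT.eigenvectorBasis (finrank_euc r) i)) := by
  have h : T (hT.eigenvectorBasis (finrank_euc r) i) = hT.eigenvalues (finrank_euc r) i •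
      hT.eigenvectorBasis (finrank_euc r) i := hT.apply_eigenvectorBasis (finrank_euc r) i
  rw [h, real_inner_smul_right, real_inner_self_eq_norm_sq, OrthonormalBasis.norm_eq_one]
  simp

lemma le_eigenvalues (hT : (T : Euc r →ₗ[ℝ] Euc r).IsSymmetric) {c : ℝ}
    (h : ∀ x, c * ‖x‖ ^ 2 ≤ inner ℝ x (T x)) (i : Fin r) :
    c ≤ hT.eigenvalues (finrank_euc r) i := by
  rw [eigenvalues_eq_inner hT i]
  simpa using h (hT.eigenvectorBasis (finrank_euc r) i)

lemma eigenvalues_le (hT : (T : Euc r →ₗ[ℝ] Euc r).IsSymmetric) {c : ℝ}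
    (h : ∀ x, inner ℝ x (T x) ≤ c * ‖x‖ ^ 2) (i : Fin r) :
    hT.eigenvalues (finrank_euc r) i ≤ c := by
  rw [eigenvalues_eq_inner hT i]
  simpa using h (hT.eigenvectorBasis (finrank_euc r) i)

lemma det_eq_prod_eigenvalues (hT : (T : Euc r →ₗ[ℝ] Euc r).IsSymmetric) :
    T.det = ∏ i, hT.eigenvalues (finrank_euc r) i :=
  hT.det_eq_prod_eigenvalues (finrank_euc r)

lemma pow_le_det (hT : (T : Euc r →ₗ[ℝ] Euc r).IsSymmetric) {c : ℝ} (hc : 0 ≤ c)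
    (h : ∀ x, c * ‖x‖ ^ 2 ≤ inner ℝ x (T x)) : c ^ r ≤ T.det := by
  rw [det_eq_prod_eigenvalues hT]
  calc c ^ r = ∏ _i : Fin r, c := by simp
    _ ≤ _ := Finset.prod_le_prod (fun _ _ => hc) fun i _ => le_eigenvalues hT h i

lemma det_le_pow (hT : (T : Euc r →ₗ[ℝ] Euc r).IsSymmetric) {c : ℝ}
    (h0 : ∀ x, 0 ≤ inner ℝ x (T x))
    (h : ∀ x, inner ℝ x (T x) ≤ c * ‖x‖ ^ 2) : T.det ≤ c ^ r := by
  rw [det_eq_prod_eigenvalues hT]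
  calc _ ≤ ∏ _i : Fin r, c := Finset.prod_le_prod
        (fun i _ => le_eigenvalues hT (c := 0) (by simpa using h0) i)
        fun i _ => eigenvalues_le hT h i
    _ = c ^ r := by simp

lemma one_add_sum_le_prod {ι : Type*} (s : Finset ι) (f : ι → ℝ) (hf : ∀ i ∈ s, 1 ≤ f i) :
    1 + ∑ i ∈ s, (f i - 1) ≤ ∏ i ∈ s, f i := by
  classical
  induction s using Finset.induction_on with
  | empty => simp
  | insert a s ha ih =>
    rw [Finset.sum_insert ha, Finset.prod_insert ha]
    have h1 := ih fun i hi => hf i (Finset.mem_insert_of_mem hi)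
    have h2 := hf a (Finset.mem_insert_self a s)
    have h3 : 0 ≤ ∑ i ∈ s, (f i - 1) :=
      Finset.sum_nonneg fun i hi => by linarith [hf i (Finset.mem_insert_of_mem hi)]
    nlinarith

/-- In an eigenbasis the Rayleigh quotient is `1 + ∑ (l_i - 1) u_i²` with `u_i² ≤ 1`, while the
product of eigenvalues `l_i ≥ 1` dominates `1 + ∑ (l_i - 1)`. -/
lemma inner_map_self_le_det (hT : (T : Euc r →ₗ[ℝ] Euc r).IsSymmetric)
    (h : ∀ x, ‖x‖ ^ 2 ≤ inner ℝ x (T x)) {u : Euc r} (hu : ‖u‖ = 1) :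
    inner ℝ u (T u) ≤ T.det := by
  have h1 : ∀ i, 1 ≤ hT.eigenvalues (finrank_euc r) i := le_eigenvalues hT (by simpa using h)
  set b := hT.eigenvectorBasis (finrank_euc r)
  have hsum : ∑ i, (b.repr u i) ^ 2 = 1 := by
    have := EuclideanSpace.norm_sq_eq (b.repr u)
    rw [LinearIsometryEquiv.norm_map, hu] at this
    simpa using this.symm
  rw [inner_map_self_eq_sum_eigenvalues hT, det_eq_prod_eigenvalues hT]
  refine le_trans ?_ (one_add_sum_le_prod _ _ fun i _ => h1 i)
  rw [← hsum, ← Finset.sum_add_distrib]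
  refine Finset.sum_le_sum fun i _ => ?_
  have h2 : (b.repr u i) ^ 2 ≤ 1 := by
    rw [← hsum]
    exact Finset.single_le_sum (f := fun j => (b.repr u j) ^ 2) (fun j _ => sq_nonneg _)
      (Finset.mem_univ i)
  have h3 := h1 i
  change hT.eigenvalues (finrank_euc r) i * (b.repr u i) ^ 2 ≤ _
  nlinarith

/-- The root acts as `√l_i` on the eigenvector `b_i`. It serves as the change of variables in the
Cauchy-Schwarz, determinant and Gaussian lemmas below. -/
lemma exists_symmetric_sqrt (hT : (T : Euc r →ₗ[ℝ] Euc r).IsSymmetric)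
    (h : ∀ x, 0 ≤ inner ℝ x (T x)) :
    ∃ R : Euc r →L[ℝ] Euc r, (∀ x y, inner ℝ (R x) y = inner ℝ x (R y)) ∧ T = R ∘L R := by
  set b := hT.eigenvectorBasis (finrank_euc r) with hb
  set l := hT.eigenvalues (finrank_euc r) with hl
  have hl0 : ∀ i, 0 ≤ l i := le_eigenvalues hT (c := 0) (by simpa using h)
  let R : Euc r →L[ℝ] Euc r := ∑ i, √(l i) • (innerSL ℝ (b i)).smulRight (b i)
  have hR : ∀ x, R x = ∑ i, √(l i) • inner ℝ (b i) x • b i := fun x => by simp [R]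
  have hRb : ∀ j, R (b j) = √(l j) • b j := by
    intro j
    rw [hR, Finset.sum_eq_single j]
    · simp
    · intro i _ hij
      simp [b.inner_eq_zero hij]
    · simp
  refine ⟨R, fun x y => ?_, ?_⟩
  · rw [hR, hR, sum_inner, inner_sum]
    refine Finset.sum_congr rfl fun i _ => ?_
    simp only [real_inner_smul_left, real_inner_smul_right]
    rw [real_inner_comm x]
    ring
  · apply ContinuousLinearMap.coe_injective
    refine b.toBasis.ext fun i => ?_
    have : T (b i) = l i • b i := hT.apply_eigenvectorBasis (finrank_euc r) i
    simp only [OrthonormalBasis.coe_toBasis, ContinuousLinearMap.coe_coe,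
      ContinuousLinearMap.comp_apply, this, hRb, map_smul, smul_smul, Real.mul_self_sqrt (hl0 i)]

lemma det_comp_self (R : Euc r →L[ℝ] Euc r) : (R ∘L R).det = R.det ^ 2 := by
  rw [sq]
  exact LinearMap.det_comp _ _

/-- The Cauchy-Schwarz inequality for a positive operator. -/
lemma inner_map_le_sqrt_mul_sqrt (hT : (T : Euc r →ₗ[ℝ] Euc r).IsSymmetric)
    (h : ∀ x, 0 ≤ inner ℝ x (T x)) (x y : Euc r) :
    |inner ℝ x (T y)| ≤ √(inner ℝ x (T x)) * √(inner ℝ y (T y)) := by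
  obtain ⟨R, hR, rfl⟩ := exists_symmetric_sqrt hT h
  have hn : ∀ z, inner ℝ z ((R ∘L R) z) = ‖R z‖ ^ 2 := fun z => by
    rw [ContinuousLinearMap.comp_apply, ← hR, real_inner_self_eq_norm_sq]
  rw [hn, hn, Real.sqrt_sq (norm_nonneg _), Real.sqrt_sq (norm_nonneg _),
    ContinuousLinearMap.comp_apply, ← hR]
  exact abs_real_inner_le_norm _ _

/-- Adding a positive operator increases the determinant at least by its Rayleigh quotient. -/
lemma det_mul_one_add_le_det_add (hT : (T : Euc r →ₗ[ℝ] Euc r).IsSymmetric)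
    (hS : (S : Euc r →ₗ[ℝ] Euc r).IsSymmetric) {c : ℝ} (hc : 0 < c)
    (h : ∀ x, c * ‖x‖ ^ 2 ≤ inner ℝ x (T x)) (hS0 : ∀ x, 0 ≤ inner ℝ x (S x))
    {x : Euc r} (hx : x ≠ 0) :
    T.det * (1 + inner ℝ x (S x) / inner ℝ x (T x)) ≤ (T + S).det := by
  have hdet : 0 < T.det := lt_of_lt_of_le (pow_pos hc r) (pow_le_det hT hc.le h)
  obtain ⟨R, hR, rfl⟩ := exists_symmetric_sqrt hT fun x => le_trans (by positivity) (h x)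
  have hRdet : R.det ≠ 0 := by
    intro h0
    rw [det_comp_self, h0] at hdet
    simp at hdet
  set e := R.toContinuousLinearEquivOfDetNeZero hRdet with he
  have heR : ∀ z, e z = R z := fun z => by simp [he]
  set Q : Euc r →L[ℝ] Euc r := (e.symm : Euc r →L[ℝ] Euc r) with hQ
  have hRQ : ∀ z, R (Q z) = z := fun z => by rw [← heR]; simp [hQ]
  have hQR : ∀ z, Q (R z) = z := fun z => by rw [← heR]; simp [hQ]
  have hQs : ∀ y z, inner ℝ (Q y) z = inner ℝ y (Q z) := fun y z => by
    conv_lhs => rw [← hRQ z, ← hR, hRQ]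
  -- With `Q = R⁻¹`, `T + S = R U R` and `U ≥ 1`, so the ratio of determinants is `det U`. The
  -- Rayleigh quotient of `U` at `R x / ‖R x‖` is exactly `1 + ⟨x, S x⟩ / ⟨x, T x⟩`.
  let U : Euc r →L[ℝ] Euc r := ContinuousLinearMap.id ℝ _ + Q ∘L S ∘L Q
  have hUs : (U : Euc r →ₗ[ℝ] Euc r).IsSymmetric := by
    intro y z
    have : inner ℝ (S (Q y)) (Q z) = inner ℝ (Q y) (S (Q z)) := hS (Q y) (Q z)
    simp [U, inner_add_left, inner_add_right, hQs, this]
  have hU : ∀ z, inner ℝ z (U z) = ‖z‖ ^ 2 + inner ℝ (Q z) (S (Q z)) := fun z => by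
    simp [U, inner_add_right, hQs]
  have hTS : R ∘L R + S = R ∘L U ∘L R := by
    ext1 z
    simp [U, hRQ, hQR]
  have hdTS : (R ∘L R + S).det = (R ∘L R).det * U.det := by
    rw [hTS, det_comp_self]
    have h1 : (R ∘L U ∘L R).det = R.det * (U.det * R.det) := by
      rw [show (R ∘L U ∘L R).det = R.det * (U ∘L R).det from LinearMap.det_comp _ _,
        show (U ∘L R).det = U.det * R.det from LinearMap.det_comp _ _]
    rw [h1]; ring
  rw [hdTS]
  refine mul_le_mul_of_nonneg_left ?_ hdet.le
  have hRx : R x ≠ 0 := fun h0 => hx (by rw [← hQR x, h0, map_zero])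
  have hRxn : 0 < ‖R x‖ := norm_pos_iff.2 hRx
  have key := inner_map_self_le_det hUs
    (fun z => by rw [hU]; linarith [hS0 (Q z)]) (u := ‖R x‖⁻¹ • R x)
    (by rw [norm_smul, norm_inv, norm_norm, inv_mul_cancel₀ hRxn.ne'])
  refine le_trans (le_of_eq ?_) key
  have h2 : inner ℝ x ((R ∘L R) x) = ‖R x‖ ^ 2 := by
    rw [ContinuousLinearMap.comp_apply, ← hR, real_inner_self_eq_norm_sq]
  rw [hU, h2, map_smul, hQR, map_smul, real_inner_smul_left, real_inner_smul_right, norm_smul,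
    norm_inv, norm_norm, inv_mul_cancel₀ hRxn.ne']
  field_simp

lemma det_le_det_add (hT : (T : Euc r →ₗ[ℝ] Euc r).IsSymmetric)
    (hS : (S : Euc r →ₗ[ℝ] Euc r).IsSymmetric) {c : ℝ} (hc : 0 < c)
    (h : ∀ x, c * ‖x‖ ^ 2 ≤ inner ℝ x (T x)) (hS0 : ∀ x, 0 ≤ inner ℝ x (S x)) :
    T.det ≤ (T + S).det := by
  by_cases hr : ∃ x : Euc r, x ≠ 0
  · obtain ⟨x, hx⟩ := hr
    refine le_trans ?_ (det_mul_one_add_le_det_add hT hS hc h hS0 hx)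
    have hdet : 0 < T.det := lt_of_lt_of_le (pow_pos hc r) (pow_le_det hT hc.le h)
    have h1 : 0 ≤ inner ℝ x (S x) / inner ℝ x (T x) :=
      div_nonneg (hS0 x) (le_trans (by positivity) (h x))
    nlinarith
  · push Not at hr
    have : T + S = T := by
      ext1 x
      rw [hr x]; simp
    rw [this]

/-- A shifted Gaussian integral with covariance `(κ T)⁻¹`. -/
lemma lintegral_exp_inner_sub (hT : (T : Euc r →ₗ[ℝ] Euc r).IsSymmetric) {c : ℝ} (hc : 0 < c)
    (h : ∀ x, c * ‖x‖ ^ 2 ≤ inner ℝ x (T x)) {κ : ℝ} (hκ : 0 < κ) (w : Euc r) :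
    ∫⁻ z, ENNReal.ofReal (Real.exp (inner ℝ z (T w) - κ / 2 * inner ℝ z (T z))) =
      ENNReal.ofReal (Real.exp (inner ℝ w (T w) / (2 * κ)) * (√T.det)⁻¹) *
        ∫⁻ z : Euc r, ENNReal.ofReal (Real.exp (-(κ / 2) * ‖z‖ ^ 2)) := by
  have hdet : 0 < T.det := lt_of_lt_of_le (pow_pos hc r) (pow_le_det hT hc.le h)
  obtain ⟨R, hR, rfl⟩ := exists_symmetric_sqrt hT fun x => le_trans (by positivity) (h x)
  have hRdet : R.det ≠ 0 := by
    intro h0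
    rw [det_comp_self, h0] at hdet
    simp at hdet
  -- Complete the square around `κ⁻¹ w`; after translation, substituting `R z` costs `|det R|⁻¹ =
  -- (√det T)⁻¹`.
  have h1 : ∀ z, inner ℝ z ((R ∘L R) w) - κ / 2 * inner ℝ z ((R ∘L R) z) =
      inner ℝ w ((R ∘L R) w) / (2 * κ) + -(κ / 2) * ‖R (z - κ⁻¹ • w)‖ ^ 2 := by
    intro z
    have h2 : ∀ x y, inner ℝ x (R (R y)) = inner ℝ (R x) (R y) := fun x y => (hR x (R y)).symm
    simp only [ContinuousLinearMap.comp_apply, h2, map_sub, map_smul, norm_sub_sq_real,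
      real_inner_self_eq_norm_sq, real_inner_smul_right, norm_smul, mul_pow, norm_inv,
      Real.norm_of_nonneg hκ.le]
    field_simp
    ring
  simp_rw [h1, Real.exp_add, ENNReal.ofReal_mul (Real.exp_nonneg _)]
  rw [lintegral_const_mul' _ _ ENNReal.ofReal_ne_top, mul_assoc]
  congr 1
  rw [lintegral_sub_right_eq_self
    (fun z => ENNReal.ofReal (Real.exp (-(κ / 2) * ‖R z‖ ^ 2))) (κ⁻¹ • w)]
  have hm := Measure.map_linearMap_addHaar_eq_smul_addHaar (volume : Measure (Euc r))
    (f := (R : Euc r →ₗ[ℝ] Euc r)) hRdet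
  have h2 : ∫⁻ z, ENNReal.ofReal (Real.exp (-(κ / 2) * ‖R z‖ ^ 2)) =
      ∫⁻ z, ENNReal.ofReal (Real.exp (-(κ / 2) * ‖z‖ ^ 2))
        ∂(Measure.map (R : Euc r →ₗ[ℝ] Euc r) volume) := by
    exact (lintegral_map (f := fun z : Euc r => ENNReal.ofReal (Real.exp (-(κ / 2) * ‖z‖ ^ 2)))
      (by fun_prop) R.continuous.measurable).symm
  rw [h2, hm, lintegral_smul_measure, smul_eq_mul]
  congr 2
  rw [det_comp_self, Real.sqrt_sq_eq_abs, abs_inv]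

lemma lintegral_exp_neg_sq_ne_top {κ : ℝ} (hκ : 0 < κ) :
    ∫⁻ z : Euc r, ENNReal.ofReal (Real.exp (-κ * ‖z‖ ^ 2)) ≠ ∞ := by
  have h0 := GaussianFourier.integrable_cexp_neg_mul_sq_norm_add (b := (κ : ℂ)) (by simpa) 0
    (0 : Euc r)
  have h1 : Integrable fun z : Euc r => Real.exp (-κ * ‖z‖ ^ 2) := by
    refine h0.norm.congr (Filter.Eventually.of_forall fun z => ?_)
    simp [Complex.norm_exp, ← Complex.ofReal_pow]
  rw [← ofReal_integral_eq_lintegral_ofReal h1 (Filter.Eventually.of_forall fun _ =>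
    Real.exp_nonneg _)]
  exact ENNReal.ofReal_ne_top

lemma lintegral_exp_neg_sq_ne_zero (κ : ℝ) :
    ∫⁻ z : Euc r, ENNReal.ofReal (Real.exp (-κ * ‖z‖ ^ 2)) ≠ 0 := by
  intro h
  rw [lintegral_eq_zero_iff (by fun_prop)] at h
  have := Filter.Eventually.exists h
  obtain ⟨z, hz⟩ := this
  have : 0 < Real.exp (-κ * ‖z‖ ^ 2) := Real.exp_pos _
  simp only [Pi.zero_apply, ENNReal.ofReal_eq_zero] at hz
  linarith

end PositiveOperators

/-! ### Covering by Pareto optimal cells -/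

section Covering

variable {E : Type*} [NormedAddCommGroup E] [NormedSpace ℝ E]

lemma lineMap_mem_of_two_mem (H : AffineSubspace ℝ E) {x y : E} {s t : ℝ} (hst : s ≠ t)
    (hs : AffineMap.lineMap x y s ∈ H) (ht : AffineMap.lineMap x y t ∈ H) (u : ℝ) :
    AffineMap.lineMap x y u ∈ H := by
  have hts : t - s ≠ 0 := sub_ne_zero.2 hst.symm
  have h := AffineMap.lineMap_mem ((u - s) / (t - s)) hs ht
  convert h using 1
  have hu : u = s + (u - s) / (t - s) * (t - s) := by field_simp; ring
  simp only [AffineMap.lineMap_apply_module']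
  rw [show (t • (y - x) + x - (s • (y - x) + x)) = (t - s) • (y - x) by module, smul_smul]
  conv_lhs => rw [hu]
  module

/-- Join a point `x` that avoids the earlier subspaces to a point `y` outside the new one. The line
through them meets each subspace at most once, since otherwise `x` or `y` would lie in it; finitely
many parameters of an infinite segment are excluded. -/
lemma Convex.exists_mem_forall_notMem_affineSubspace {K : Set E} (hK : Convex ℝ K)
    (hne : K.Nonempty) {ι : Type*} (s : Finset ι) (H : ι → AffineSubspace ℝ E)
    (h : ∀ i ∈ s, ¬ K ⊆ H i) : ∃ x ∈ K, ∀ i ∈ s, x ∉ H i := by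
  classical
  induction s using Finset.induction_on with
  | empty => exact ⟨hne.some, hne.some_mem, by simp⟩
  | insert j s _ ih =>
    obtain ⟨x, hx, hxs⟩ := ih fun i hi => h i (Finset.mem_insert_of_mem hi)
    obtain ⟨y, hy, hyj⟩ := Set.not_subset.1 (h j (Finset.mem_insert_self j s))
    let bad : Set ℝ := ⋃ i ∈ insert j s, {t | AffineMap.lineMap x y t ∈ H i}
    have hbad : bad.Finite := by
      refine Set.Finite.biUnion (insert j s).finite_toSet fun i hi => Set.Subsingleton.finite ?_
      intro t ht u hu
      by_contra htu
      have hall := lineMap_mem_of_two_mem (H i) htu ht hu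
      rcases Finset.mem_insert.1 hi with rfl | hi
      · exact hyj (by simpa using hall 1)
      · exact hxs i hi (by simpa using hall 0)
    obtain ⟨t, ht, htb⟩ := ((Set.Icc_infinite (zero_lt_one' ℝ)).sdiff hbad).nonempty
    refine ⟨AffineMap.lineMap x y t, hK.lineMap_mem hx hy ht, fun i hi hmem => htb ?_⟩
    exact Set.mem_biUnion hi hmem

end Covering

namespace LinearPM

variable {A : Type*} {d m r : ℕ} {G : LinearPM A d m}

lemma pareto_of_params_subset {a : A} (hne : (G.cell a).Nonempty)
    (h : G.params ⊆ affineSpan ℝ (G.cell a)) : G.Pareto a := by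
  refine ⟨hne, ?_⟩
  suffices hv : vectorSpan ℝ (G.cell a) = vectorSpan ℝ G.params by rw [hv]
  apply le_antisymm
  · exact vectorSpan_mono ℝ fun _ hx => hx.1
  · rw [← direction_affineSpan ℝ (G.cell a)]
    have h2 : affineSpan ℝ G.params ≤ affineSpan ℝ (G.cell a) := affineSpan_le.2 h
    rw [← direction_affineSpan ℝ G.params]
    exact AffineSubspace.direction_le h2

/-- Choose `θ'` outside the affine hulls of all cells that are not Pareto optimal and approach `θ`
along the segment from `θ'`. Some action is optimal at infinitely many of these points, hence at `θ`
by continuity. If it were not Pareto optimal, its affine hull would contain two points of the line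
and therefore `θ'`. -/
lemma paretoCovers_of_finite [Finite A] [Nonempty A] (hc : Convex ℝ G.params) :
    G.ParetoCovers := by
  classical
  have := Fintype.ofFinite A
  intro θ hθ
  obtain ⟨θ', hθ', hgen⟩ := hc.exists_mem_forall_notMem_affineSubspace ⟨θ, hθ⟩
    (Finset.univ.filter fun a => ¬ G.Pareto a) (fun a => affineSpan ℝ (G.cell a)) (by
      intro a ha hsub
      have hna : ¬ G.Pareto a := (Finset.mem_filter.1 ha).2
      by_cases hne : (G.cell a).Nonempty
      · exact hna (pareto_of_params_subset hne hsub)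
      · rw [Set.not_nonempty_iff_eq_empty] at hne
        rw [hne] at hsub
        simpa using hsub hθ)
  let p : ℕ → Euc d := fun k => AffineMap.lineMap θ θ' (1 / ((k : ℝ) + 1))
  have hpos : ∀ k : ℕ, (0 : ℝ) < 1 / ((k : ℝ) + 1) := fun k => by positivity
  have hp : ∀ k, p k ∈ G.params := fun k => hc.lineMap_mem hθ hθ'
    ⟨(hpos k).le, by rw [div_le_one (by positivity)]; linarith [k.cast_nonneg (α := ℝ)]⟩
  have hbest : ∀ k, ∃ a, p k ∈ G.cell a := fun k => by
    obtain ⟨a, ha⟩ := Finite.exists_max fun a => inner ℝ (G.feat a) (p k)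
    exact ⟨a, hp k, ha⟩
  choose f hf using hbest
  obtain ⟨a, ha⟩ := Finite.exists_infinite_fiber f
  have hinf : (f ⁻¹' {a}).Infinite := Set.infinite_coe_iff.1 ha
  have hmem : ∀ k ∈ f ⁻¹' {a}, p k ∈ G.cell a := fun k hk => by
    have : f k = a := hk
    exact this ▸ hf k
  refine ⟨a, ?_, hθ, fun b => ?_⟩
  · by_contra hna
    obtain ⟨k, hk, l, hl, hkl⟩ := hinf.nontrivial
    refine hgen a (by simp [hna]) ?_
    have := lineMap_mem_of_two_mem (affineSpan ℝ (G.cell a)) (x := θ) (y := θ')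
      (s := 1 / ((k : ℝ) + 1)) (t := 1 / ((l : ℝ) + 1)) ?_
      (subset_affineSpan ℝ _ (hmem k hk)) (subset_affineSpan ℝ _ (hmem l hl)) 1
    · simpa using this
    · intro h
      apply hkl
      have h1 : ((k : ℝ) + 1) ≠ 0 := by positivity
      have h2 : ((l : ℝ) + 1) ≠ 0 := by positivity
      field_simp at h
      exact_mod_cast (by linarith : (k : ℝ) = l)
  · have hlim : Filter.Tendsto (fun k => inner ℝ (G.feat a - G.feat b) (p k)) Filter.atTop
        (nhds (inner ℝ (G.feat a - G.feat b) θ)) := by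
      have h1 : Filter.Tendsto p Filter.atTop (nhds (AffineMap.lineMap θ θ' (0 : ℝ))) :=
        ((AffineMap.lineMap_continuous (R := ℝ) (p := θ) (q := θ')).tendsto 0).comp
          tendsto_one_div_add_atTop_nhds_zero_nat
      rw [AffineMap.lineMap_apply_zero] at h1
      exact tendsto_const_nhds.inner h1
    have h0 : (0 : ℝ) ≤ inner ℝ (G.feat a - G.feat b) θ := by
      refine ge_of_tendsto_of_frequently hlim ?_
      refine (Nat.frequently_atTop_iff_infinite.2 hinf).mono fun k hk => ?_
      rw [inner_sub_left]
      linarith [(hmem k hk).2 b]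
    rw [inner_sub_left] at h0
    linarith

/-! ### The alignment constant -/

/-- A common bound `X` on all `‖M_c ν‖²` replaces the infimum over `c`. Finiteness of `α` covers `X
= 0`, where it forces the left side to vanish. -/
lemma inner_sq_le_alignment_mul (hfin : G.alignment ≠ ∞) {ν : Euc d} (hν : ν ∈ G.diffSpan)
    {a b : A} (ha : G.Pareto a) (hb : G.Pareto b) {X : ℝ} (hX : 0 ≤ X)
    (h : ∀ c, ‖G.obs c ν‖ ^ 2 ≤ X) :
    inner ℝ (G.feat a - G.feat b) ν ^ 2 ≤ G.alignment.toReal * X := by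
  have h1 : ENNReal.ofReal (inner ℝ (G.feat a - G.feat b) ν ^ 2) / ENNReal.ofReal X ≤
      G.alignment := by
    refine le_trans ?_ (le_iSup₂_of_le (f := fun ν (_ : ν ∈ G.diffSpan) =>
      ⨆ (a : A) (_ : G.Pareto a) (b : A) (_ : G.Pareto b), ⨅ c : A,
        ENNReal.ofReal (inner ℝ (G.feat a - G.feat b) ν ^ 2) /
          ENNReal.ofReal (‖G.obs c ν‖ ^ 2)) ν hν
      (le_iSup₂_of_le a ha (le_iSup₂_of_le b hb le_rfl)))
    exact le_iInf fun c => ENNReal.div_le_div_left (ENNReal.ofReal_le_ofReal (h c)) _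
  rw [ENNReal.div_le_iff_le_mul (Or.inr hfin) (Or.inl ENNReal.ofReal_ne_top),
    ← ENNReal.ofReal_toReal hfin, ← ENNReal.ofReal_mul ENNReal.toReal_nonneg,
    ENNReal.ofReal_le_ofReal_iff (mul_nonneg ENNReal.toReal_nonneg hX)] at h1
  exact h1

lemma sub_mem_diffSpan {θ ν : Euc d} (hθ : θ ∈ G.params) (hν : ν ∈ G.params) :
    θ - ν ∈ G.diffSpan :=
  Submodule.subset_span ⟨θ, hθ, ν, hν, rfl⟩

/-- Elements of the span of `Proj M_cᵀ w`, up to a uniform constant, are controlled by the largest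
observation of a direction. -/
lemma exists_bound_inner_of_mem_span (U : Submodule ℝ (Euc d)) :
    ∃ K : ℝ, 0 ≤ K ∧ ∀ y ∈ Submodule.span ℝ {v | ∃ c, ∃ w : Euc m,
        v = U.starProjection ((G.obs c).adjoint w)}, ∀ ν ∈ U, ∀ X : ℝ,
      (∀ c, ‖G.obs c ν‖ ≤ X) → |inner ℝ y ν| ≤ K * ‖y‖ * X := by
  classical
  set S : Set (Euc d) := {v | ∃ c, ∃ w : Euc m, v = U.starProjection ((G.obs c).adjoint w)}
  obtain ⟨T, hTS, hspan⟩ := (Submodule.fg_span_iff_fg_span_finset_subset S).1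
    (IsNoetherian.noetherian (Submodule.span ℝ S))
  choose c w hcw using fun v : T => (hTS v.2 : ∃ c, ∃ w : Euc m, _)
  let L : (T → ℝ) →ₗ[ℝ] Euc d := Fintype.linearCombination ℝ (fun v : T => (v : Euc d))
  have hrange : LinearMap.range L = Submodule.span ℝ S := by
    rw [hspan, Fintype.range_linearCombination]
    simp
  -- A linear right inverse picks coefficients that depend continuously on `y`, hence of size at
  -- most `‖g'‖ ‖y‖`. This makes `K` independent of `y`.
  obtain ⟨g, hg⟩ := L.rangeRestrict.exists_rightInverse_of_surjective
    (LinearMap.range_rangeRestrict L)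
  let g' : LinearMap.range L →L[ℝ] (T → ℝ) := LinearMap.toContinuousLinearMap g
  refine ⟨∑ v : T, ‖g'‖ * ‖w v‖, by positivity, fun y hy ν hν X hX => ?_⟩
  rw [← hrange] at hy
  have hLy : L (g' ⟨y, hy⟩) = y := by
    have := LinearMap.congr_fun hg ⟨y, hy⟩
    exact congrArg Subtype.val this
  have hsum : inner ℝ y ν = ∑ v : T, g' ⟨y, hy⟩ v * inner ℝ (v : Euc d) ν := by
    conv_lhs => rw [← hLy]
    simp [L, Fintype.linearCombination_apply, sum_inner, real_inner_smul_left]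
  have hv : ∀ v : T, |inner ℝ (v : Euc d) ν| ≤ ‖w v‖ * X := by
    intro v
    have hP : U.starProjection ν = ν := Submodule.starProjection_eq_self_iff.2 hν
    have : inner ℝ (v : Euc d) ν = inner ℝ (w v) (G.obs (c v) ν) := by
      conv_lhs => rw [hcw v]
      rw [Submodule.inner_starProjection_left_eq_right, hP,
        ContinuousLinearMap.adjoint_inner_left]
    rw [this]
    exact (abs_real_inner_le_norm _ _).trans
      (mul_le_mul_of_nonneg_left (hX _) (norm_nonneg _))
  rw [hsum, Finset.sum_mul, Finset.sum_mul]
  refine (Finset.abs_sum_le_sum_abs _ _).trans (Finset.sum_le_sum fun v _ => ?_)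
  rw [abs_mul]
  have h1 : |g' ⟨y, hy⟩ v| ≤ ‖g'‖ * ‖y‖ :=
    (norm_le_pi_norm (g' ⟨y, hy⟩) v).trans (g'.le_opNorm _)
  calc |g' ⟨y, hy⟩ v| * |inner ℝ (v : Euc d) ν| ≤ (‖g'‖ * ‖y‖) * (‖w v‖ * X) :=
        mul_le_mul h1 (hv v) (abs_nonneg _) (by positivity)
    _ = _ := by ring

/-- Take `c` maximizing `‖M_c ν‖`, by compactness. The projected feature differences have norm at
most `2`, so the uniform span estimate gives the single bound `(2K)²` for all `ν, a, b`, even if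
there are infinitely many actions. -/
lemma alignment_ne_top [TopologicalSpace A] [CompactSpace A] [Nonempty A] {θ₀ : Euc d} {L B : ℝ}
    (hB : G.Bounded θ₀ L B) (hG : G.GloballyObservable) : G.alignment ≠ ∞ := by
  obtain ⟨K, hK0, hK⟩ := exists_bound_inner_of_mem_span (G := G) G.diffSpan
  refine ne_top_of_le_ne_top (ENNReal.ofReal_ne_top (r := (K * 2) ^ 2)) ?_
  refine iSup₂_le fun ν hν => iSup₂_le fun a ha => iSup₂_le fun b hb => ?_
  obtain ⟨c, -, hc⟩ := isCompact_univ.exists_isMaxOn (Set.univ_nonempty (α := A))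
    (f := fun c => ‖G.obs c ν‖) (hB.continuous_obs.clm_apply continuous_const).norm.continuousOn
  refine iInf_le_of_le c (ENNReal.div_le_of_le_mul ?_)
  rw [← ENNReal.ofReal_mul (by positivity)]
  refine ENNReal.ofReal_le_ofReal ?_
  set y := G.diffSpan.starProjection (G.feat a - G.feat b) with hy
  have hyn : ‖y‖ ≤ 2 := by
    refine (G.diffSpan.norm_starProjection_apply_le _).trans ((norm_sub_le _ _).trans ?_)
    linarith [hB.feat_bound a, hB.feat_bound b]
  have h1 := hK y (hG a b ha hb) ν hν ‖G.obs c ν‖ fun c' => hc (Set.mem_univ c')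
  have h2 : inner ℝ (G.feat a - G.feat b) ν = inner ℝ y ν := by
    rw [hy, Submodule.inner_starProjection_left_eq_right,
      Submodule.starProjection_eq_self_iff.2 hν]
  rw [h2, ← sq_abs, ← mul_pow]
  refine pow_le_pow_left₀ (abs_nonneg _) (h1.trans ?_) 2
  gcongr

lemma ValidBasis.obs_eq_of_mem {W : Euc r →L[ℝ] Euc d} (hW : G.ValidBasis W) (c : A) {ν : Euc d}
    (hν : ν ∈ G.diffSpan) : G.obs c ν = G.obs c (W (W.adjoint ν)) := by
  have h : G.diffSpan ≤ LinearMap.eqLocus (G.obs c : Euc d →ₗ[ℝ] Euc m)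
      ((G.obs c ∘L W ∘L W.adjoint : Euc d →L[ℝ] Euc m) : Euc d →ₗ[ℝ] Euc m) := by
    refine Submodule.span_le.2 ?_
    rintro _ ⟨θ, hθ, θ', hθ', rfl⟩
    exact hW.obs_eq c θ hθ θ' hθ'
  exact h hν

/-- For `r = 0` every direction of `diffSpan` is unobservable, and a finite `α` then leaves no
reward difference. The explicit bound needs this because its right side is zero for `r = 0`. -/
lemma alignment_eq_zero_of_rank_zero [TopologicalSpace A] [CompactSpace A] [Nonempty A]
    {θ₀ : Euc d} {L B : ℝ} {W : Euc 0 →L[ℝ] Euc d} (hB : G.Bounded θ₀ L B)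
    (hW : G.ValidBasis W) (hG : G.GloballyObservable) : G.alignment = 0 := by
  have hfin := alignment_ne_top hB hG
  refine le_antisymm ?_ bot_le
  refine iSup₂_le fun ν hν => iSup₂_le fun a ha => iSup₂_le fun b hb => ?_
  have h0 := inner_sq_le_alignment_mul hfin hν ha hb le_rfl fun c => by
    rw [hW.obs_eq_of_mem c hν, Subsingleton.elim (W.adjoint ν) 0]
    simp
  rw [mul_zero] at h0
  refine iInf_le_of_le (Classical.arbitrary A) ?_
  rw [ENNReal.ofReal_of_nonpos h0]
  simp

end LinearPM

/-! ### Information ratio -/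

section InfoRatio

variable {A : Type*} [MeasurableSpace A]

lemma Continuous.integrable_of_compactSpace [TopologicalSpace A] [CompactSpace A] [BorelSpace A]
    {f : A → ℝ} (hf : Continuous f) (μ : Measure A) [IsFiniteMeasure μ] : Integrable f μ := by
  obtain ⟨C, hC⟩ := isCompact_univ.exists_bound_of_continuousOn hf.continuousOn
  exact Integrable.of_bound hf.measurable.aestronglyMeasurable C
    (Filter.Eventually.of_forall fun a => hC a (Set.mem_univ a))

/-- The cross-multiplied form survives zero information under `μ`: as `x / 0 = ∞`, a finite ratio
then forces a zero gap. -/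
lemma sq_mul_le_of_infoRatio_le {gap info : A → ℝ} {μ ν : Measure A}
    (hμ : 0 ≤ ∫ a, info a ∂μ) (hν : 0 < ∫ a, info a ∂ν)
    (h : infoRatio gap info μ ≤ infoRatio gap info ν) :
    (∫ a, gap a ∂μ) ^ 2 * ∫ a, info a ∂ν ≤ (∫ a, gap a ∂ν) ^ 2 * ∫ a, info a ∂μ := by
  unfold infoRatio at h
  rw [← ENNReal.ofReal_div_of_pos hν] at h
  rcases hμ.eq_or_lt with h0 | h0
  · rw [← h0] at h ⊢
    by_contra hne
    have hpos : 0 < (∫ a, gap a ∂μ) ^ 2 := by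
      rw [mul_zero, not_le] at hne
      exact (pos_iff_pos_of_mul_pos hne).2 hν
    rw [ENNReal.ofReal_zero, ENNReal.div_zero (ENNReal.ofReal_pos.2 hpos).ne'] at h
    exact ENNReal.ofReal_ne_top (top_le_iff.1 h)
  · rw [← ENNReal.ofReal_div_of_pos h0, ENNReal.ofReal_le_ofReal_iff (by positivity),
      div_le_div_iff₀ h0 hν] at h
    exact h

/-- The mixture `(1 - p) μ + p δ_a`. -/
def mixDirac (μ : Measure A) (p : ℝ) (a : A) : Measure A :=
  ENNReal.ofReal (1 - p) • μ + ENNReal.ofReal p • Measure.dirac a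

lemma isProbabilityMeasure_mixDirac (μ : Measure A) [IsProbabilityMeasure μ] {p : ℝ} (hp : 0 ≤ p)
    (hp1 : p ≤ 1) (a : A) : IsProbabilityMeasure (mixDirac μ p a) := by
  constructor
  simp only [mixDirac, Measure.add_apply, Measure.smul_apply, measure_univ, smul_eq_mul, mul_one]
  rw [← ENNReal.ofReal_add (by linarith) hp]
  simp

lemma integral_mixDirac (μ : Measure A) {p : ℝ} (hp : 0 ≤ p)
    (hp1 : p ≤ 1) (a : A) {f : A → ℝ} (hm : Measurable f) (hf : Integrable f μ) :
    ∫ x, f x ∂(mixDirac μ p a) = (1 - p) * ∫ x, f x ∂μ + p * f a := by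
  have hd : Integrable f (Measure.dirac a) := by
    rw [← memLp_one_iff_integrable]
    refine ⟨hm.aestronglyMeasurable, ?_⟩
    simp only [eLpNorm_one_eq_lintegral_enorm]
    rw [lintegral_dirac' _ hm.enorm]
    simp
  unfold mixDirac
  rw [integral_add_measure (hf.smul_measure ENNReal.ofReal_ne_top)
    (hd.smul_measure ENNReal.ofReal_ne_top), integral_smul_measure, integral_smul_measure,
    integral_dirac' _ _ hm.stronglyMeasurable, ENNReal.toReal_ofReal (by linarith),
    ENNReal.toReal_ofReal hp]
  simp

variable [TopologicalSpace A] [CompactSpace A] [BorelSpace A]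

/-- The gap of an IDS distribution is at most twice the gap of any action, and its third power is
controlled by the information gain. -/
lemma IsIDS.integral_gap_le {gap info : A → ℝ} {μ : Measure A} (h : IsIDS gap info μ)
    (hgap : Continuous gap) (hinfo : Continuous info) (hgap0 : ∀ a, 0 ≤ gap a)
    (hinfo0 : ∀ a, 0 ≤ info a) {a c : A} {g k : ℝ} (hk : 0 ≤ k)
    (hag : gap a ≤ g) (hcg : gap c ≤ g) (hsq : gap a ^ 2 ≤ k * info c) :
    ∫ x, gap x ∂μ ≤ 2 * gap a ∧ (∫ x, gap x ∂μ) ^ 3 ≤ 8 * k * g * ∫ x, info x ∂μ := by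
  obtain ⟨hμ, hmin⟩ := h
  have hig := hgap.integrable_of_compactSpace μ
  have hii := hinfo.integrable_of_compactSpace μ
  have hΔ0 : 0 ≤ ∫ x, gap x ∂μ := integral_nonneg hgap0
  have hI0 : 0 ≤ ∫ x, info x ∂μ := integral_nonneg hinfo0
  set Δ := ∫ x, gap x ∂μ with hΔ
  set I := ∫ x, info x ∂μ with hI
  have hg0 : 0 ≤ g := (hgap0 a).trans hag
  -- If `gap a = 0`, the Dirac measure at `a` has ratio `0`, also when it carries no information.
  -- Hence IDS has ratio `0`, and since its information is finite, its gap is `0`.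
  rcases (hgap0 a).eq_or_lt with hD | hD
  · have h1 := hmin (Measure.dirac a) inferInstance
    have h2 : infoRatio gap info (Measure.dirac a) = 0 := by
      unfold infoRatio
      rw [integral_dirac' _ _ hgap.measurable.stronglyMeasurable, ← hD]
      simp
    rw [h2, nonpos_iff_eq_zero] at h1
    unfold infoRatio at h1
    rw [ENNReal.div_eq_zero_iff] at h1
    have h3 : Δ ^ 2 ≤ 0 := by simpa using h1.resolve_right ENNReal.ofReal_ne_top
    have h4 : Δ = 0 := by
      have := le_antisymm h3 (sq_nonneg _)
      simpa using this
    rw [h4]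
    refine ⟨by positivity, ?_⟩
    have : 0 ≤ 8 * k * g * I := by positivity
    simpa using this
  set D := gap a with hDdef
  have hc : 0 < info c := by
    refine (hinfo0 c).lt_of_ne fun h0 => ?_
    rw [← h0, mul_zero] at hsq
    exact absurd (sq_pos_of_pos hD) (not_lt.2 hsq)
  have hgpos : 0 < g := hD.trans_le hag
  have hp0 : 0 < D / g := div_pos hD hgpos
  have hp1 : D / g ≤ 1 := (div_le_one hgpos).2 hag
  have hDp : Integrable gap (Measure.dirac a) := hgap.integrable_of_compactSpace _
  have hIp : Integrable info (Measure.dirac a) := hinfo.integrable_of_compactSpace _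
  -- Compare with `(1 - p) δ_a + p δ_c` for `p = D / g`: its gap is at most `D + p g = 2D` and its
  -- information at least `p * info c`.
  have hcmp : Δ ^ 2 * info c ≤ 4 * D * g * I := by
    have hg1 := integral_mixDirac (Measure.dirac a) hp0.le hp1 c hgap.measurable hDp
    have hi1 := integral_mixDirac (Measure.dirac a) hp0.le hp1 c hinfo.measurable hIp
    rw [integral_dirac' _ _ hgap.measurable.stronglyMeasurable] at hg1
    rw [integral_dirac' _ _ hinfo.measurable.stronglyMeasurable] at hi1
    have hi2 : D / g * info c ≤ ∫ x, info x ∂(mixDirac (Measure.dirac a) (D / g) c) := by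
      rw [hi1]
      have := mul_nonneg (sub_nonneg.2 hp1) (hinfo0 a)
      linarith
    have hg2 : ∫ x, gap x ∂(mixDirac (Measure.dirac a) (D / g) c) ≤ 2 * D := by
      rw [hg1]
      have h1 : D / g * gap c ≤ D / g * g := mul_le_mul_of_nonneg_left hcg hp0.le
      have h2 : D / g * g = D := div_mul_cancel₀ _ hgpos.ne'
      have h3 : 0 ≤ D / g * D := by positivity
      rw [← hDdef]
      nlinarith
    have hg3 : 0 ≤ ∫ x, gap x ∂(mixDirac (Measure.dirac a) (D / g) c) := integral_nonneg hgap0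
    have := sq_mul_le_of_infoRatio_le hI0 (lt_of_lt_of_le (by positivity) hi2)
      (hmin _ (isProbabilityMeasure_mixDirac _ hp0.le hp1 c))
    have h5 : Δ ^ 2 * (D / g * info c) ≤ (2 * D) ^ 2 * I :=
      calc _ ≤ _ := mul_le_mul_of_nonneg_left hi2 (sq_nonneg _)
        _ ≤ _ := this
        _ ≤ _ := mul_le_mul_of_nonneg_right (pow_le_pow_left₀ hg3 hg2 2) hI0
    have h6 : D * (Δ ^ 2 * info c) ≤ D * (4 * D * g * I) := by
      have h7 : D * (Δ ^ 2 * info c) = g * (Δ ^ 2 * (D / g * info c)) := by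
        field_simp
      rw [h7]
      calc _ ≤ g * ((2 * D) ^ 2 * I) := mul_le_mul_of_nonneg_left h5 hg0
        _ = _ := by ring
    exact le_of_mul_le_mul_left h6 hD
  -- IDS is almost greedy: moving mass `ε` to `a` loses at most the fraction `ε` of the information,
  -- so minimality gives `Δ (Δ - 2D) ≤ ε (Δ - D)²`. If `Δ > 2D`, the choice of `ε` below makes the
  -- right side at most half of the left, a contradiction.
  have hle : Δ ≤ 2 * D := by
    by_contra! hlt
    have hΔpos : 0 < Δ := lt_trans (by positivity) hlt
    have hIpos : 0 < I := by
      refine hI0.lt_of_ne fun h0 => ?_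
      rw [← h0, mul_zero] at hcmp
      exact absurd (mul_pos (sq_pos_of_pos hΔpos) hc) (not_lt.2 hcmp)
    set ε := (Δ - 2 * D) / (2 * Δ) with hε
    have hεΔ : ε * (2 * Δ) = Δ - 2 * D := div_mul_cancel₀ _ (by positivity)
    have hε0 : 0 < ε := div_pos (by linarith) (by positivity)
    have hε1 : ε < 1 := by rw [hε, div_lt_one (by positivity)]; linarith
    have hg1 := integral_mixDirac μ hε0.le hε1.le a hgap.measurable hig
    have hi1 := integral_mixDirac μ hε0.le hε1.le a hinfo.measurable hii
    have hi2 : (1 - ε) * I ≤ ∫ x, info x ∂(mixDirac μ ε a) := by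
      rw [hi1]
      have := mul_nonneg hε0.le (hinfo0 a)
      linarith
    have := sq_mul_le_of_infoRatio_le hI0
      (lt_of_lt_of_le (mul_pos (by linarith) hIpos) hi2)
      (hmin _ (isProbabilityMeasure_mixDirac _ hε0.le hε1.le a))
    rw [hg1] at this
    have h5 : (Δ ^ 2 * (1 - ε)) * I ≤ ((1 - ε) * Δ + ε * D) ^ 2 * I :=
      calc _ = Δ ^ 2 * ((1 - ε) * I) := by ring
        _ ≤ _ := mul_le_mul_of_nonneg_left hi2 (sq_nonneg _)
        _ ≤ _ := this
    have h6 := le_of_mul_le_mul_right h5 hIpos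
    have h7 : ε * (Δ * (Δ - 2 * D)) ≤ ε * (ε * (Δ - D) ^ 2) := by nlinarith
    have h8 := le_of_mul_le_mul_left h7 hε0
    have h9 : ε * (Δ - D) ^ 2 ≤ ε * Δ ^ 2 :=
      mul_le_mul_of_nonneg_left (pow_le_pow_left₀ (by linarith) (by linarith) 2) hε0.le
    have h10 : ε * Δ ^ 2 = Δ * (Δ - 2 * D) / 2 := by rw [← hεΔ]; ring
    have h11 : 0 < Δ * (Δ - 2 * D) := mul_pos hΔpos (by linarith)
    linarith
  refine ⟨hle, ?_⟩
  -- Since `D² ≤ k * info c`, the comparison yields `Δ² D² ≤ 4 k D g I`. One `D` cancels and the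
  -- other is traded for `Δ / 2`.
  have h1 : D * (Δ ^ 2 * D) ≤ D * (4 * k * g * I) :=
    calc D * (Δ ^ 2 * D) = Δ ^ 2 * D ^ 2 := by ring
      _ ≤ Δ ^ 2 * (k * info c) := mul_le_mul_of_nonneg_left hsq (sq_nonneg _)
      _ = k * (Δ ^ 2 * info c) := by ring
      _ ≤ k * (4 * D * g * I) := mul_le_mul_of_nonneg_left hcmp hk
      _ = _ := by ring
  have h2 := le_of_mul_le_mul_left h1 hD
  calc Δ ^ 3 = Δ ^ 2 * Δ := by ring
    _ ≤ Δ ^ 2 * (2 * D) := mul_le_mul_of_nonneg_left hle (sq_nonneg _)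
    _ ≤ _ := by linarith

end InfoRatio

namespace LinearPM

variable {A : Type*} {d m r : ℕ} {G : LinearPM A d m}

/-! ### Covariance operators -/

lemma inner_covV (lam : ℝ) (act : ℕ → A) (t : ℕ) (x y : Euc d) :
    inner ℝ x (G.covV lam act t y) =
      lam * inner ℝ x y + ∑ s ∈ Finset.Ico 1 t, inner ℝ (G.obs (act s) x) (G.obs (act s) y) := by
  simp [covV, inner_add_right, real_inner_smul_right, inner_sum,
    ContinuousLinearMap.adjoint_inner_right]

lemma inner_covV_self (lam : ℝ) (act : ℕ → A) (t : ℕ) (x : Euc d) :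
    inner ℝ x (G.covV lam act t x) =
      lam * ‖x‖ ^ 2 + ∑ s ∈ Finset.Ico 1 t, ‖G.obs (act s) x‖ ^ 2 := by
  simp [inner_covV]

variable {W : Euc r →L[ℝ] Euc d} {lam : ℝ} {act : ℕ → A} {t : ℕ}

lemma inner_covW (x y : Euc r) :
    inner ℝ x (G.covW W lam act t y) = inner ℝ (W x) (G.covV lam act t (W y)) := by
  simp [covW, ContinuousLinearMap.adjoint_inner_right]

lemma covW_isSymmetric : (G.covW W lam act t : Euc r →ₗ[ℝ] Euc r).IsSymmetric := by
  intro x y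
  change inner ℝ (G.covW W lam act t x) y = inner ℝ x (G.covW W lam act t y)
  rw [real_inner_comm, inner_covW, inner_covW, inner_covV, inner_covV, real_inner_comm]
  congr 1
  exact Finset.sum_congr rfl fun s _ => real_inner_comm _ _

/-- The information operator `Wᵀ M_aᵀ M_a W`. -/
def infoOp (G : LinearPM A d m) (W : Euc r →L[ℝ] Euc d) (a : A) : Euc r →L[ℝ] Euc r :=
  W.adjoint ∘L (G.obs a).adjoint ∘L G.obs a ∘L W

lemma inner_infoOp (a : A) (x y : Euc r) :
    inner ℝ x (infoOp G W a y) = inner ℝ (G.obs a (W x)) (G.obs a (W y)) := by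
  simp [infoOp, ContinuousLinearMap.adjoint_inner_right]

lemma infoOp_isSymmetric (a : A) : (infoOp G W a : Euc r →ₗ[ℝ] Euc r).IsSymmetric := by
  intro x y
  change inner ℝ (infoOp G W a x) y = inner ℝ x (infoOp G W a y)
  rw [real_inner_comm, inner_infoOp, inner_infoOp, real_inner_comm]

lemma inner_infoOp_self_nonneg (a : A) (x : Euc r) : 0 ≤ inner ℝ x (infoOp G W a x) := by
  rw [inner_infoOp]
  exact real_inner_self_nonneg

lemma infoGain_eq (a : A) : G.infoGain W lam act t a =
    1 / 2 * Real.log (G.covW W lam act t + infoOp G W a).det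
      - 1 / 2 * Real.log (G.covW W lam act t).det := rfl

lemma covW_succ (ht : 1 ≤ t) :
    G.covW W lam act (t + 1) = G.covW W lam act t + infoOp G W (act t) := by
  ext1 x
  simp [covW, covV, infoOp, Finset.sum_Ico_succ_top ht, add_assoc]

lemma ValidBasis.norm_map (hW : G.ValidBasis W) (x : Euc r) : ‖W x‖ = ‖x‖ := by
  have h : inner ℝ (W x) (W x) = inner ℝ x x := by
    rw [← ContinuousLinearMap.adjoint_inner_right]
    have := congrArg (fun T => T x) hW.orthonormal
    simp only [ContinuousLinearMap.comp_apply, ContinuousLinearMap.id_apply] at this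
    rw [this]
  rw [real_inner_self_eq_norm_sq, real_inner_self_eq_norm_sq] at h
  exact (sq_eq_sq₀ (norm_nonneg _) (norm_nonneg _)).1 h

lemma ValidBasis.norm_adjoint_le (hW : G.ValidBasis W) (y : Euc d) : ‖W.adjoint y‖ ≤ ‖y‖ := by
  have h : ‖W.adjoint y‖ ^ 2 ≤ ‖W.adjoint y‖ * ‖y‖ := by
    rw [← real_inner_self_eq_norm_sq, ContinuousLinearMap.adjoint_inner_left,
      ← hW.norm_map (W.adjoint y), real_inner_comm]
    exact real_inner_le_norm _ _
  rcases (norm_nonneg (W.adjoint y)).eq_or_lt with h0 | h0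
  · rw [← h0]; positivity
  · rw [sq] at h
    exact le_of_mul_le_mul_left h h0

lemma inner_covW_self (hW : G.ValidBasis W) (x : Euc r) :
    inner ℝ x (G.covW W lam act t x) =
      lam * ‖x‖ ^ 2 + ∑ s ∈ Finset.Ico 1 t, ‖G.obs (act s) (W x)‖ ^ 2 := by
  rw [inner_covW, inner_covV_self, hW.norm_map]

lemma le_inner_covW_self (hW : G.ValidBasis W) (x : Euc r) :
    lam * ‖x‖ ^ 2 ≤ inner ℝ x (G.covW W lam act t x) := by
  rw [inner_covW_self hW]
  have : 0 ≤ ∑ s ∈ Finset.Ico 1 t, ‖G.obs (act s) (W x)‖ ^ 2 := by positivity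
  linarith

/-- In the coordinates of `W` the observations of `ν` are unchanged and only the regularizer
shrinks. This is how `r` rather than `d` enters the bounds. -/
lemma inner_covW_adjoint_le (hW : G.ValidBasis W) (hlam : 0 ≤ lam) {ν : Euc d}
    (hν : ν ∈ G.diffSpan) :
    inner ℝ (W.adjoint ν) (G.covW W lam act t (W.adjoint ν)) ≤
      inner ℝ ν (G.covV lam act t ν) := by
  rw [inner_covW_self hW, inner_covV_self]
  refine add_le_add ?_ (le_of_eq (Finset.sum_congr rfl fun s _ => ?_))
  · exact mul_le_mul_of_nonneg_left
      (pow_le_pow_left₀ (norm_nonneg _) (hW.norm_adjoint_le ν) 2) hlam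
  · rw [← hW.obs_eq_of_mem _ hν]

lemma det_covW_pos (hW : G.ValidBasis W) (hlam : 0 < lam) : 0 < (G.covW W lam act t).det :=
  lt_of_lt_of_le (pow_pos hlam r) (pow_le_det covW_isSymmetric hlam.le (le_inner_covW_self hW))

lemma det_covW_add_infoOp_ge (hW : G.ValidBasis W) (hlam : 0 < lam) (a : A) :
    (G.covW W lam act t).det ≤ (G.covW W lam act t + infoOp G W a).det :=
  det_le_det_add covW_isSymmetric (infoOp_isSymmetric a) hlam (le_inner_covW_self hW)
    (inner_infoOp_self_nonneg a)

lemma infoGain_nonneg (hW : G.ValidBasis W) (hlam : 0 < lam) (a : A) :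
    0 ≤ G.infoGain W lam act t a := by
  rw [infoGain_eq]
  have := Real.log_le_log (det_covW_pos (act := act) (t := t) hW hlam)
    (det_covW_add_infoOp_ge hW hlam a)
  linarith

lemma log_det_covW_mono (hW : G.ValidBasis W) (hlam : 0 < lam) {s : ℕ} (hs : 1 ≤ s)
    (hst : s ≤ t) :
    Real.log (G.covW W lam act s).det ≤ Real.log (G.covW W lam act t).det := by
  induction t, hst using Nat.le_induction with
  | base => exact le_rfl
  | succ t hst ih =>
    refine ih.trans ?_
    rw [covW_succ (hs.trans hst)]
    exact Real.log_le_log (det_covW_pos hW hlam) (det_covW_add_infoOp_ge hW hlam _)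

lemma det_smul_id (lam : ℝ) : (lam • ContinuousLinearMap.id ℝ (Euc r)).det = lam ^ r := by
  have h : (lam • ContinuousLinearMap.id ℝ (Euc r)).det =
    LinearMap.det (lam • (LinearMap.id : Euc r →ₗ[ℝ] Euc r)) := rfl
  rw [h, LinearMap.det_smul]
  simp

lemma covW_one (hW : G.ValidBasis W) :
    G.covW W lam act 1 = lam • ContinuousLinearMap.id ℝ (Euc r) := by
  have : ∀ x, W.adjoint (W x) = x := fun x => congrArg (fun T => T x) hW.orthonormal
  ext1 x
  simp [covW, covV, this]

lemma log_det_smul_id_le (hW : G.ValidBasis W) (hlam : 0 < lam) :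
    Real.log (lam • ContinuousLinearMap.id ℝ (Euc r)).det ≤
      Real.log (G.covW W lam act t).det := by
  rw [det_smul_id]
  exact Real.log_le_log (pow_pos hlam r)
    (pow_le_det covW_isSymmetric hlam.le (le_inner_covW_self hW))

/-- A direction in which the confidence set is wide is informative. -/
lemma norm_obs_sq_le_infoGain (hW : G.ValidBasis W) (hlam : 0 < lam) {c : A}
    (hL : ‖G.obs c‖ ^ 2 ≤ lam) {ν : Euc d} (hν : ν ∈ G.diffSpan) {β : ℝ}
    (hβ : inner ℝ ν (G.covV lam act t ν) ≤ β) :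
    ‖G.obs c ν‖ ^ 2 ≤ 4 * β * G.infoGain W lam act t c := by
  have hI := infoGain_nonneg (act := act) (t := t) hW hlam c
  have hβ0 : 0 ≤ β := le_trans (by rw [inner_covV_self]; positivity) hβ
  rw [hW.obs_eq_of_mem c hν]
  set x := W.adjoint ν with hx
  by_cases hx0 : x = 0
  · rw [hx0]
    simp only [map_zero, norm_zero]
    rw [zero_pow two_ne_zero]
    exact mul_nonneg (by positivity) hI
  have hxn : 0 < ‖x‖ := norm_pos_iff.2 hx0
  set T := G.covW W lam act t with hT
  have hq : 0 < inner ℝ x (T x) :=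
    lt_of_lt_of_le (by positivity) (le_inner_covW_self (act := act) (t := t) hW x)
  have hqβ : inner ℝ x (T x) ≤ β := (inner_covW_adjoint_le hW hlam.le hν).trans hβ
  have hS : inner ℝ x (infoOp G W c x) = ‖G.obs c (W x)‖ ^ 2 := by
    rw [inner_infoOp, real_inner_self_eq_norm_sq]
  have hMx : ‖G.obs c (W x)‖ ^ 2 ≤ inner ℝ x (T x) := by
    refine le_trans ?_ (le_inner_covW_self (act := act) (t := t) hW x)
    calc ‖G.obs c (W x)‖ ^ 2 ≤ (‖G.obs c‖ * ‖W x‖) ^ 2 :=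
          pow_le_pow_left₀ (norm_nonneg _) ((G.obs c).le_opNorm _) 2
      _ = ‖G.obs c‖ ^ 2 * ‖x‖ ^ 2 := by rw [mul_pow, hW.norm_map]
      _ ≤ lam * ‖x‖ ^ 2 := mul_le_mul_of_nonneg_right hL (sq_nonneg _)
  set y := ‖G.obs c (W x)‖ ^ 2 / inner ℝ x (T x) with hy
  have hy0 : 0 ≤ y := by positivity
  have hy1 : y ≤ 1 := (div_le_one hq).2 hMx
  have hdet := det_mul_one_add_le_det_add (T := T) (S := infoOp G W c) covW_isSymmetric
    (infoOp_isSymmetric c) hlam (le_inner_covW_self hW) (inner_infoOp_self_nonneg c) hx0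
  rw [hS] at hdet
  have hdT : 0 < T.det := det_covW_pos hW hlam
  have hlog := Real.log_le_log (mul_pos hdT (by linarith : 0 < 1 + y)) hdet
  rw [Real.log_mul hdT.ne' (by linarith)] at hlog
  -- For `0 ≤ y ≤ 1`, `log (1 + y) ≥ y / (1 + y) ≥ y / 2`; with the `½` in the information gain this
  -- gives the factor `4`. The bound `y ≤ 1` is where `‖M_c‖² ≤ λ` is needed.
  have hlog2 := Real.one_sub_inv_le_log_of_pos (by linarith : 0 < 1 + y)
  have hlog3 : y / 2 ≤ 1 - (1 + y)⁻¹ := by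
    rw [inv_eq_one_div, div_le_iff₀ two_pos, sub_mul, div_mul_eq_mul_div, le_sub_iff_add_le,
      ← le_sub_iff_add_le', div_le_iff₀ (by linarith)]
    nlinarith
  have hI4 : y ≤ 4 * G.infoGain W lam act t c := by
    rw [infoGain_eq]
    linarith
  calc ‖G.obs c (W x)‖ ^ 2 = y * inner ℝ x (T x) := (div_mul_cancel₀ _ hq.ne').symm
    _ ≤ (4 * G.infoGain W lam act t c) * β := mul_le_mul hI4 hqβ hq.le (by positivity)
    _ = _ := by ring

/-! ### Gap estimates -/

section Gap

variable {θ₀ θstar θhat : Euc d} {L B ρ : ℝ} {E : Set (Euc d)}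

lemma gapEst_le (hne : E.Nonempty) {a : A} {X : ℝ}
    (h : ∀ θ ∈ E, ∀ b, inner ℝ (G.feat b - G.feat a) θ ≤ X) : G.gapEst E a ≤ X := by
  refine csSup_le ⟨_, hne.some, hne.some_mem, a, rfl⟩ ?_
  rintro _ ⟨ν, hν, c, rfl⟩
  exact h ν hν c

lemma confSet_subset : G.confSet W lam ρ B act t θhat ⊆ G.params := fun _ h => h.1

lemma beta_nonneg : 0 ≤ G.beta W lam ρ B act t := sq_nonneg _

lemma mem_confSet_self (h : θhat ∈ G.params) : θhat ∈ G.confSet W lam ρ B act t θhat :=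
  ⟨h, by simpa using beta_nonneg⟩

lemma le_beta (hρ : 0 ≤ ρ) (hB0 : 0 ≤ B) (hlam : 0 ≤ lam) :
    lam * B ^ 2 ≤ G.beta W lam ρ B act t := by
  calc lam * B ^ 2 = (√lam * B) ^ 2 := by rw [mul_pow, Real.sq_sqrt hlam]
    _ ≤ _ := pow_le_pow_left₀ (by positivity)
      (le_add_of_nonneg_left (mul_nonneg hρ (Real.sqrt_nonneg _))) 2

variable [TopologicalSpace A]

lemma Bounded.nonneg (hB : G.Bounded θ₀ L B) : 0 ≤ B := by
  simpa using hB.params_bound θ₀ hB.prior_mem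

lemma Bounded.norm_sub_le (hB : G.Bounded θ₀ L B) {θ ν : Euc d} (hθ : θ ∈ G.params)
    (hν : ν ∈ G.params) : ‖θ - ν‖ ≤ 2 * B := by
  have h := norm_sub_le_norm_sub_add_norm_sub θ θ₀ ν
  have h1 := hB.params_bound θ hθ
  have h2 := hB.params_bound ν hν
  rw [norm_sub_rev] at h2
  linarith

lemma Bounded.norm_le (hB : G.Bounded θ₀ L B) {θ : Euc d} (hθ : θ ∈ G.params) :
    ‖θ‖ ≤ ‖θ₀‖ + B := by
  have := norm_le_norm_add_norm_sub' θ θ₀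
  linarith [hB.params_bound θ hθ]

lemma Bounded.abs_inner_feat_sub_le (hB : G.Bounded θ₀ L B) (a b : A) (θ : Euc d) :
    |inner ℝ (G.feat b - G.feat a) θ| ≤ 2 * ‖θ‖ := by
  refine (abs_real_inner_le_norm _ _).trans (mul_le_mul_of_nonneg_right ?_ (norm_nonneg _))
  exact (_root_.norm_sub_le _ _).trans (by linarith [hB.feat_bound a, hB.feat_bound b])

lemma le_gapEst (hB : G.Bounded θ₀ L B) (hE : E ⊆ G.params) {θ : Euc d} (hθ : θ ∈ E) (a b : A) :
    inner ℝ (G.feat b - G.feat a) θ ≤ G.gapEst E a := by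
  refine le_csSup ⟨2 * (‖θ₀‖ + B), ?_⟩ ⟨θ, hθ, b, rfl⟩
  rintro _ ⟨ν, hν, c, rfl⟩
  exact (le_abs_self _).trans ((hB.abs_inner_feat_sub_le a c ν).trans
    (mul_le_mul_of_nonneg_left (hB.norm_le (hE hν)) two_pos.le))

lemma gapEst_nonneg (hB : G.Bounded θ₀ L B) (hE : E ⊆ G.params) (hne : E.Nonempty) (a : A) :
    0 ≤ G.gapEst E a := by
  simpa using le_gapEst hB hE hne.some_mem a a

lemma gapEst_mono (hB : G.Bounded θ₀ L B) {E' : Set (Euc d)} (hE : E ⊆ G.params)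
    (hne : E'.Nonempty) (h : E' ⊆ E) (a : A) : G.gapEst E' a ≤ G.gapEst E a :=
  gapEst_le hne fun _ hθ b => le_gapEst hB hE (h hθ) a b

lemma continuous_gapEst (hB : G.Bounded θ₀ L B) (hE : E ⊆ G.params) (hne : E.Nonempty) :
    Continuous (G.gapEst E) := by
  have hR : 0 ≤ ‖θ₀‖ + B := add_nonneg (norm_nonneg _) hB.nonneg
  have key : ∀ a a', G.gapEst E a ≤ G.gapEst E a' + ‖G.feat a - G.feat a'‖ * (‖θ₀‖ + B) := by
    intro a a'
    refine gapEst_le hne fun θ hθ b => ?_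
    have h1 := le_gapEst hB hE hθ a' b
    have h2 : inner ℝ (G.feat a' - G.feat a) θ ≤ ‖G.feat a - G.feat a'‖ * (‖θ₀‖ + B) := by
      refine (real_inner_le_norm _ _).trans ?_
      rw [norm_sub_rev]
      exact mul_le_mul_of_nonneg_left (hB.norm_le (hE hθ)) (norm_nonneg _)
    have h3 : inner ℝ (G.feat b - G.feat a) θ =
        inner ℝ (G.feat b - G.feat a') θ + inner ℝ (G.feat a' - G.feat a) θ := by
      rw [← inner_add_left]; congr 1; abel
    linarith
  refine continuous_iff_continuousAt.2 fun a₀ => ?_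
  have hlim : Filter.Tendsto (fun a => ‖G.feat a - G.feat a₀‖ * (‖θ₀‖ + B)) (nhds a₀)
      (nhds 0) := by
    have : Continuous fun a => ‖G.feat a - G.feat a₀‖ * (‖θ₀‖ + B) :=
      ((hB.continuous_feat.sub continuous_const).norm).mul continuous_const
    simpa using this.tendsto a₀
  refine tendsto_iff_dist_tendsto_zero.2 (squeeze_zero (fun _ => dist_nonneg) (fun a => ?_) hlim)
  rw [Real.dist_eq, abs_le]
  have h1 := key a a₀
  have h2 := key a₀ a
  rw [norm_sub_rev] at h2
  constructor <;> linarith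

lemma inner_le_maxGap (hB : G.Bounded θ₀ L B) (a b : A) (θ : Euc d) :
    inner ℝ (G.feat b - G.feat a) θ ≤ G.maxGap θ := by
  refine le_ciSup (f := fun p : A × A => inner ℝ (G.feat p.1 - G.feat p.2) θ)
    ⟨2 * ‖θ‖, ?_⟩ (b, a)
  rintro _ ⟨p, rfl⟩
  exact (le_abs_self _).trans (hB.abs_inner_feat_sub_le p.2 p.1 θ)

lemma maxGap_nonneg [Nonempty A] (hB : G.Bounded θ₀ L B) (θ : Euc d) : 0 ≤ G.maxGap θ := by
  simpa using inner_le_maxGap hB (Classical.arbitrary A) (Classical.arbitrary A) θ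

lemma gapEst_singleton_le_maxGap (hB : G.Bounded θ₀ L B) (θ : Euc d) (a : A) :
    G.gapEst {θ} a ≤ G.maxGap θ := by
  refine gapEst_le (Set.singleton_nonempty _) ?_
  rintro _ rfl b
  exact inner_le_maxGap hB a b _

/-- Replacing `θ` by `θ*` costs at most `‖φ_b - φ_a‖ ‖θ - θ*‖ ≤ 2 * 2B`. -/
lemma gapEst_le_maxGap_add (hB : G.Bounded θ₀ L B) (hE : E ⊆ G.params) (hne : E.Nonempty)
    (hs : θstar ∈ G.params) (a : A) : G.gapEst E a ≤ G.maxGap θstar + 4 * B := by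
  refine gapEst_le hne fun θ hθ b => ?_
  have h1 := inner_le_maxGap hB a b θstar
  have h2 := (le_abs_self _).trans (hB.abs_inner_feat_sub_le a b (θ - θstar))
  have h3 := hB.norm_sub_le (hE hθ) hs
  rw [inner_sub_right] at h2
  linarith

lemma continuous_infoGain (hB : G.Bounded θ₀ L B) (hW : G.ValidBasis W) (hlam : 0 < lam) :
    Continuous (G.infoGain W lam act t) := by
  have hop : Continuous fun a => G.covW W lam act t + infoOp G W a := by
    have h := hB.continuous_obs
    have hadj : Continuous fun a => (G.obs a).adjoint :=
      (ContinuousLinearMap.adjoint (𝕜 := ℝ) (E := Euc d) (F := Euc m)).continuous.comp h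
    exact continuous_const.add
      (continuous_const.clm_comp (hadj.clm_comp (h.clm_comp continuous_const)))
  have hdet : Continuous fun a => (G.covW W lam act t + infoOp G W a).det :=
    ContinuousLinearMap.continuous_det.comp hop
  have hpos : ∀ a, (G.covW W lam act t + infoOp G W a).det ≠ 0 := fun a =>
    ((det_covW_pos hW hlam).trans_le (det_covW_add_infoOp_ge hW hlam a)).ne'
  exact (continuous_const.mul (hdet.log hpos)).sub continuous_const

/-! ### One round of the algorithm -/

/-- If all observations distinguish the parameters in `E` from `θ̂` by at most `X`, then an action
that is optimal for `θ̂` has a small estimated gap. -/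
lemma gapEst_sq_le (hB : G.Bounded θ₀ L B) (hcov : G.ParetoCovers) (hfin : G.alignment ≠ ∞)
    (hE : E ⊆ G.params) (hθ : θhat ∈ E) {a : A} (ha : G.Pareto a) (hcell : θhat ∈ G.cell a) {X : ℝ}
    (hX : 0 ≤ X) (h : ∀ θ ∈ E, ∀ c, ‖G.obs c (θ - θhat)‖ ^ 2 ≤ X) :
    G.gapEst E a ^ 2 ≤ G.alignment.toReal * X := by
  have h0 := gapEst_nonneg hB hE ⟨_, hθ⟩ a
  suffices hs : G.gapEst E a ≤ √(G.alignment.toReal * X) by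
    calc _ ≤ √(G.alignment.toReal * X) ^ 2 := pow_le_pow_left₀ h0 hs 2
      _ = _ := Real.sq_sqrt (mul_nonneg ENNReal.toReal_nonneg hX)
  refine gapEst_le ⟨_, hθ⟩ fun θ hθE b => ?_
  -- The competitor `b` need not be Pareto optimal, so a Pareto optimal `b'` that is optimal for `θ`
  -- replaces it. Optimality of `a` at `θ̂` then permits subtracting `⟨φ_b' - φ_a, θ̂⟩ ≤ 0`.
  obtain ⟨b', hb', -, hopt⟩ := hcov θ (hE hθE)
  have h1 := inner_sq_le_alignment_mul hfin (sub_mem_diffSpan (hE hθE) (hE hθ)) hb' ha hX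
    (h θ hθE)
  have h2 := Real.le_sqrt_of_sq_le h1
  have h3 := hopt b
  have h4 := hcell.2 b'
  rw [inner_sub_right, inner_sub_left, inner_sub_left] at h2
  rw [inner_sub_left]
  linarith

lemma norm_obs_sub_sq_le (hB : G.Bounded θ₀ L B) (hL : L ≤ lam) {θ ν : Euc d}
    (hθ : θ ∈ G.params) (hν : ν ∈ G.params) (c : A) :
    ‖G.obs c (θ - ν)‖ ^ 2 ≤ lam * (2 * B) ^ 2 := by
  calc _ ≤ (‖G.obs c‖ * ‖θ - ν‖) ^ 2 :=
        pow_le_pow_left₀ (norm_nonneg _) ((G.obs c).le_opNorm _) 2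
    _ = ‖G.obs c‖ ^ 2 * ‖θ - ν‖ ^ 2 := mul_pow _ _ 2
    _ ≤ _ := mul_le_mul ((hB.obs_bound c).trans hL)
      (pow_le_pow_left₀ (norm_nonneg _) (hB.norm_sub_le hθ hν) 2) (by positivity)
      ((sq_nonneg _).trans ((hB.obs_bound c).trans hL))

/-- The diameter `2B` of the parameter set takes the place of the confidence width. The bound is
crude but holds for every `E` and carries the factor `√α`. -/
lemma gapEst_optimal_le (hB : G.Bounded θ₀ L B) (hcov : G.ParetoCovers) (hfin : G.alignment ≠ ∞)
    (hlam : 0 ≤ lam) (hL : L ≤ lam)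
    (hE : E ⊆ G.params) (hθ : θhat ∈ E) {a : A} (ha : G.Pareto a) (hcell : θhat ∈ G.cell a) :
    G.gapEst E a ≤ 2 * B * √(G.alignment.toReal * lam) := by
  have hB0 := hB.nonneg
  have h := gapEst_sq_le hB hcov hfin hE hθ ha hcell (X := lam * (2 * B) ^ 2) (by positivity)
    fun θ hθE c => norm_obs_sub_sq_le hB hL (hE hθE) (hE hθ) c
  have h2 := Real.le_sqrt_of_sq_le h
  rwa [← mul_assoc, Real.sqrt_mul (mul_nonneg ENNReal.toReal_nonneg hlam),
    Real.sqrt_sq (by positivity), mul_comm] at h2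

lemma inner_covV_self_le (hB : G.Bounded θ₀ L B) (hL : L ≤ lam) (ht : 1 ≤ t) (x : Euc d) :
    inner ℝ x (G.covV lam act t x) ≤ t * lam * ‖x‖ ^ 2 := by
  rw [inner_covV_self]
  have h : ∑ s ∈ Finset.Ico 1 t, ‖G.obs (act s) x‖ ^ 2 ≤
      ∑ _s ∈ Finset.Ico 1 t, lam * ‖x‖ ^ 2 := by
    refine Finset.sum_le_sum fun s _ => ?_
    calc _ ≤ (‖G.obs (act s)‖ * ‖x‖) ^ 2 :=
          pow_le_pow_left₀ (norm_nonneg _) ((G.obs _).le_opNorm _) 2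
      _ = ‖G.obs (act s)‖ ^ 2 * ‖x‖ ^ 2 := mul_pow _ _ 2
      _ ≤ _ := mul_le_mul_of_nonneg_right ((hB.obs_bound _).trans hL) (by positivity)
  rw [Finset.sum_const, Nat.card_Ico, nsmul_eq_mul, Nat.cast_sub ht] at h
  push_cast at h
  linarith

/-- Regardless of whether the true parameter lies in the confidence set, the true gap of an action
is controlled by its estimated gap. -/
lemma gapEst_true_le (hB : G.Bounded θ₀ L B) (hcov : G.ParetoCovers) (hfin : G.alignment ≠ ∞)
    (hlam : 0 < lam) (hL : L ≤ lam) (hρ : 0 ≤ ρ) (ht : 1 ≤ t) (hs : θstar ∈ G.params)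
    (hθ : θhat ∈ G.params) (a : A) :
    G.gapEst {θstar} a ≤ 2 * √t * G.gapEst (G.confSet W lam ρ B act t θhat) a +
      2 * B * √(G.alignment.toReal * lam) := by
  have hB0 := hB.nonneg
  obtain ⟨a₀, ha₀, hcell⟩ := hcov θhat hθ
  have htpos : (0 : ℝ) < t := by exact_mod_cast ht
  have hst : 1 ≤ √(t : ℝ) := Real.one_le_sqrt.2 (by exact_mod_cast ht)
  have hst2 : √(t : ℝ) ^ 2 = t := Real.sq_sqrt htpos.le
  -- Shrinking `θ*` towards `θ̂` by `1 / (2√t)` lands in the confidence set whatever the noise was: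
  -- since `V_t ≤ t λ` and `‖h‖ ≤ 2B`, the squared `V_t`-distance is at most `λ B² ≤ β_t`.
  set s : ℝ := 1 / (2 * √t) with hsdef
  have hs0 : 0 < s := by positivity
  have hs1 : s ≤ 1 := by
    rw [hsdef, div_le_one (by positivity)]
    linarith
  have hsmul : 2 * √t * s = 1 := by rw [hsdef]; field_simp
  set h := θstar - θhat with hh
  have hmem : θhat + s • h ∈ G.confSet W lam ρ B act t θhat := by
    constructor
    · exact hB.convex_params.add_smul_sub_mem hθ hs ⟨hs0.le, hs1⟩
    · refine le_trans ?_ (le_beta hρ hB0 hlam.le)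
      rw [add_sub_cancel_left, map_smul, real_inner_smul_left, real_inner_smul_right, ← mul_assoc]
      have h1 := inner_covV_self_le (act := act) hB hL ht h
      have h2 : ‖h‖ ^ 2 ≤ (2 * B) ^ 2 :=
        pow_le_pow_left₀ (norm_nonneg _) (hB.norm_sub_le hs hθ) 2
      have hss : s * s = 1 / (4 * t) := by
        rw [hsdef, div_mul_div_comm, one_mul, show 2 * √(t : ℝ) * (2 * √t) = 4 * √t ^ 2 by ring,
          hst2]
      rw [hss]
      calc 1 / (4 * (t : ℝ)) * inner ℝ h (G.covV lam act t h)
          ≤ 1 / (4 * (t : ℝ)) * (t * lam * (2 * B) ^ 2) := by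
            refine mul_le_mul_of_nonneg_left (h1.trans ?_) (by positivity)
            exact mul_le_mul_of_nonneg_left h2 (by positivity)
        _ = lam * B ^ 2 := by field_simp; ring
  have h1 := le_gapEst hB confSet_subset hmem a a₀
  have h2 : 0 ≤ inner ℝ (G.feat a₀ - G.feat a) θhat := by
    rw [inner_sub_left]; linarith [hcell.2 a]
  -- The gap between `a₀` and `a` is affine along the segment and nonnegative at `θ̂`, so undoing
  -- the shrinkage costs only the factor `2√t`.
  have h3 : inner ℝ (G.feat a₀ - G.feat a) θstar ≤
      2 * √t * G.gapEst (G.confSet W lam ρ B act t θhat) a := by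
    rw [inner_add_right, real_inner_smul_right, hh, inner_sub_right] at h1
    have h4 := mul_le_mul_of_nonneg_left h1 (by positivity : (0 : ℝ) ≤ 2 * √t)
    have h5 : 2 * √t * (inner ℝ (G.feat a₀ - G.feat a) θhat +
        s * (inner ℝ (G.feat a₀ - G.feat a) θstar - inner ℝ (G.feat a₀ - G.feat a) θhat)) =
        (2 * √t - 1) * inner ℝ (G.feat a₀ - G.feat a) θhat +
          inner ℝ (G.feat a₀ - G.feat a) θstar := by
      linear_combination (inner ℝ (G.feat a₀ - G.feat a) θstar -
        inner ℝ (G.feat a₀ - G.feat a) θhat) * hsmul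
    rw [h5] at h4
    have h6 : 0 ≤ (2 * √t - 1) * inner ℝ (G.feat a₀ - G.feat a) θhat :=
      mul_nonneg (by linarith) h2
    linarith
  refine gapEst_le (Set.singleton_nonempty _) ?_
  rintro _ rfl b
  have h4 := gapEst_optimal_le hB hcov hfin hlam.le hL (E := G.params) le_rfl hθ ha₀ hcell
  have h5 := le_gapEst hB le_rfl hs a₀ b
  rw [inner_sub_left] at h3 h5 ⊢
  linarith

variable [MeasurableSpace A] [BorelSpace A] [CompactSpace A] [Nonempty A] {μ : Measure A}

/-- The guarantees of an IDS distribution in a globally observable game. -/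
lemma integral_gapEst_le_of_isIDS (hB : G.Bounded θ₀ L B) (hW : G.ValidBasis W) (hcov : G.ParetoCovers)
    (hfin : G.alignment ≠ ∞) (hlam : 0 < lam) (hL : L ≤ lam) (hs : θstar ∈ G.params)
    (hθ : θhat ∈ G.params)
    (hμ : IsIDS (G.gapEst (G.confSet W lam ρ B act t θhat)) (G.infoGain W lam act t) μ) :
    ∫ a, G.gapEst (G.confSet W lam ρ B act t θhat) a ∂μ ≤
        4 * B * √(G.alignment.toReal * lam) ∧
    (∫ a, G.gapEst (G.confSet W lam ρ B act t θhat) a ∂μ) ^ 3 ≤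
      32 * G.alignment.toReal * (G.maxGap θstar + 4 * B) * G.beta W lam ρ B act t *
        ∫ a, G.infoGain W lam act t a ∂μ := by
  have hE : G.confSet W lam ρ B act t θhat ⊆ G.params := confSet_subset
  have hmem : θhat ∈ G.confSet W lam ρ B act t θhat := mem_confSet_self hθ
  obtain ⟨a, ha, hcell⟩ := hcov θhat hθ
  have hci := continuous_infoGain (act := act) (t := t) hB hW hlam
  -- As `c` maximizes the information gain, it controls at once what every action observes of `θ -
  -- θ̂`.
  obtain ⟨c, -, hc⟩ := isCompact_univ.exists_isMaxOn (Set.univ_nonempty (α := A)) hci.continuousOn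
  have hβ : 0 ≤ G.beta W lam ρ B act t := beta_nonneg
  have hα : 0 ≤ G.alignment.toReal := ENNReal.toReal_nonneg
  have hsq := gapEst_sq_le hB hcov hfin hE hmem ha hcell
    (X := 4 * G.beta W lam ρ B act t * G.infoGain W lam act t c)
    (mul_nonneg (by positivity) (infoGain_nonneg hW hlam c)) fun θ hθE c' =>
      (norm_obs_sq_le_infoGain hW hlam ((hB.obs_bound c').trans hL)
        (sub_mem_diffSpan (hE hθE) hθ) hθE.2).trans
      (mul_le_mul_of_nonneg_left (hc (Set.mem_univ c')) (by positivity))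
  have h := hμ.integral_gap_le (continuous_gapEst hB hE ⟨_, hmem⟩) hci
    (gapEst_nonneg hB hE ⟨_, hmem⟩) (infoGain_nonneg hW hlam)
    (a := a) (c := c) (g := G.maxGap θstar + 4 * B)
    (k := 4 * G.alignment.toReal * G.beta W lam ρ B act t) (by positivity)
    (gapEst_le_maxGap_add hB hE ⟨_, hmem⟩ hs a) (gapEst_le_maxGap_add hB hE ⟨_, hmem⟩ hs c)
    (hsq.trans (le_of_eq (by ring)))
  refine ⟨h.1.trans ?_, h.2.trans (le_of_eq (by ring))⟩
  have := gapEst_optimal_le hB hcov hfin hlam.le hL hE hmem ha hcell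
  linarith

end Gap

end LinearPM

/-! ### Conditionally sub-Gaussian noise -/

section SubGaussian

variable {Ω : Type*} {m₁ m₀ : MeasurableSpace Ω} {P : Measure Ω}

/-- The conditional bound says that the measures with densities `f` and `c` are ordered after
restriction to `m₁`. Integrating against them needs no integrability of `F`. -/
lemma lintegral_mul_ofReal_le_of_condExp_le [IsFiniteMeasure P] (hm : m₁ ≤ m₀) {f : Ω → ℝ}
    (hfm : Measurable f) (hf : Integrable f P) (hf0 : ∀ ω, 0 ≤ f ω) {c : ℝ} (hc : 0 ≤ c)
    (h : P[f | m₁] ≤ᵐ[P] fun _ => c) {F : Ω → ℝ≥0∞} (hF : Measurable[m₁] F) :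
    ∫⁻ ω, F ω * ENNReal.ofReal (f ω) ∂P ≤ ∫⁻ ω, F ω * ENNReal.ofReal c ∂P := by
  have hF' : Measurable F := hF.mono hm le_rfl
  have key : (P.withDensity fun ω => ENNReal.ofReal (f ω)).trim hm ≤
      (P.withDensity fun _ => ENNReal.ofReal c).trim hm := by
    refine Measure.le_iff.2 fun S hS => ?_
    rw [trim_measurableSet_eq hm hS, trim_measurableSet_eq hm hS, withDensity_apply _ (hm S hS),
      withDensity_apply _ (hm S hS),
      ← ofReal_integral_eq_lintegral_ofReal hf.integrableOn (Filter.Eventually.of_forall hf0),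
      ← ofReal_integral_eq_lintegral_ofReal (integrable_const c)
        (Filter.Eventually.of_forall fun _ => hc), ← setIntegral_condExp hm hf hS]
    exact ENNReal.ofReal_le_ofReal (setIntegral_mono_ae integrable_condExp.integrableOn
      (integrable_const c).integrableOn h)
  have h1 := lintegral_mono' key (le_refl F)
  rw [lintegral_trim hm hF, lintegral_trim hm hF,
    lintegral_withDensity_eq_lintegral_mul _ hfm.ennreal_ofReal hF',
    lintegral_withDensity_eq_lintegral_mul _ measurable_const hF'] at h1
  simpa only [Pi.mul_apply, mul_comm] using h1

/-- A conditional sub-Gaussian bound for all fixed directions extends to directions that are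
measurable with respect to the conditioning σ-algebra. -/
lemma lintegral_mul_exp_inner_sub_le [IsFiniteMeasure P] (hm : m₁ ≤ m₀) {k : ℕ} {Y : Ω → Euc k}
    (hY : Measurable Y) {ρ : ℝ}
    (hint : ∀ u : Euc k, Integrable (fun ω => Real.exp (inner ℝ u (Y ω))) P)
    (hsub : ∀ u : Euc k, P[fun ω => Real.exp (inner ℝ u (Y ω)) | m₁]
      ≤ᵐ[P] fun _ => Real.exp (‖u‖ ^ 2 * ρ ^ 2 / 2))
    {F : Ω → ℝ≥0∞} (hF : Measurable[m₁] F) {U : Ω → Euc k} (hU : Measurable[m₁] U) :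
    ∫⁻ ω, F ω * ENNReal.ofReal (Real.exp (inner ℝ (U ω) (Y ω) - ‖U ω‖ ^ 2 * ρ ^ 2 / 2)) ∂P ≤
      ∫⁻ ω, F ω ∂P := by
  have hF' : Measurable F := hF.mono hm le_rfl
  have hUs : StronglyMeasurable[m₁] U := hU.stronglyMeasurable
  let V : ℕ → @SimpleFunc Ω m₁ (Euc k) := hUs.approx
  let R : ℕ → Finset (Euc k) := fun j => @SimpleFunc.range Ω _ m₁ (V j)
  -- On each fibre of a simple approximation the direction is constant and the hypothesis applies.
  -- Fatou's lemma then passes to `U`.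
  have hsimple : ∀ j, ∫⁻ ω, F ω * ENNReal.ofReal
      (Real.exp (inner ℝ (V j ω) (Y ω) - ‖V j ω‖ ^ 2 * ρ ^ 2 / 2)) ∂P ≤ ∫⁻ ω, F ω ∂P := by
    intro j
    let I : Euc k → Ω → ℝ≥0∞ := fun u => (V j ⁻¹' {u}).indicator 1
    have hIm : ∀ u, Measurable[m₁] (I u) := fun u =>
      Measurable.indicator (@measurable_const _ _ _ m₁ 1) (@SimpleFunc.measurableSet_fiber _ _ m₁ (V j) u)
    have hIm' : ∀ u, Measurable (I u) := fun u => (hIm u).mono hm le_rfl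
    have hI : ∀ ω, ∀ g : Euc k → ℝ≥0∞, g (V j ω) = ∑ u ∈ R j, I u ω * g u := by
      intro ω g
      rw [Finset.sum_eq_single (V j ω)]
      · simp [I]
      · intro u _ hu
        simp [I, Set.indicator_of_notMem (show ω ∉ V j ⁻¹' {u} from fun h => hu h.symm)]
      · exact fun h => absurd (@SimpleFunc.mem_range_self _ _ m₁ (V j) ω) h
    have hexp : ∀ u : Euc k, ∫⁻ ω, F ω * (I u ω * ENNReal.ofReal
        (Real.exp (inner ℝ u (Y ω) - ‖u‖ ^ 2 * ρ ^ 2 / 2))) ∂P ≤ ∫⁻ ω, F ω * I u ω ∂P := by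
      intro u
      have h1 := lintegral_mul_ofReal_le_of_condExp_le hm (by fun_prop) (hint u)
        (fun _ => Real.exp_nonneg _) (Real.exp_nonneg _) (hsub u)
        (F := fun ω => F ω * I u ω * ENNReal.ofReal (Real.exp (-(‖u‖ ^ 2 * ρ ^ 2 / 2))))
        ((hF.fun_mul (hIm u)).fun_mul measurable_const)
      calc _ = _ := lintegral_congr fun ω => ?_
        _ ≤ _ := h1
        _ = _ := lintegral_congr fun ω => ?_
      · rw [sub_eq_neg_add, Real.exp_add, ENNReal.ofReal_mul (Real.exp_nonneg _)]
        ring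
      · rw [mul_assoc (F ω * I u ω), ← ENNReal.ofReal_mul (Real.exp_nonneg _), ← Real.exp_add]
        simp
    calc _ = ∫⁻ ω, ∑ u ∈ R j, F ω * (I u ω * ENNReal.ofReal
          (Real.exp (inner ℝ u (Y ω) - ‖u‖ ^ 2 * ρ ^ 2 / 2))) ∂P := by
          refine lintegral_congr fun ω => ?_
          rw [hI ω fun u => ENNReal.ofReal (Real.exp (inner ℝ u (Y ω) - ‖u‖ ^ 2 * ρ ^ 2 / 2)),
            Finset.mul_sum]
      _ = ∑ u ∈ R j, ∫⁻ ω, F ω * (I u ω * ENNReal.ofReal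
          (Real.exp (inner ℝ u (Y ω) - ‖u‖ ^ 2 * ρ ^ 2 / 2))) ∂P :=
          lintegral_finsetSum _ fun u _ => hF'.mul ((hIm' u).mul (by fun_prop))
      _ ≤ ∑ u ∈ R j, ∫⁻ ω, F ω * I u ω ∂P := Finset.sum_le_sum fun u _ => hexp u
      _ = ∫⁻ ω, ∑ u ∈ R j, F ω * I u ω ∂P :=
          (lintegral_finsetSum _ fun u _ => hF'.mul (hIm' u)).symm
      _ = _ := by
          refine lintegral_congr fun ω => ?_
          have := hI ω fun _ => 1
          simp only [mul_one] at this
          rw [← Finset.mul_sum, ← this, mul_one]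
  have hVm : ∀ j, Measurable fun ω => V j ω := fun j =>
    (@SimpleFunc.measurable _ _ m₁ _ (V j)).mono hm le_rfl
  have hlim : ∀ ω, Filter.Tendsto (fun j => F ω * ENNReal.ofReal
      (Real.exp (inner ℝ (V j ω) (Y ω) - ‖V j ω‖ ^ 2 * ρ ^ 2 / 2))) Filter.atTop
      (nhds (F ω * ENNReal.ofReal
        (Real.exp (inner ℝ (U ω) (Y ω) - ‖U ω‖ ^ 2 * ρ ^ 2 / 2)))) := by
    intro ω
    refine ENNReal.Tendsto.const_mul ?_ (Or.inl ?_)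
    · have hc : Continuous fun v : Euc k =>
          ENNReal.ofReal (Real.exp (inner ℝ v (Y ω) - ‖v‖ ^ 2 * ρ ^ 2 / 2)) :=
        ENNReal.continuous_ofReal.comp (by fun_prop)
      exact (hc.tendsto _).comp (hUs.tendsto_approx ω)
    · exact (ENNReal.ofReal_pos.2 (Real.exp_pos _)).ne'
  calc _ = ∫⁻ ω, Filter.liminf (fun j => F ω * ENNReal.ofReal
        (Real.exp (inner ℝ (V j ω) (Y ω) - ‖V j ω‖ ^ 2 * ρ ^ 2 / 2))) Filter.atTop ∂P :=
        lintegral_congr fun ω => (hlim ω).liminf_eq.symm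
    _ ≤ Filter.liminf (fun j => ∫⁻ ω, F ω * ENNReal.ofReal
        (Real.exp (inner ℝ (V j ω) (Y ω) - ‖V j ω‖ ^ 2 * ρ ^ 2 / 2)) ∂P) Filter.atTop :=
        lintegral_liminf_le fun j => by
          have := hVm j
          fun_prop
    _ ≤ _ := Filter.liminf_le_of_frequently_le'
        (Filter.Frequently.of_forall hsimple)

end SubGaussian

namespace LinearPM

variable {A : Type*} [MeasurableSpace A] {d m r : ℕ} {G : LinearPM A d m}
variable {Ω : Type*} [MeasurableSpace Ω] {P : Measure Ω}
variable {act : ℕ → Ω → A} {fb : ℕ → Ω → Euc m} {n : ℕ}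

/-! ### The filtration of the interaction -/

omit [MeasurableSpace Ω] in
lemma measurable_act_past {s t : ℕ} (hs : s ∈ Finset.Ico 1 t) :
    Measurable[past act fb t] (act s) :=
  measurable_iff_comap_le.2 (le_iSup₂_of_le s hs le_sup_left)

omit [MeasurableSpace Ω] in
lemma measurable_fb_past {s t : ℕ} (hs : s ∈ Finset.Ico 1 t) :
    Measurable[past act fb t] (fb s) :=
  measurable_iff_comap_le.2 (le_iSup₂_of_le s hs le_sup_right)

lemma past_le (ha : ∀ t ∈ Finset.Icc 1 n, Measurable (act t))
    (hf : ∀ t ∈ Finset.Icc 1 n, Measurable (fb t)) {t : ℕ} (ht : t ≤ n + 1) :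
    past act fb t ≤ ‹MeasurableSpace Ω› := by
  refine iSup₂_le fun s hs => ?_
  have hs' : s ∈ Finset.Icc 1 n := by
    rw [Finset.mem_Ico] at hs
    rw [Finset.mem_Icc]
    omega
  exact sup_le (ha s hs').comap_le (hf s hs').comap_le

lemma pastAct_le (ha : ∀ t ∈ Finset.Icc 1 n, Measurable (act t))
    (hf : ∀ t ∈ Finset.Icc 1 n, Measurable (fb t)) {t : ℕ} (ht : t ∈ Finset.Icc 1 n) :
    pastAct act fb t ≤ ‹MeasurableSpace Ω› :=
  sup_le (past_le ha hf (by rw [Finset.mem_Icc] at ht; omega)) (ha t ht).comap_le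

/-! ### Self-normalized concentration -/

/-- The exponent of the exponential supermartingale in direction `x`. -/
def expArg (G : LinearPM A d m) (ρ : ℝ) (θstar : Euc d) (act : ℕ → Ω → A) (fb : ℕ → Ω → Euc m)
    (t : ℕ) (x : Euc d) (ω : Ω) : ℝ :=
  ∑ s ∈ Finset.Ico 1 t, (inner ℝ (G.obs (act s ω) x) (fb s ω - G.obs (act s ω) θstar) -
    ‖G.obs (act s ω) x‖ ^ 2 * ρ ^ 2 / 2)

variable [TopologicalSpace A] [BorelSpace A] {ρ : ℝ} {θstar : Euc d}

omit [MeasurableSpace Ω] in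
lemma measurable_expArg (hobs : Continuous G.obs) (x : Euc d) (t : ℕ) :
    Measurable[past act fb t] (expArg G ρ θstar act fb t x) := by
  unfold expArg
  refine @Finset.measurable_fun_sum _ _ _ _ _ _ (past act fb t) _ _ fun s hs => ?_
  have h1 : ∀ y : Euc d, Measurable[past act fb t] fun ω => G.obs (act s ω) y := fun y =>
    (hobs.clm_apply continuous_const).measurable.comp (measurable_act_past hs)
  have h2 : Measurable[past act fb t] (fb s) := measurable_fb_past hs
  exact ((h1 x).inner (h2.fun_sub (h1 θstar))).fun_sub
    ((by fun_prop : Measurable fun v : Euc m => ‖v‖ ^ 2 * ρ ^ 2 / 2).comp (h1 x))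

/-- This is the exponential supermartingale. Given the past and the current action, `M_{a_t} x` is a
known direction, so each round contributes a factor of conditional mean at most `1`. -/
lemma lintegral_exp_expArg_le [IsProbabilityMeasure P] (hobs : Continuous G.obs)
    (ha : ∀ t ∈ Finset.Icc 1 n, Measurable (act t))
    (hf : ∀ t ∈ Finset.Icc 1 n, Measurable (fb t))
    (hint : ∀ t ∈ Finset.Icc 1 n, ∀ u : Euc m,
      Integrable (fun ω => Real.exp (inner ℝ u (fb t ω - G.obs (act t ω) θstar))) P)
    (hsub : ∀ t ∈ Finset.Icc 1 n, ∀ u : Euc m,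
      P[fun ω => Real.exp (inner ℝ u (fb t ω - G.obs (act t ω) θstar)) | pastAct act fb t]
        ≤ᵐ[P] fun _ => Real.exp (‖u‖ ^ 2 * ρ ^ 2 / 2))
    (x : Euc d) (t : ℕ) (ht : t ≤ n + 1) :
    ∫⁻ ω, ENNReal.ofReal (Real.exp (expArg G ρ θstar act fb t x ω)) ∂P ≤ 1 := by
  induction t with
  | zero => simp [expArg]
  | succ t ih =>
    rcases Nat.eq_zero_or_pos t with rfl | ht0
    · simp [expArg]
    refine le_trans ?_ (ih (by omega))
    have htn : t ∈ Finset.Icc 1 n := Finset.mem_Icc.2 ⟨ht0, by omega⟩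
    have hact : Measurable[pastAct act fb t] (act t) :=
      measurable_iff_comap_le.2 le_sup_right
    have hmeas : ∀ y : Euc d, Measurable fun ω => G.obs (act t ω) y := fun y =>
      (hobs.clm_apply continuous_const).measurable.comp (ha t htn)
    have h := lintegral_mul_exp_inner_sub_le (pastAct_le ha hf htn)
      (Y := fun ω => fb t ω - G.obs (act t ω) θstar)
      ((hf t htn).sub (hmeas θstar)) (hint t htn) (hsub t htn)
      (F := fun ω => ENNReal.ofReal (Real.exp (expArg G ρ θstar act fb t x ω)))
      ((Measurable.mono (measurable_expArg hobs x t) le_sup_left le_rfl).exp.ennreal_ofReal)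
      (U := fun ω => G.obs (act t ω) x)
      ((hobs.clm_apply continuous_const).measurable.comp hact)
    refine le_trans (le_of_eq (lintegral_congr fun ω => ?_)) h
    rw [← ENNReal.ofReal_mul (Real.exp_nonneg _), ← Real.exp_add]
    unfold expArg
    rw [Finset.sum_Ico_succ_top ht0]

/-- The projected noise `∑_{s < t} Wᵀ M_sᵀ ε_s`. -/
def noiseSum (G : LinearPM A d m) (W : Euc r →L[ℝ] Euc d) (θstar : Euc d) (act : ℕ → A)
    (fb : ℕ → Euc m) (t : ℕ) : Euc r :=
  ∑ s ∈ Finset.Ico 1 t, W.adjoint ((G.obs (act s)).adjoint (fb s - G.obs (act s) θstar))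

omit [MeasurableSpace A] [TopologicalSpace A] [BorelSpace A] in
lemma inner_noiseSum (W : Euc r →L[ℝ] Euc d) (act : ℕ → A) (fb : ℕ → Euc m) (t : ℕ)
    (z : Euc r) : inner ℝ z (noiseSum G W θstar act fb t) =
      ∑ s ∈ Finset.Ico 1 t, inner ℝ (G.obs (act s) (W z)) (fb s - G.obs (act s) θstar) := by
  simp only [noiseSum, inner_sum, ContinuousLinearMap.adjoint_inner_right]

end LinearPM

namespace LinearPM

/-! ### The method of mixtures -/

section Concentration

variable {A : Type*} [MeasurableSpace A] {d m r : ℕ} {G : LinearPM A d m}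
variable {Ω : Type*} [MeasurableSpace Ω] {P : Measure Ω}
variable {act : ℕ → Ω → A} {fb : ℕ → Ω → Euc m} {n t : ℕ}
variable {ρ lam : ℝ} {θstar : Euc d} {W : Euc r →L[ℝ] Euc d}

omit [MeasurableSpace A] [MeasurableSpace Ω] in
-- The Gaussian weight of precision `ρ² λ` supplies the regularizer of `W_t`. The mixture of
-- supermartingales over `z` is therefore a Gaussian integral with operator `W_t`.
lemma exp_mixture_eq (hW : G.ValidBasis W) (ω : Ω) (z : Euc r) :
    Real.exp (inner ℝ z (noiseSum G W θstar (fun s => act s ω) (fun s => fb s ω) t) -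
      ρ ^ 2 / 2 * inner ℝ z (G.covW W lam (fun s => act s ω) t z)) =
    Real.exp (-(ρ ^ 2 * lam / 2) * ‖z‖ ^ 2) * Real.exp (expArg G ρ θstar act fb t (W z) ω) := by
  rw [← Real.exp_add, inner_noiseSum, inner_covW_self hW, expArg, Finset.sum_sub_distrib]
  congr 1
  have : ∑ s ∈ Finset.Ico 1 t, ‖G.obs (act s ω) (W z)‖ ^ 2 * ρ ^ 2 / 2 =
      ρ ^ 2 / 2 * ∑ s ∈ Finset.Ico 1 t, ‖G.obs (act s ω) (W z)‖ ^ 2 := by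
    rw [Finset.mul_sum]
    exact Finset.sum_congr rfl fun s _ => by ring
  rw [this]
  ring

/-- This is the mass of the mixing weight, expressed through the same unevaluated Gaussian constant
as the mixture itself; the constant later cancels. -/
lemma lintegral_exp_neg_mul_sq {κ : ℝ} (hκ : 0 < κ) (hlam : 0 < lam) :
    ∫⁻ z : Euc r, ENNReal.ofReal (Real.exp (-(κ * lam / 2) * ‖z‖ ^ 2)) =
      ENNReal.ofReal (√(lam ^ r))⁻¹ *
        ∫⁻ z : Euc r, ENNReal.ofReal (Real.exp (-(κ / 2) * ‖z‖ ^ 2)) := by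
  have h := lintegral_exp_inner_sub (T := lam • ContinuousLinearMap.id ℝ (Euc r))
    (by intro x y; simp [real_inner_smul_left, real_inner_smul_right]) hlam
    (by intro x; simp [real_inner_smul_right]) hκ 0
  simp only [map_zero, inner_zero_right, zero_sub, zero_div, Real.exp_zero, one_mul,
    det_smul_id] at h
  rw [← h]
  refine lintegral_congr fun z => ?_
  congr 2
  simp [real_inner_smul_right]
  ring

variable [TopologicalSpace A] [BorelSpace A]

lemma measurable_expArg_uncurry (hobs : Continuous G.obs)
    (ha : ∀ t ∈ Finset.Icc 1 n, Measurable (act t))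
    (hf : ∀ t ∈ Finset.Icc 1 n, Measurable (fb t)) (ht : t ≤ n + 1) :
    Measurable fun p : Ω × Euc r => expArg G ρ θstar act fb t (W p.2) p.1 := by
  unfold expArg
  refine Finset.measurable_fun_sum _ fun s hs => ?_
  have hs' : s ∈ Finset.Icc 1 n := by
    rw [Finset.mem_Ico] at hs; rw [Finset.mem_Icc]; omega
  have h0 : Measurable fun p : Euc r × Ω => G.obs (act s p.2) (W p.1) :=
    measurable_uncurry_of_continuous_of_measurable
      (u := fun (z : Euc r) (ω : Ω) => G.obs (act s ω) (W z))
      (fun ω => (G.obs (act s ω)).continuous.comp W.continuous)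
      (fun z => (hobs.clm_apply continuous_const).measurable.comp (ha s hs'))
  have h1 : Measurable fun p : Ω × Euc r => G.obs (act s p.1) (W p.2) :=
    h0.comp (measurable_snd.prodMk measurable_fst)
  have h2 : Measurable fun ω => G.obs (act s ω) θstar :=
    (hobs.clm_apply continuous_const).measurable.comp (ha s hs')
  have h3 : Measurable fun p : Ω × Euc r => fb s p.1 - G.obs (act s p.1) θstar :=
    ((hf s hs').sub h2).comp measurable_fst
  exact (h1.inner h3).fun_sub
    ((by fun_prop : Measurable fun v : Euc m => ‖v‖ ^ 2 * ρ ^ 2 / 2).comp h1)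

/-- The method of mixtures: the self-normalized noise is small outside of an event of
probability `δ`. -/
lemma exists_measurableSet_selfNormalized_le [IsProbabilityMeasure P] (hobs : Continuous G.obs)
    (hW : G.ValidBasis W) (hlam : 0 < lam) (hρ : 0 < ρ)
    (ha : ∀ t ∈ Finset.Icc 1 n, Measurable (act t))
    (hf : ∀ t ∈ Finset.Icc 1 n, Measurable (fb t))
    (hint : ∀ t ∈ Finset.Icc 1 n, ∀ u : Euc m,
      Integrable (fun ω => Real.exp (inner ℝ u (fb t ω - G.obs (act t ω) θstar))) P)
    (hsub : ∀ t ∈ Finset.Icc 1 n, ∀ u : Euc m,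
      P[fun ω => Real.exp (inner ℝ u (fb t ω - G.obs (act t ω) θstar)) | pastAct act fb t]
        ≤ᵐ[P] fun _ => Real.exp (‖u‖ ^ 2 * ρ ^ 2 / 2))
    (ht : t ≤ n + 1) {δ : ℝ} (hδ : 0 < δ) :
    ∃ N : Set Ω, MeasurableSet N ∧ P N ≤ ENNReal.ofReal δ ∧ ∀ ω ∉ N, ∀ w : Euc r,
      G.covW W lam (fun s => act s ω) t w =
        noiseSum G W θstar (fun s => act s ω) (fun s => fb s ω) t →
      inner ℝ w (G.covW W lam (fun s => act s ω) t w) ≤ ρ ^ 2 * (2 * Real.log (1 / δ) +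
        Real.log (G.covW W lam (fun s => act s ω) t).det -
        Real.log (lam • ContinuousLinearMap.id ℝ (Euc r)).det) := by
  have hκ : 0 < ρ ^ 2 := by positivity
  set Z := ∫⁻ z : Euc r, ENNReal.ofReal (Real.exp (-(ρ ^ 2 / 2) * ‖z‖ ^ 2)) with hZ
  have hZtop : Z ≠ ∞ := lintegral_exp_neg_sq_ne_top (half_pos hκ)
  have hZ0 : Z ≠ 0 := lintegral_exp_neg_sq_ne_zero _
  let f : Ω → Euc r → ℝ≥0∞ := fun ω z =>
    ENNReal.ofReal (Real.exp (-(ρ ^ 2 * lam / 2) * ‖z‖ ^ 2)) *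
      ENNReal.ofReal (Real.exp (expArg G ρ θstar act fb t (W z) ω))
  have hfm : Measurable (Function.uncurry f) :=
    (by fun_prop : Measurable fun p : Ω × Euc r =>
      ENNReal.ofReal (Real.exp (-(ρ ^ 2 * lam / 2) * ‖p.2‖ ^ 2))).fun_mul
      (measurable_expArg_uncurry hobs ha hf ht).exp.ennreal_ofReal
  let Q : Ω → ℝ≥0∞ := fun ω => ∫⁻ z, f ω z
  have hQm : Measurable Q := hfm.lintegral_prod_right
  have hQint : ∫⁻ ω, Q ω ∂P ≤ ENNReal.ofReal (√(lam ^ r))⁻¹ * Z := by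
    rw [← lintegral_exp_neg_mul_sq hκ hlam]
    change ∫⁻ ω, (∫⁻ z, f ω z) ∂P ≤ _
    rw [lintegral_lintegral_swap hfm.aemeasurable]
    refine lintegral_mono fun z => ?_
    change ∫⁻ ω, ENNReal.ofReal _ * ENNReal.ofReal _ ∂P ≤ _
    rw [lintegral_const_mul' _ _ ENNReal.ofReal_ne_top]
    exact mul_le_of_le_one_right' (lintegral_exp_expArg_le hobs ha hf hint hsub (W z) t ht)
  have hQeq : ∀ ω, ∀ w : Euc r, G.covW W lam (fun s => act s ω) t w =
        noiseSum G W θstar (fun s => act s ω) (fun s => fb s ω) t →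
      Q ω = ENNReal.ofReal (Real.exp (inner ℝ w (G.covW W lam (fun s => act s ω) t w) /
        (2 * ρ ^ 2)) * (√(G.covW W lam (fun s => act s ω) t).det)⁻¹) * Z := by
    intro ω w hw
    have h := lintegral_exp_inner_sub (T := G.covW W lam (fun s => act s ω) t)
      covW_isSymmetric hlam (le_inner_covW_self hW) hκ w
    rw [← h]
    refine lintegral_congr fun z => ?_
    rw [hw, exp_mixture_eq hW, ENNReal.ofReal_mul (Real.exp_nonneg _)]
  have hlr : 0 < lam ^ r := pow_pos hlam r
  set c := ENNReal.ofReal (√(lam ^ r))⁻¹ * Z with hc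
  have hc0 : c ≠ 0 := mul_ne_zero (ENNReal.ofReal_pos.2 (by positivity)).ne' hZ0
  have hctop : c ≠ ∞ := ENNReal.mul_ne_top ENNReal.ofReal_ne_top hZtop
  -- Markov's inequality applies because `Q` has mean at most `c`. Off this event, the logarithm of
  -- the closed form of `Q` is the claimed bound.
  refine ⟨{ω | ENNReal.ofReal (1 / δ) * c ≤ Q ω}, measurableSet_le measurable_const hQm, ?_, ?_⟩
  · have h := (mul_meas_ge_le_lintegral₀ hQm.aemeasurable (ENNReal.ofReal (1 / δ) * c)).trans hQint
    set p := P {ω | ENNReal.ofReal (1 / δ) * c ≤ Q ω}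
    have h2 : c * (ENNReal.ofReal (1 / δ) * p) ≤ c * 1 := by
      rw [mul_one]
      calc _ = ENNReal.ofReal (1 / δ) * c * p := by ring
        _ ≤ c := h
    have h3 := (ENNReal.mul_le_mul_iff_right hc0 hctop).1 h2
    calc p = ENNReal.ofReal δ * (ENNReal.ofReal (1 / δ) * p) := by
          rw [← mul_assoc, ← ENNReal.ofReal_mul hδ.le, mul_one_div_cancel hδ.ne']
          simp
      _ ≤ ENNReal.ofReal δ * 1 := by gcongr
      _ = _ := mul_one _
  · intro ω hω w hw
    have hlt : Q ω < ENNReal.ofReal (1 / δ) * c := not_le.1 hω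
    have hdet := det_covW_pos (act := fun s => act s ω) (t := t) hW hlam
    set D := (G.covW W lam (fun s => act s ω) t).det with hD
    set q := inner ℝ w (G.covW W lam (fun s => act s ω) t w) with hq
    rw [hQeq ω w hw, hc, ← mul_assoc, ← ENNReal.ofReal_mul (by positivity)] at hlt
    have hlt2 := lt_of_mul_lt_mul_right' hlt
    rw [ENNReal.ofReal_lt_ofReal_iff (by positivity)] at hlt2
    have hlog := Real.log_lt_log (by positivity) hlt2
    rw [Real.log_mul (by positivity) (by positivity), Real.log_exp,
      Real.log_mul (by positivity) (by positivity), Real.log_inv, Real.log_inv,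
      Real.log_sqrt hdet.le, Real.log_sqrt hlr.le] at hlog
    rw [det_smul_id]
    have h5 : q / (2 * ρ ^ 2) < Real.log (1 / δ) + Real.log D / 2 - Real.log (lam ^ r) / 2 := by
      linarith
    rw [div_lt_iff₀ (by positivity)] at h5
    nlinarith

/-- The self-normalized bound, including the noiseless case `ρ = 0`. -/
lemma exists_measurableSet_selfNormalized_le' [IsProbabilityMeasure P] (hobs : Continuous G.obs)
    (hW : G.ValidBasis W) (hlam : 0 < lam) (hρ : 0 ≤ ρ)
    (ha : ∀ t ∈ Finset.Icc 1 n, Measurable (act t))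
    (hf : ∀ t ∈ Finset.Icc 1 n, Measurable (fb t))
    (hint : ∀ t ∈ Finset.Icc 1 n, ∀ u : Euc m,
      Integrable (fun ω => Real.exp (inner ℝ u (fb t ω - G.obs (act t ω) θstar))) P)
    (hsub : ∀ t ∈ Finset.Icc 1 n, ∀ u : Euc m,
      P[fun ω => Real.exp (inner ℝ u (fb t ω - G.obs (act t ω) θstar)) | pastAct act fb t]
        ≤ᵐ[P] fun _ => Real.exp (‖u‖ ^ 2 * ρ ^ 2 / 2))
    (ht : t ≤ n + 1) {δ : ℝ} (hδ : 0 < δ) :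
    ∃ N : Set Ω, MeasurableSet N ∧ P N ≤ ENNReal.ofReal δ ∧ ∀ ω ∉ N, ∀ w : Euc r,
      G.covW W lam (fun s => act s ω) t w =
        noiseSum G W θstar (fun s => act s ω) (fun s => fb s ω) t →
      inner ℝ w (G.covW W lam (fun s => act s ω) t w) ≤ ρ ^ 2 * (2 * Real.log (1 / δ) +
        Real.log (G.covW W lam (fun s => act s ω) t).det -
        Real.log (lam • ContinuousLinearMap.id ℝ (Euc r)).det) := by
  -- The Gaussian weight degenerates at `ρ = 0`, so `ρ` is approached from above. By Fatou, the
  -- limit inferior of the exceptional events has probability at most `δ`; outside it the bound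
  -- holds for infinitely many `k`, which suffices for the limit.
  let ρ' : ℕ → ℝ := fun k => ρ + 1 / ((k : ℝ) + 1)
  have hρ' : ∀ k, ρ ≤ ρ' k ∧ 0 < ρ' k := fun k => by
    have : (0 : ℝ) < 1 / ((k : ℝ) + 1) := by positivity
    constructor <;> simp only [ρ'] <;> linarith
  have hex : ∀ k, _ := fun k => exists_measurableSet_selfNormalized_le (P := P) (n := n) (t := t)
    (δ := δ) hobs hW hlam (hρ' k).2 ha hf hint (fun t ht u => (hsub t ht u).trans
      (Filter.Eventually.of_forall fun _ => Real.exp_le_exp.2 (by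
        have := pow_le_pow_left₀ hρ (hρ' k).1 2
        gcongr))) ht hδ
  choose N hNm hNP hN using hex
  refine ⟨Filter.liminf N Filter.atTop, MeasurableSet.measurableSet_liminf hNm, ?_, ?_⟩
  · have h1 : ∫⁻ ω, (Filter.liminf N Filter.atTop).indicator 1 ω ∂P ≤ ENNReal.ofReal δ := by
      calc _ ≤ ∫⁻ ω, Filter.liminf (fun k => (N k).indicator (1 : Ω → ℝ≥0∞) ω) Filter.atTop ∂P := by
            refine lintegral_mono fun ω => ?_
            by_cases hω : ω ∈ Filter.liminf N Filter.atTop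
            · rw [Set.indicator_of_mem hω]
              rw [Filter.mem_liminf_iff_eventually_mem] at hω
              refine Filter.le_liminf_of_le (by isBoundedDefault) (hω.mono fun k hk => ?_)
              rw [Set.indicator_of_mem hk]
            · rw [Set.indicator_of_notMem hω]
              exact bot_le
        _ ≤ Filter.liminf (fun k => ∫⁻ ω, (N k).indicator 1 ω ∂P) Filter.atTop :=
            lintegral_liminf_le fun k => measurable_one.indicator (hNm k)
        _ ≤ _ := Filter.liminf_le_of_frequently_le' (Filter.Frequently.of_forall fun k => by
            rw [lintegral_indicator_one (hNm k)]
            exact hNP k)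
    rwa [lintegral_indicator_one (MeasurableSet.measurableSet_liminf hNm)] at h1
  · intro ω hω w hw
    rw [Filter.mem_liminf_iff_eventually_mem, Filter.not_eventually] at hω
    have hlim : Filter.Tendsto (fun k => ρ' k ^ 2 * (2 * Real.log (1 / δ) +
        Real.log (G.covW W lam (fun s => act s ω) t).det -
        Real.log (lam • ContinuousLinearMap.id ℝ (Euc r)).det)) Filter.atTop
        (nhds ((ρ + 0) ^ 2 * (2 * Real.log (1 / δ) +
        Real.log (G.covW W lam (fun s => act s ω) t).det -
        Real.log (lam • ContinuousLinearMap.id ℝ (Euc r)).det))) :=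
      ((tendsto_const_nhds.add tendsto_one_div_add_atTop_nhds_zero_nat).pow 2).mul_const _
    rw [add_zero] at hlim
    exact ge_of_tendsto_of_frequently hlim (hω.mono fun k hk => hN k ω hk w hw)

end Concentration

/-! ### The confidence set contains the true parameter -/

section LeastSquares

variable {A : Type*} {d m r : ℕ} {G : LinearPM A d m} {W : Euc r →L[ℝ] Euc d} {lam ρ B L : ℝ}
  {θ₀ θstar θhat : Euc d} {act : ℕ → A} {fb : ℕ → Euc m} {t : ℕ}

lemma lsLoss_add_smul (h : Euc d) (τ : ℝ) :
    G.lsLoss θ₀ lam act fb t (θhat + τ • h) = G.lsLoss θ₀ lam act fb t θhat +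
      2 * τ * (∑ s ∈ Finset.Ico 1 t, inner ℝ (G.obs (act s) θhat - fb s) (G.obs (act s) h) +
        lam * inner ℝ (θhat - θ₀) h) + τ ^ 2 * inner ℝ h (G.covV lam act t h) := by
  rw [inner_covV_self]
  unfold lsLoss
  have h1 : ∀ s, ‖G.obs (act s) (θhat + τ • h) - fb s‖ ^ 2 = ‖G.obs (act s) θhat - fb s‖ ^ 2 +
      2 * τ * inner ℝ (G.obs (act s) θhat - fb s) (G.obs (act s) h) +
      τ ^ 2 * ‖G.obs (act s) h‖ ^ 2 := by
    intro s
    rw [map_add, map_smul, add_sub_right_comm, norm_add_sq_real, real_inner_smul_right, norm_smul,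
      mul_pow, Real.norm_eq_abs, sq_abs]
    ring
  have h2 : ‖θhat + τ • h - θ₀‖ ^ 2 = ‖θhat - θ₀‖ ^ 2 + 2 * τ * inner ℝ (θhat - θ₀) h +
      τ ^ 2 * ‖h‖ ^ 2 := by
    rw [add_sub_right_comm, norm_add_sq_real, real_inner_smul_right, norm_smul,
      mul_pow, Real.norm_eq_abs, sq_abs]
    ring
  simp only [h1, h2, Finset.sum_add_distrib, ← Finset.mul_sum]
  ring

/-- First-order optimality of the constrained least-squares estimate. -/
lemma lsLoss_variational (hconv : Convex ℝ G.params) (hhat : θhat ∈ G.params)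
    (hmin : IsMinOn (G.lsLoss θ₀ lam act fb t) G.params θhat) {θ : Euc d} (hθ : θ ∈ G.params) :
    0 ≤ ∑ s ∈ Finset.Ico 1 t,
        inner ℝ (G.obs (act s) θhat - fb s) (G.obs (act s) (θ - θhat)) +
      lam * inner ℝ (θhat - θ₀) (θ - θhat) := by
  set g := ∑ s ∈ Finset.Ico 1 t,
        inner ℝ (G.obs (act s) θhat - fb s) (G.obs (act s) (θ - θhat)) +
      lam * inner ℝ (θhat - θ₀) (θ - θhat) with hg
  set q := inner ℝ (θ - θhat) (G.covV lam act t (θ - θhat)) with hq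
  by_contra! hneg
  have key : ∀ τ : ℝ, 0 < τ → τ ≤ 1 → 0 ≤ 2 * g + τ * q := by
    intro τ h0 h1
    have h := hmin (hconv.add_smul_sub_mem hhat hθ ⟨h0.le, h1⟩)
    simp only [Set.mem_ofPred_eq, lsLoss_add_smul] at h
    have h2 : 0 ≤ τ * (2 * g + τ * q) := by linarith
    exact nonneg_of_mul_nonneg_right h2 h0
  have hqpos : 0 < q := by
    have := key 1 one_pos le_rfl
    linarith
  -- At this step size the second-order term is at most `-g`, so the inequality reads `0 ≤ g`.
  have h := key (min 1 (-g / q)) (lt_min one_pos (div_pos (by linarith) hqpos)) (min_le_left _ _)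
  have h2 : min 1 (-g / q) * q ≤ -g / q * q := mul_le_mul_of_nonneg_right (min_le_right _ _) hqpos.le
  rw [div_mul_cancel₀ _ hqpos.ne'] at h2
  linarith

/-- With `η = θ* - θ̂`, the square `‖η‖²_V` is the sum of a first-order term, nonpositive by
constrained optimality, a noise term of size at most `‖η‖_V ρ √Y`, and a prior term of at most
`‖η‖_V √λ B`. Dividing by `‖η‖_V` gives the root of `β_t`. -/
lemma mem_confSet_of_selfNormalized_le [TopologicalSpace A] (hB : G.Bounded θ₀ L B)
    (hW : G.ValidBasis W)
    (hlam : 0 < lam) (hρ : 0 ≤ ρ) (hs : θstar ∈ G.params) (hhat : θhat ∈ G.params)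
    (hmin : IsMinOn (G.lsLoss θ₀ lam act fb t) G.params θhat) {Y : ℝ}
    (hY : Y = 2 * Real.log (1 / (1 / (t : ℝ) ^ 2)) + Real.log (G.covW W lam act t).det -
      Real.log (lam • ContinuousLinearMap.id ℝ (Euc r)).det)
    (h : ∀ w : Euc r, G.covW W lam act t w = noiseSum G W θstar act fb t →
      inner ℝ w (G.covW W lam act t w) ≤ ρ ^ 2 * Y) :
    θstar ∈ G.confSet W lam ρ B act t θhat := by
  refine ⟨hs, ?_⟩
  have hvar := lsLoss_variational hB.convex_params hhat hmin hs
  set η := θstar - θhat with hη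
  have hηmem : η ∈ G.diffSpan := sub_mem_diffSpan hs hhat
  set T := G.covW W lam act t with hT
  have hTdet : T.det ≠ 0 := (det_covW_pos hW hlam).ne'
  -- This `w` is `W_t⁻¹` applied to the noise sum, so `⟨w, W_t w⟩` is the squared self-normalized
  -- noise.
  set w := (T.toContinuousLinearEquivOfDetNeZero hTdet).symm (noiseSum G W θstar act fb t) with hw
  have hTw : T w = noiseSum G W θstar act fb t := by
    rw [hw, ← ContinuousLinearMap.toContinuousLinearEquivOfDetNeZero_apply T hTdet,
      ContinuousLinearEquiv.apply_symm_apply]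
  have hq := h w hTw
  have hpos : ∀ z, 0 ≤ inner ℝ z (T z) := fun z =>
    le_trans (by positivity) (le_inner_covW_self hW z)
  have hV0 : 0 ≤ inner ℝ η (G.covV lam act t η) := by rw [inner_covV_self]; positivity
  set v := √(inner ℝ η (G.covV lam act t η)) with hv
  have hv2 : v ^ 2 = inner ℝ η (G.covV lam act t η) := Real.sq_sqrt hV0
  have hv0 : 0 ≤ v := Real.sqrt_nonneg _
  have hB0 := hB.nonneg
  have hnoise : |inner ℝ (W.adjoint η) (noiseSum G W θstar act fb t)| ≤ v * (ρ * √Y) := by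
    rw [← hTw]
    refine (inner_map_le_sqrt_mul_sqrt covW_isSymmetric hpos _ _).trans ?_
    refine mul_le_mul (Real.sqrt_le_sqrt (inner_covW_adjoint_le hW hlam.le hηmem)) ?_
      (Real.sqrt_nonneg _) hv0
    calc _ ≤ √(ρ ^ 2 * Y) := Real.sqrt_le_sqrt hq
      _ = ρ * √Y := by rw [Real.sqrt_mul (sq_nonneg _), Real.sqrt_sq hρ]
  have hprior : lam * inner ℝ (θstar - θ₀) η ≤ v * (√lam * B) := by
    have h1 : √lam * ‖η‖ ≤ v := by
      rw [hv, ← Real.sqrt_sq (norm_nonneg η), ← Real.sqrt_mul hlam.le]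
      refine Real.sqrt_le_sqrt ?_
      rw [inner_covV_self]
      have : 0 ≤ ∑ s ∈ Finset.Ico 1 t, ‖G.obs (act s) η‖ ^ 2 := by positivity
      linarith
    have h2 : inner ℝ (θstar - θ₀) η ≤ B * ‖η‖ := (real_inner_le_norm _ _).trans
      (mul_le_mul_of_nonneg_right (hB.params_bound _ hs) (norm_nonneg _))
    calc lam * inner ℝ (θstar - θ₀) η ≤ lam * (B * ‖η‖) := mul_le_mul_of_nonneg_left h2 hlam.le
      _ = (√lam * ‖η‖) * (√lam * B) := by
          nth_rewrite 1 [← Real.mul_self_sqrt hlam.le]; ring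
      _ ≤ _ := mul_le_mul_of_nonneg_right h1 (by positivity)
  have hident : inner ℝ η (G.covV lam act t η) =
      -(∑ s ∈ Finset.Ico 1 t, inner ℝ (G.obs (act s) θhat - fb s) (G.obs (act s) η) +
        lam * inner ℝ (θhat - θ₀) η) -
      inner ℝ (W.adjoint η) (noiseSum G W θstar act fb t) + lam * inner ℝ (θstar - θ₀) η := by
    rw [inner_noiseSum, inner_covV]
    have h1 : ∀ s, inner ℝ (G.obs (act s) η) (G.obs (act s) η) =
        -inner ℝ (G.obs (act s) θhat - fb s) (G.obs (act s) η) -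
        inner ℝ (G.obs (act s) (W (W.adjoint η))) (fb s - G.obs (act s) θstar) := by
      intro s
      rw [← hW.obs_eq_of_mem _ hηmem, real_inner_comm (fb s - G.obs (act s) θstar), ← inner_neg_left,
        ← inner_sub_left]
      congr 1
      rw [hη, map_sub]
      abel
    have h2 : inner ℝ η η = inner ℝ (θstar - θ₀) η - inner ℝ (θhat - θ₀) η := by
      rw [← inner_sub_left]
      congr 1
      rw [hη]
      abel
    simp only [h1, h2, Finset.sum_sub_distrib, Finset.sum_neg_distrib]
    ring
  have hfinal : v * v ≤ v * (ρ * √Y + √lam * B) := by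
    have h3 := (abs_le.1 hnoise).1
    rw [← sq, hv2, hident]
    linarith
  have hvle : v ≤ ρ * √Y + √lam * B := by
    rcases hv0.eq_or_lt with h0 | h0
    · rw [← h0]; positivity
    · exact le_of_mul_le_mul_left hfinal h0
  rw [← hv2]
  unfold beta betaConf
  rw [← hY]
  exact pow_le_pow_left₀ hv0 hvle 2

end LeastSquares

end LinearPM

/-! ### Sampling from a predictable kernel -/

section Sampling

variable {A Ω Ω' : Type*} [MeasurableSpace A]

open ProbabilityTheory in
lemma map_prodMk_eq_compProd {m₀ : MeasurableSpace Ω} {m' : MeasurableSpace Ω'} {P : Measure Ω}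
    [IsProbabilityMeasure P] {X : Ω → Ω'} (hX : Measurable X) {Y : Ω → A} (hY : Measurable Y)
    (κ : Kernel Ω' A) [IsMarkovKernel κ]
    (h : ∀ S, MeasurableSet S → ∀ T, MeasurableSet T →
      P (X ⁻¹' T ∩ Y ⁻¹' S) = ∫⁻ ω in X ⁻¹' T, κ (X ω) S ∂P) :
    P.map (fun ω => (X ω, Y ω)) = (P.map X) ⊗ₘ κ := by
  have := Measure.isProbabilityMeasure_map (μ := P) (hX.prodMk hY).aemeasurable
  have := Measure.isProbabilityMeasure_map (μ := P) hX.aemeasurable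
  refine Measure.ext_prod fun {T S} hT hS => ?_
  rw [Measure.compProd_apply_prod hT hS, Measure.map_apply (hX.prodMk hY) (hT.prod hS),
    setLIntegral_map hT (κ.measurable_coe hS) hX, ← h S hS T hT]
  rfl

open ProbabilityTheory in
/-- Expectations of bounded functions of the past and of an action sampled from `κ`. -/
lemma integral_sample {m₀ : MeasurableSpace Ω} {m' : MeasurableSpace Ω'} {P : Measure Ω}
    [IsProbabilityMeasure P] {X : Ω → Ω'} (hX : Measurable X) {Y : Ω → A} (hY : Measurable Y)
    (κ : Kernel Ω' A) [IsMarkovKernel κ]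
    (h : ∀ S, MeasurableSet S → ∀ T, MeasurableSet T →
      P (X ⁻¹' T ∩ Y ⁻¹' S) = ∫⁻ ω in X ⁻¹' T, κ (X ω) S ∂P)
    {f : Ω' × A → ℝ} (hf : Measurable f) {C : ℝ} (hC : ∀ p, |f p| ≤ C) :
    Integrable (fun ω => f (X ω, Y ω)) P ∧ Integrable (fun ω => ∫ a, f (X ω, a) ∂(κ (X ω))) P ∧
      ∫ ω, f (X ω, Y ω) ∂P = ∫ ω, (∫ a, f (X ω, a) ∂(κ (X ω))) ∂P := by
  have := Measure.isProbabilityMeasure_map (μ := P) hX.aemeasurable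
  have hint : Integrable f ((P.map X) ⊗ₘ κ) := Integrable.of_bound hf.aestronglyMeasurable C
    (Filter.Eventually.of_forall hC)
  have hsm : StronglyMeasurable fun x => ∫ a, f (x, a) ∂(κ x) :=
    StronglyMeasurable.integral_kernel_prod_right (f := fun x a => f (x, a)) hf.stronglyMeasurable
  refine ⟨Integrable.of_bound (hf.comp (hX.prodMk hY)).aestronglyMeasurable C
    (Filter.Eventually.of_forall fun _ => hC _), ?_, ?_⟩
  · refine Integrable.of_bound (hsm.measurable.comp hX).aestronglyMeasurable C
      (Filter.Eventually.of_forall fun ω => ?_)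
    refine (norm_integral_le_of_norm_le_const (C := C)
      (Filter.Eventually.of_forall fun a => hC (X ω, a))).trans ?_
    simp
  · rw [← integral_map (φ := fun ω => (X ω, Y ω)) (hX.prodMk hY).aemeasurable
      hf.aestronglyMeasurable, map_prodMk_eq_compProd hX hY κ h, Measure.integral_compProd hint,
      integral_map hX.aemeasurable hsm.aestronglyMeasurable]

/-- Expectations of bounded functions of the past `m₁` and of an action whose conditional
distribution given the past is `μ`. -/
lemma integral_sample_of_condExp {m₁ m₀ : MeasurableSpace Ω} (hm : m₁ ≤ m₀) {P : Measure Ω}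
    [IsProbabilityMeasure P] {Y : Ω → A} (hY : Measurable Y) {μ : Ω → Measure A}
    (hμ : Measurable[m₁] μ) (hprob : ∀ ω, IsProbabilityMeasure (μ ω))
    (h : ∀ S, MeasurableSet S → P[(Y ⁻¹' S).indicator (fun _ => (1 : ℝ)) | m₁]
      =ᵐ[P] fun ω => (μ ω).real S)
    {f : Ω × A → ℝ} (hf : Measurable[m₁.prod ‹MeasurableSpace A›] f) {C : ℝ}
    (hC : ∀ p, |f p| ≤ C) :
    Integrable (fun ω => f (ω, Y ω)) P ∧ Integrable (fun ω => ∫ a, f (ω, a) ∂(μ ω)) P ∧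
      ∫ ω, f (ω, Y ω) ∂P = ∫ ω, (∫ a, f (ω, a) ∂(μ ω)) ∂P := by
  -- The kernel lives on `Ω` with the σ-algebra of the past, and the identity from `m₀` to `m₁`
  -- plays the role of the history variable `X`.
  let κ : @ProbabilityTheory.Kernel Ω A m₁ _ :=
    @ProbabilityTheory.Kernel.mk Ω A m₁ _ μ hμ
  have hκ : @ProbabilityTheory.IsMarkovKernel Ω A m₁ _ κ :=
    @ProbabilityTheory.IsMarkovKernel.mk Ω A m₁ _ κ hprob
  refine @integral_sample A Ω Ω _ m₀ m₁ P _ id (measurable_id'' hm) Y hY κ hκ ?_ f hf C hC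
  intro S hS T hT
  have hYS : MeasurableSet (Y ⁻¹' S) := hY hS
  have hT' : MeasurableSet T := hm T hT
  have hi : Integrable ((Y ⁻¹' S).indicator fun _ => (1 : ℝ)) P :=
    (integrable_const 1).indicator hYS
  have h1 := setIntegral_condExp hm hi hT
  rw [setIntegral_congr_ae hT' ((h S hS).mono fun ω hω _ => hω)] at h1
  rw [setIntegral_indicator hYS, setIntegral_const, smul_eq_mul, mul_one] at h1
  have hreal : ∀ ω, ENNReal.ofReal ((μ ω).real S) = μ ω S := fun ω => by
    have := hprob ω
    exact ofReal_measureReal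
  have hmeas : Measurable fun ω => μ ω S := (Measure.measurable_measure.1 (hμ.mono hm le_rfl)) S hS
  have hint : Integrable (fun ω => (μ ω).real S) P :=
    Integrable.of_bound hmeas.ennreal_toReal.aestronglyMeasurable 1
      (Filter.Eventually.of_forall fun ω => by
        have := hprob ω
        rw [Real.norm_of_nonneg measureReal_nonneg]
        exact measureReal_le_one)
  change P (T ∩ Y ⁻¹' S) = ∫⁻ ω in T, μ ω S ∂P
  rw [← lintegral_congr hreal, ← ofReal_integral_eq_lintegral_ofReal hint.integrableOn
    (Filter.Eventually.of_forall fun _ => measureReal_nonneg), h1, ofReal_measureReal]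

end Sampling

namespace LinearPM

/-! ### Measurability and boundedness of the algorithmic quantities -/

section Measurability

variable {A : Type*} [MeasurableSpace A] [TopologicalSpace A] [BorelSpace A] {d m r : ℕ}
  {G : LinearPM A d m} {Ω : Type*} {m₁ : MeasurableSpace Ω} {act : ℕ → Ω → A} {t : ℕ}
  {W : Euc r →L[ℝ] Euc d} {lam ρ B : ℝ}

lemma measurable_infoOp (hobs : Continuous G.obs) : Measurable (infoOp G W) := by
  have hadj : Continuous fun a => (G.obs a).adjoint :=
    (ContinuousLinearMap.adjoint (𝕜 := ℝ) (E := Euc d) (F := Euc m)).continuous.comp hobs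
  exact (continuous_const.clm_comp (hadj.clm_comp (hobs.clm_comp continuous_const))).measurable

omit [MeasurableSpace A] [TopologicalSpace A] [BorelSpace A] in
lemma covW_eq (act : ℕ → A) : G.covW W lam act t = lam • (W.adjoint ∘L W) +
    ∑ s ∈ Finset.Ico 1 t, infoOp G W (act s) := by
  ext1 x
  simp [covW, covV, infoOp]

lemma measurable_covW (hobs : Continuous G.obs)
    (hact : ∀ s ∈ Finset.Ico 1 t, Measurable[m₁] (act s)) :
    Measurable[m₁] fun ω => G.covW W lam (fun s => act s ω) t := by
  simp_rw [covW_eq]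
  exact measurable_const.add (Finset.measurable_fun_sum _ fun s hs =>
    (measurable_infoOp hobs).comp (hact s hs))

lemma measurable_log_det_covW (hobs : Continuous G.obs)
    (hact : ∀ s ∈ Finset.Ico 1 t, Measurable[m₁] (act s)) :
    Measurable[m₁] fun ω => Real.log (G.covW W lam (fun s => act s ω) t).det :=
  (ContinuousLinearMap.continuous_det.measurable.comp (measurable_covW hobs hact)).log

lemma measurable_beta (hobs : Continuous G.obs)
    (hact : ∀ s ∈ Finset.Ico 1 t, Measurable[m₁] (act s)) :
    Measurable[m₁] fun ω => G.beta W lam ρ B (fun s => act s ω) t := by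
  unfold beta betaConf
  have := measurable_log_det_covW (W := W) (lam := lam) hobs hact
  fun_prop

lemma measurable_infoGain (hobs : Continuous G.obs)
    (hact : ∀ s ∈ Finset.Ico 1 t, Measurable[m₁] (act s)) :
    Measurable[m₁.prod ‹MeasurableSpace A›] fun p : Ω × A =>
      G.infoGain W lam (fun s => act s p.1) t p.2 := by
  simp_rw [infoGain_eq]
  have h1 : Measurable fun p : Ω × A => G.covW W lam (fun s => act s p.1) t :=
    (measurable_covW hobs hact).comp measurable_fst
  have h2 : Measurable fun p : Ω × A => infoOp G W p.2 :=
    (measurable_infoOp hobs).comp measurable_snd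
  have hdet : Measurable fun T : Euc r →L[ℝ] Euc r => T.det :=
    ContinuousLinearMap.continuous_det.measurable
  exact ((hdet.comp (h1.add h2)).log.const_mul _).sub ((hdet.comp h1).log.const_mul _)

end Measurability

section Bounds

variable {A : Type*} [TopologicalSpace A] {d m r : ℕ} {G : LinearPM A d m} {act : ℕ → A} {t n : ℕ}
  {W : Euc r →L[ℝ] Euc d} {lam ρ B L : ℝ} {θ₀ : Euc d}

lemma inner_covW_self_le (hB : G.Bounded θ₀ L B) (hW : G.ValidBasis W) (hL : L ≤ lam)
    (ht : 1 ≤ t) (x : Euc r) :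
    inner ℝ x (G.covW W lam act t x) ≤ t * lam * ‖x‖ ^ 2 := by
  rw [inner_covW, ← hW.norm_map x]
  exact inner_covV_self_le hB hL ht _

lemma inner_infoOp_self_le (hB : G.Bounded θ₀ L B) (hW : G.ValidBasis W) (hL : L ≤ lam)
    (a : A) (x : Euc r) : inner ℝ x (infoOp G W a x) ≤ lam * ‖x‖ ^ 2 := by
  rw [inner_infoOp, real_inner_self_eq_norm_sq]
  calc _ ≤ (‖G.obs a‖ * ‖W x‖) ^ 2 :=
        pow_le_pow_left₀ (norm_nonneg _) ((G.obs a).le_opNorm _) 2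
    _ = ‖G.obs a‖ ^ 2 * ‖x‖ ^ 2 := by rw [mul_pow, hW.norm_map]
    _ ≤ _ := mul_le_mul_of_nonneg_right ((hB.obs_bound a).trans hL) (by positivity)

/-- All `r` eigenvalues of `T` lie between `λ` and `t λ`. -/
lemma log_det_sub_le (hlam : 0 < lam) {T : Euc r →L[ℝ] Euc r}
    (hT : (T : Euc r →ₗ[ℝ] Euc r).IsSymmetric) (hl : ∀ x, lam * ‖x‖ ^ 2 ≤ inner ℝ x (T x))
    (ht : 1 ≤ t) (hu : ∀ x, inner ℝ x (T x) ≤ t * lam * ‖x‖ ^ 2) :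
    Real.log T.det - Real.log (lam • ContinuousLinearMap.id ℝ (Euc r)).det ≤
      r * Real.log t := by
  have htpos : (0 : ℝ) < t := by exact_mod_cast ht
  have h := det_le_pow hT (fun x => le_trans (by positivity) (hl x)) hu
  have h0 : 0 < T.det := (pow_pos hlam r).trans_le (pow_le_det hT hlam.le hl)
  have h1 := Real.log_le_log h0 h
  rw [Real.log_pow, Real.log_mul htpos.ne' hlam.ne'] at h1
  rw [det_smul_id, Real.log_pow]
  linarith

lemma log_det_covW_sub_le (hB : G.Bounded θ₀ L B) (hW : G.ValidBasis W) (hlam : 0 < lam)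
    (hL : L ≤ lam) (ht : 1 ≤ t) :
    Real.log (G.covW W lam act t).det -
      Real.log (lam • ContinuousLinearMap.id ℝ (Euc r)).det ≤ r * Real.log t :=
  log_det_sub_le hlam covW_isSymmetric (le_inner_covW_self hW) ht
    (inner_covW_self_le hB hW hL ht)

lemma infoGain_le (hB : G.Bounded θ₀ L B) (hW : G.ValidBasis W) (hlam : 0 < lam)
    (hL : L ≤ lam) (ht : 1 ≤ t) (a : A) :
    G.infoGain W lam act t a ≤ 1 / 2 * (r * Real.log (t + 1)) := by
  have h := log_det_sub_le (t := t + 1) hlam (T := G.covW W lam act t + infoOp G W a)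
    (covW_isSymmetric.add (infoOp_isSymmetric a))
    (fun x => by
      have h1 := le_inner_covW_self (act := act) (t := t) (lam := lam) hW x
      have h2 := inner_infoOp_self_nonneg (G := G) (W := W) a x
      simp only [add_apply, inner_add_right]
      linarith) (by omega)
    (fun x => by
      have h1 := inner_covW_self_le (act := act) hB hW hL ht x
      have h2 := inner_infoOp_self_le hB hW hL a x
      simp only [add_apply, inner_add_right]
      push_cast
      linarith)
  have h2 := log_det_smul_id_le (act := act) (t := t) hW hlam
  rw [infoGain_eq]
  push_cast at h
  linarith

omit [TopologicalSpace A] in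
-- The sum telescopes, because `W_{t+1}` adds to `W_t` the information operator of the action
-- played.
lemma totalInfo_eq (act : ℕ → A) (n : ℕ) : G.totalInfo W lam act n =
    1 / 2 * (Real.log (G.covW W lam act (n + 1)).det - Real.log (G.covW W lam act 1).det) := by
  induction n with
  | zero => simp [totalInfo]
  | succ n ih =>
    unfold totalInfo at ih ⊢
    rw [Finset.sum_Icc_succ_top (by omega), ih, infoGain_eq, covW_succ (t := n + 1) (by omega)]
    ring

lemma totalInfo_le (hB : G.Bounded θ₀ L B) (hW : G.ValidBasis W) (hlam : 0 < lam)
    (hL : L ≤ lam) (n : ℕ) :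
    G.totalInfo W lam act n ≤ 1 / 2 * (r * Real.log (1 + n)) := by
  have h := log_det_covW_sub_le (act := act) (t := n + 1) hB hW hlam hL (by omega)
  rw [totalInfo_eq, covW_one hW]
  push_cast at h
  rw [add_comm (1 : ℝ)]
  linarith

omit [TopologicalSpace A] in
lemma totalInfo_nonneg (hW : G.ValidBasis W) (hlam : 0 < lam) (n : ℕ) :
    0 ≤ G.totalInfo W lam act n :=
  Finset.sum_nonneg fun _ _ => infoGain_nonneg hW hlam _

omit [TopologicalSpace A] in
lemma log_det_covW_sub_nonneg (hW : G.ValidBasis W) (hlam : 0 < lam) :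
    0 ≤ Real.log (G.covW W lam act t).det -
      Real.log (lam • ContinuousLinearMap.id ℝ (Euc r)).det :=
  sub_nonneg.2 (log_det_smul_id_le hW hlam)

omit [TopologicalSpace A] in
lemma beta_mono (hW : G.ValidBasis W) (hlam : 0 < lam) (hρ : 0 ≤ ρ) (hB0 : 0 ≤ B) (ht : 1 ≤ t)
    (htn : t ≤ n) : G.beta W lam ρ B act t ≤ G.beta W lam ρ B act n := by
  have htpos : (0 : ℝ) < t := by exact_mod_cast ht
  have h1 := log_det_covW_mono (act := act) hW hlam ht htn
  have h2 : Real.log (1 / (1 / (t : ℝ) ^ 2)) ≤ Real.log (1 / (1 / (n : ℝ) ^ 2)) := by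
    rw [one_div_one_div, one_div_one_div]
    have : (t : ℝ) ≤ n := by exact_mod_cast htn
    gcongr
  unfold beta betaConf
  gcongr

lemma beta_le (hB : G.Bounded θ₀ L B) (hW : G.ValidBasis W) (hlam : 0 < lam)
    (hL : L ≤ lam) (ht : 1 ≤ t) :
    G.beta W lam ρ B act t ≤ 2 * ρ ^ 2 * ((4 + r) * Real.log t) + 2 * (lam * B ^ 2) := by
  have h1 := log_det_covW_sub_le (act := act) hB hW hlam hL ht
  have h0 := log_det_covW_sub_nonneg (act := act) (t := t) hW hlam
  have h2 : Real.log (1 / (1 / (t : ℝ) ^ 2)) = 2 * Real.log t := by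
    rw [one_div_one_div, Real.log_pow]; simp
  have hlogt : 0 ≤ Real.log t := Real.log_natCast_nonneg t
  unfold beta betaConf
  rw [h2]
  set Y := 2 * (2 * Real.log t) + Real.log (G.covW W lam act t).det -
    Real.log (lam • ContinuousLinearMap.id ℝ (Euc r)).det with hY
  have hY0 : 0 ≤ Y := by linarith
  have hYle : Y ≤ (4 + r) * Real.log t := by linarith
  have h3 : (ρ * √Y + √lam * B) ^ 2 ≤ 2 * (ρ * √Y) ^ 2 + 2 * (√lam * B) ^ 2 := by
    nlinarith [sq_nonneg (ρ * √Y - √lam * B)]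
  rw [mul_pow, mul_pow, Real.sq_sqrt hY0, Real.sq_sqrt hlam.le] at h3
  have h4 : ρ ^ 2 * Y ≤ ρ ^ 2 * ((4 + r) * Real.log t) :=
    mul_le_mul_of_nonneg_left hYle (sq_nonneg _)
  linarith

end Bounds

end LinearPM

/-! ### Elementary inequalities -/

section Real

lemma sum_one_div_sq_le (n : ℕ) : ∑ t ∈ Finset.Icc 1 n, 1 / (t : ℝ) ^ 2 ≤ 2 := by
  have h : ∀ n : ℕ, 1 ≤ n → ∑ t ∈ Finset.Icc 1 n, 1 / (t : ℝ) ^ 2 ≤ 2 - 1 / (n : ℝ) := by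
    intro n hn
    induction n, hn using Nat.le_induction with
    | base => norm_num
    | succ k hk ih =>
      rw [Finset.sum_Icc_succ_top (by omega)]
      have hk0 : (0 : ℝ) < k := by exact_mod_cast hk
      have : 1 / ((k + 1 : ℕ) : ℝ) ^ 2 ≤ 1 / (k : ℝ) - 1 / ((k + 1 : ℕ) : ℝ) := by
        push_cast
        rw [div_sub_div _ _ hk0.ne' (by positivity), div_le_div_iff₀ (by positivity) (by positivity)]
        nlinarith
      linarith
  rcases Nat.eq_zero_or_pos n with rfl | hn
  · simp
  · have : (0 : ℝ) ≤ 1 / n := by positivity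
    linarith [h n hn]

/-- The terms `t^{-3/2}` are dominated by the increments of `-2 / √t`. The sum weighs the failure
probabilities against a gap bound growing like `√t`. -/
lemma sum_sqrt_div_sq_le (n : ℕ) : ∑ t ∈ Finset.Icc 1 n, √(t : ℝ) * (1 / (t : ℝ) ^ 2) ≤ 3 := by
  have h : ∀ n : ℕ, 1 ≤ n →
      ∑ t ∈ Finset.Icc 1 n, √(t : ℝ) * (1 / (t : ℝ) ^ 2) ≤ 3 - 2 / √(n : ℝ) := by
    intro n hn
    induction n, hn using Nat.le_induction with
    | base => norm_num
    | succ k hk ih =>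
      rw [Finset.sum_Icc_succ_top (by omega)]
      have hk0 : (0 : ℝ) < k := by exact_mod_cast hk
      set a := √(k : ℝ) with ha
      set b := √((k + 1 : ℕ) : ℝ) with hb
      have ha0 : 0 < a := Real.sqrt_pos.2 hk0
      have hb0 : 0 < b := Real.sqrt_pos.2 (by positivity)
      have ha2 : a ^ 2 = k := Real.sq_sqrt hk0.le
      have hb2 : b ^ 2 = ((k + 1 : ℕ) : ℝ) := Real.sq_sqrt (by positivity)
      have hab2 : b ^ 2 = a ^ 2 + 1 := by rw [ha2, hb2]; push_cast; ring
      have hab : a ≤ b := by nlinarith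
      have : b * (1 / ((k + 1 : ℕ) : ℝ) ^ 2) ≤ 2 / a - 2 / b := by
        have h1 : 2 / a - 2 / b = 2 / (a * b * (a + b)) := by
          field_simp
          nlinarith
        have h2 : b * (1 / ((k + 1 : ℕ) : ℝ) ^ 2) = 1 / b ^ 3 := by
          rw [← hb2]; field_simp
        rw [h1, h2, div_le_div_iff₀ (by positivity) (by positivity)]
        have h3 : a * b * (a + b) ≤ b * b * (b + b) := by gcongr
        nlinarith
      linarith
  rcases Nat.eq_zero_or_pos n with rfl | hn
  · simp
  · have : (0 : ℝ) ≤ 2 / √(n : ℝ) := by positivity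
    linarith [h n hn]

lemma le_add_div_three_of_pow_three_le {x p q w : ℝ} (hp : 0 ≤ p) (hq : 0 ≤ q) (hw : 0 ≤ w)
    (h : x ^ 3 ≤ p * q * w) : x ≤ (p + q + w) / 3 := by
  by_contra! hlt
  have h0 : 0 ≤ (p + q + w) / 3 := by positivity
  have h1 : ((p + q + w) / 3) ^ 3 < x ^ 3 := pow_lt_pow_left₀ hlt h0 (by norm_num)
  have h2 : p * q * w ≤ ((p + q + w) / 3) ^ 3 := by
    nlinarith [mul_nonneg hp (sq_nonneg (q - w)), mul_nonneg hq (sq_nonneg (p - w)),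
      mul_nonneg hw (sq_nonneg (p - q)), mul_nonneg hp (sq_nonneg (p - q)),
      mul_nonneg hp (sq_nonneg (p - w)), mul_nonneg hq (sq_nonneg (q - p)),
      mul_nonneg hq (sq_nonneg (q - w)), mul_nonneg hw (sq_nonneg (w - p)),
      mul_nonneg hw (sq_nonneg (w - q))]
  linarith

/-- Optimizing the weights in the inequality between arithmetic and geometric means. -/
lemma le_rpow_of_forall_weights {R e u v c N : ℝ} (hu : 0 ≤ u) (hv : 0 ≤ v) (hc : 0 ≤ c)
    (hN : 0 < N)
    (h : ∀ s k : ℝ, 0 < s → 0 < k → R ≤ (s * (N * u) + k * v + N * (c / (s * k))) / 3 + e) :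
    R ≤ N ^ (2 / 3 : ℝ) * (c * u * v) ^ (1 / 3 : ℝ) + e := by
  -- The shift by `ε` keeps the weights defined and positive if `u`, `v` or `c` vanishes. The chosen
  -- weights make each of the three terms at most `T = X^{1/3}`.
  have key : ∀ ε : ℝ, 0 < ε →
      R ≤ (N ^ 2 * ((c + ε) * (u + ε) * (v + ε))) ^ (1 / 3 : ℝ) + e := by
    intro ε hε
    set X := N ^ 2 * ((c + ε) * (u + ε) * (v + ε)) with hX
    have hXpos : 0 < X := by positivity
    set T := X ^ (1 / 3 : ℝ) with hT
    have hTpos : 0 < T := Real.rpow_pos_of_pos hXpos _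
    have hT3 : T ^ 3 = X := by
      rw [hT, ← Real.rpow_natCast, ← Real.rpow_mul hXpos.le]
      norm_num
    have huε : 0 < u + ε := by positivity
    have hvε : 0 < v + ε := by positivity
    have hs : 0 < T / (N * (u + ε)) := by positivity
    have hk : 0 < T / (v + ε) := by positivity
    refine (h _ _ hs hk).trans ?_
    have h1 : T / (N * (u + ε)) * (N * u) ≤ T := by
      rw [div_mul_eq_mul_div, div_le_iff₀ (by positivity)]
      gcongr
      linarith
    have h2 : T / (v + ε) * v ≤ T := by
      rw [div_mul_eq_mul_div, div_le_iff₀ hvε]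
      gcongr
      linarith
    have h3 : N * (c / (T / (N * (u + ε)) * (T / (v + ε)))) ≤ T := by
      have : N * (c / (T / (N * (u + ε)) * (T / (v + ε)))) =
          N ^ 2 * (c * (u + ε) * (v + ε)) / T ^ 2 := by
        field_simp
      rw [this, div_le_iff₀ (by positivity), ← pow_succ', hT3, hX]
      gcongr
      linarith
    linarith
  have hlim : Filter.Tendsto
      (fun ε : ℝ => (N ^ 2 * ((c + ε) * (u + ε) * (v + ε))) ^ (1 / 3 : ℝ) + e)
      (nhdsWithin 0 (Set.Ioi 0))
      (nhds ((N ^ 2 * ((c + 0) * (u + 0) * (v + 0))) ^ (1 / 3 : ℝ) + e)) := by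
    have hcont : Continuous fun ε : ℝ =>
        (N ^ 2 * ((c + ε) * (u + ε) * (v + ε))) ^ (1 / 3 : ℝ) + e :=
      (Continuous.rpow_const (by fun_prop) fun _ => Or.inr (by norm_num)).add continuous_const
    exact (hcont.tendsto 0).mono_left nhdsWithin_le_nhds
  have h1 := ge_of_tendsto hlim (eventually_nhdsWithin_of_forall fun ε hε => key ε hε)
  rw [add_zero, add_zero, add_zero, Real.mul_rpow (by positivity) (by positivity),
    ← Real.rpow_natCast, ← Real.rpow_mul hN.le] at h1
  norm_num at h1 ⊢
  exact h1

end Real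

namespace LinearPM

/-! ### The regret of IDS -/

section Regret

variable {A : Type*} [TopologicalSpace A] [CompactSpace A] [Nonempty A] [MeasurableSpace A]
  [BorelSpace A] {Ω : Type*} [MeasurableSpace Ω] {P : Measure Ω} [IsProbabilityMeasure P]
  {d m r n t : ℕ} {G : LinearPM A d m} {W : Euc r →L[ℝ] Euc d} {L B lam ρ : ℝ}
  {θ₀ θstar : Euc d} {act : ℕ → Ω → A} {fb : ℕ → Ω → Euc m} {θhat : ℕ → Ω → Euc d}
  {μ : ℕ → Ω → Measure A}

omit [CompactSpace A] [Nonempty A] in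
lemma IDSRun.exists_measurableSet_mem_confSet
    (hrun : G.IDSRun P n W lam ρ B θ₀ θstar act fb θhat μ) (hB : G.Bounded θ₀ L B)
    (hW : G.ValidBasis W) (hlam : 0 < lam) (hρ : 0 ≤ ρ) (hs : θstar ∈ G.params)
    (ht : t ∈ Finset.Icc 1 n) :
    ∃ N : Set Ω, MeasurableSet N ∧ P N ≤ ENNReal.ofReal (1 / (t : ℝ) ^ 2) ∧
      ∀ ω ∉ N, θstar ∈ G.confSet W lam ρ B (fun s => act s ω) t (θhat t ω) := by
  have ht' := Finset.mem_Icc.1 ht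
  have htpos : (0 : ℝ) < t := by exact_mod_cast ht'.1
  obtain ⟨N, hNm, hNP, hN⟩ := exists_measurableSet_selfNormalized_le' (P := P) (t := t)
    (δ := 1 / (t : ℝ) ^ 2) hB.continuous_obs hW hlam hρ hrun.measurable_act hrun.measurable_fb
    hrun.noise_integrable hrun.noise_subGaussian (by omega) (by positivity)
  exact ⟨N, hNm, hNP, fun ω hω => mem_confSet_of_selfNormalized_le hB hW hlam hρ hs
    (hrun.estimate t ht ω).1 (hrun.estimate t ht ω).2 rfl fun w hw => hN ω hω w hw⟩

omit [CompactSpace A] [Nonempty A] in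
lemma IDSRun.integrable_beta (hrun : G.IDSRun P n W lam ρ B θ₀ θstar act fb θhat μ)
    (hB : G.Bounded θ₀ L B) (hW : G.ValidBasis W) (hlam : 0 < lam) (hL : L ≤ lam)
    (ht : t ∈ Finset.Icc 1 n) :
    Integrable (fun ω => G.beta W lam ρ B (fun s => act s ω) t) P := by
  have ht' := Finset.mem_Icc.1 ht
  refine Integrable.of_bound (measurable_beta hB.continuous_obs fun s hs =>
    hrun.measurable_act s (by rw [Finset.mem_Ico] at hs; rw [Finset.mem_Icc]; omega)
    ).aestronglyMeasurable (2 * ρ ^ 2 * ((4 + r) * Real.log t) + 2 * (lam * B ^ 2))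
    (Filter.Eventually.of_forall fun ω => ?_)
  rw [Real.norm_of_nonneg beta_nonneg]
  exact beta_le hB hW hlam hL ht'.1

omit [Nonempty A] in
lemma IDSRun.integrable_comp_act (hrun : G.IDSRun P n W lam ρ B θ₀ θstar act fb θhat μ)
    (ht : t ∈ Finset.Icc 1 n) {f : A → ℝ} (hf : Continuous f) :
    Integrable (fun ω => f (act t ω)) P := by
  obtain ⟨C, hC⟩ := isCompact_univ.exists_bound_of_continuousOn hf.continuousOn
  exact Integrable.of_bound (hf.measurable.comp (hrun.measurable_act t ht)).aestronglyMeasurable C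
    (Filter.Eventually.of_forall fun ω => hC _ (Set.mem_univ _))

omit [CompactSpace A] [Nonempty A] in
lemma IDSRun.integral_infoGain (hrun : G.IDSRun P n W lam ρ B θ₀ θstar act fb θhat μ)
    (hB : G.Bounded θ₀ L B) (hW : G.ValidBasis W) (hlam : 0 < lam) (hL : L ≤ lam)
    (ht : t ∈ Finset.Icc 1 n) :
    Integrable (fun ω => G.infoGain W lam (fun s => act s ω) t (act t ω)) P ∧
    Integrable (fun ω => ∫ a, G.infoGain W lam (fun s => act s ω) t a ∂(μ t ω)) P ∧
    ∫ ω, G.infoGain W lam (fun s => act s ω) t (act t ω) ∂P =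
      ∫ ω, (∫ a, G.infoGain W lam (fun s => act s ω) t a ∂(μ t ω)) ∂P := by
  have ht' := Finset.mem_Icc.1 ht
  exact integral_sample_of_condExp
    (past_le hrun.measurable_act hrun.measurable_fb (by omega))
    (hrun.measurable_act t ht) (hrun.predictable t ht) (fun ω => (hrun.ids t ht ω).1)
    (hrun.sample t ht)
    (f := fun p : Ω × A => G.infoGain W lam (fun s => act s p.1) t p.2)
    (measurable_infoGain hB.continuous_obs fun s hs => measurable_act_past hs)
    (C := 1 / 2 * (r * Real.log (t + 1))) fun p => by
      rw [abs_of_nonneg (infoGain_nonneg hW hlam _)]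
      exact infoGain_le hB hW hlam hL ht'.1 _

omit [Nonempty A] in
lemma IDSRun.integral_comp_act (hrun : G.IDSRun P n W lam ρ B θ₀ θstar act fb θhat μ)
    (ht : t ∈ Finset.Icc 1 n) {f : A → ℝ} (hf : Continuous f) :
    Integrable (fun ω => ∫ a, f a ∂(μ t ω)) P ∧
    ∫ ω, f (act t ω) ∂P = ∫ ω, (∫ a, f a ∂(μ t ω)) ∂P := by
  have ht' := Finset.mem_Icc.1 ht
  obtain ⟨C, hC⟩ := isCompact_univ.exists_bound_of_continuousOn hf.continuousOn
  exact (integral_sample_of_condExp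
    (past_le hrun.measurable_act hrun.measurable_fb (by omega))
    (hrun.measurable_act t ht) (hrun.predictable t ht) (fun ω => (hrun.ids t ht ω).1)
    (hrun.sample t ht) (f := fun p : Ω × A => f p.2) (hf.measurable.comp measurable_snd)
    (C := C) fun p => hC p.2 (Set.mem_univ _)).2

/-- The expected gap in one round. The constant `M` bounds the gap in the event that the confidence
set misses the true parameter. -/
lemma IDSRun.integral_gapEst_le (hrun : G.IDSRun P n W lam ρ B θ₀ θstar act fb θhat μ)
    (hB : G.Bounded θ₀ L B) (hW : G.ValidBasis W) (hcov : G.ParetoCovers)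
    (hfin : G.alignment ≠ ∞) (hlam : 0 < lam) (hL : L ≤ lam) (hρ : 0 ≤ ρ)
    (hs : θstar ∈ G.params) (ht : t ∈ Finset.Icc 1 n) {M : ℝ}
    (hM : ∀ ω, ∫ a, G.gapEst {θstar} a ∂(μ t ω) ≤ M) {s k : ℝ} (hs0 : 0 < s) (hk0 : 0 < k) :
    ∫ ω, G.gapEst {θstar} (act t ω) ∂P ≤
      (s * ∫ ω, G.beta W lam ρ B (fun s => act s ω) n ∂P +
        k * ∫ ω, G.infoGain W lam (fun s => act s ω) t (act t ω) ∂P +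
        32 * G.alignment.toReal * (G.maxGap θstar + 4 * B) / (s * k)) / 3 +
      M * (1 / (t : ℝ) ^ 2) := by
  have ht' := Finset.mem_Icc.1 ht
  have hn : n ∈ Finset.Icc 1 n := Finset.mem_Icc.2 ⟨by omega, le_rfl⟩
  have hsub : {θstar} ⊆ G.params := Set.singleton_subset_iff.2 hs
  have hgc : Continuous (G.gapEst {θstar}) :=
    continuous_gapEst hB hsub (Set.singleton_nonempty _)
  have hg0 : ∀ a, 0 ≤ G.gapEst {θstar} a := gapEst_nonneg hB hsub (Set.singleton_nonempty _)
  obtain ⟨hint1, heq1⟩ := hrun.integral_comp_act ht hgc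
  obtain ⟨-, hint2, heq2⟩ := hrun.integral_infoGain hB hW hlam hL ht
  obtain ⟨N, hNm, hNP, hN⟩ := hrun.exists_measurableSet_mem_confSet hB hW hlam hρ hs ht
  have hintβ := hrun.integrable_beta hB hW hlam hL hn
  have hΔ := maxGap_nonneg hB θstar
  have hB0 := hB.nonneg
  set c := 32 * G.alignment.toReal * (G.maxGap θstar + 4 * B) with hc
  have hc0 : 0 ≤ c := by
    have : 0 ≤ G.alignment.toReal := ENNReal.toReal_nonneg
    positivity
  have hM0 : 0 ≤ M := by
    obtain ⟨ω⟩ : Nonempty Ω := P.nonempty_of_neZero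
    exact (integral_nonneg hg0).trans (hM ω)
  -- Off `N` the cube bound is split into three factors whose product does not depend on `s` and
  -- `k`. Monotonicity replaces `β_t` by `β_n`, so that the first term is the same in every round.
  have hpt : ∀ ω, ∫ a, G.gapEst {θstar} a ∂(μ t ω) ≤
      (s * G.beta W lam ρ B (fun s => act s ω) n +
        k * ∫ a, G.infoGain W lam (fun s => act s ω) t a ∂(μ t ω) + c / (s * k)) / 3 +
      N.indicator (fun _ => M) ω := by
    intro ω
    have hμ := hrun.ids t ht ω
    have := hμ.1
    have hβt : 0 ≤ G.beta W lam ρ B (fun s => act s ω) t := beta_nonneg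
    have hβn : 0 ≤ G.beta W lam ρ B (fun s => act s ω) n := beta_nonneg
    have hmono : G.beta W lam ρ B (fun s => act s ω) t ≤ G.beta W lam ρ B (fun s => act s ω) n :=
      beta_mono hW hlam hρ hB0 ht'.1 ht'.2
    have hJ : 0 ≤ ∫ a, G.infoGain W lam (fun s => act s ω) t a ∂(μ t ω) :=
      integral_nonneg fun a => infoGain_nonneg hW hlam a
    by_cases hω : ω ∈ N
    · rw [Set.indicator_of_mem hω]
      have h0 : 0 ≤ (s * G.beta W lam ρ B (fun s => act s ω) n +
        k * ∫ a, G.infoGain W lam (fun s => act s ω) t a ∂(μ t ω) + c / (s * k)) / 3 := by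
        positivity
      linarith [hM ω]
    · rw [Set.indicator_of_notMem hω, add_zero]
      have hmem := hN ω hω
      have hhat := (hrun.estimate t ht ω).1
      have hEc : Continuous (G.gapEst (G.confSet W lam ρ B (fun s => act s ω) t (θhat t ω))) :=
        continuous_gapEst hB confSet_subset ⟨_, hmem⟩
      have h1 : ∫ a, G.gapEst {θstar} a ∂(μ t ω) ≤
          ∫ a, G.gapEst (G.confSet W lam ρ B (fun s => act s ω) t (θhat t ω)) a ∂(μ t ω) :=
        integral_mono (hgc.integrable_of_compactSpace _) (hEc.integrable_of_compactSpace _)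
          fun a => gapEst_mono hB confSet_subset (Set.singleton_nonempty _)
            (Set.singleton_subset_iff.2 hmem) a
      refine h1.trans (le_add_div_three_of_pow_three_le (by positivity) (by positivity)
        (by positivity) ?_)
      refine (integral_gapEst_le_of_isIDS hB hW hcov hfin hlam hL hs hhat hμ).2.trans ?_
      rw [← hc]
      have h2 : s * G.beta W lam ρ B (fun s => act s ω) n *
          (k * ∫ a, G.infoGain W lam (fun s => act s ω) t a ∂(μ t ω)) * (c / (s * k)) =
          c * G.beta W lam ρ B (fun s => act s ω) n *
            ∫ a, G.infoGain W lam (fun s => act s ω) t a ∂(μ t ω) := by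
        field_simp
      rw [h2]
      gcongr
  have hintN : Integrable (N.indicator fun _ => M) P := (integrable_const M).indicator hNm
  have hi := ((hintβ.const_mul s).add (hint2.const_mul k)).add (integrable_const (c / (s * k)))
  rw [heq1, heq2]
  refine (integral_mono hint1 ((hi.div_const 3).add hintN) hpt).trans (le_of_eq_of_le
    (integral_add (hi.div_const 3) hintN) ?_)
  refine add_le_add (le_of_eq ?_) ?_
  · rw [integral_div]
    congr 1
    have hi' : Integrable (fun ω => s * G.beta W lam ρ B (fun s => act s ω) n +
        k * ∫ a, G.infoGain W lam (fun s => act s ω) t a ∂(μ t ω)) P :=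
      (hintβ.const_mul s).add (hint2.const_mul k)
    simp only [Pi.add_apply]
    rw [integral_add hi' (integrable_const _),
      integral_add (hintβ.const_mul s) (hint2.const_mul k), integral_const_mul,
      integral_const_mul]
    simp
  · rw [integral_indicator hNm, setIntegral_const, smul_eq_mul, mul_comm]
    exact mul_le_mul_of_nonneg_left (ENNReal.toReal_le_of_le_ofReal (by positivity) hNP) hM0

/-- The failure costs `M` and `e` stay abstract because the main theorem uses two choices: `Δ_max`,
and a bound of order `√(α t)`. The constant `32` of one round is relaxed to `54`. -/
lemma IDSRun.regret_le (hrun : G.IDSRun P n W lam ρ B θ₀ θstar act fb θhat μ)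
    (hn : 1 ≤ n) (hB : G.Bounded θ₀ L B) (hW : G.ValidBasis W) (hcov : G.ParetoCovers)
    (hfin : G.alignment ≠ ∞) (hlam : 0 < lam) (hL : L ≤ lam) (hρ : 0 ≤ ρ)
    (hs : θstar ∈ G.params) {M : ℕ → ℝ} {e : ℝ}
    (hM : ∀ t ∈ Finset.Icc 1 n, ∀ ω, ∫ a, G.gapEst {θstar} a ∂(μ t ω) ≤ M t)
    (he : ∑ t ∈ Finset.Icc 1 n, M t * (1 / (t : ℝ) ^ 2) ≤ e) :
    G.regret P n θstar act ≤ (n : ℝ) ^ (2 / 3 : ℝ) *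
      (54 * G.alignment.toReal * (∫ ω, G.beta W lam ρ B (fun t => act t ω) n ∂P)
        * (∫ ω, G.totalInfo W lam (fun t => act t ω) n * (G.maxGap θstar + 4 * B) ∂P))
          ^ (1 / 3 : ℝ) + e := by
  have hsub : {θstar} ⊆ G.params := Set.singleton_subset_iff.2 hs
  have hgc : Continuous (G.gapEst {θstar}) :=
    continuous_gapEst hB hsub (Set.singleton_nonempty _)
  have hα : 0 ≤ G.alignment.toReal := ENNReal.toReal_nonneg
  have hΔ := maxGap_nonneg hB θstar
  have hB0 := hB.nonneg
  have hnpos : (0 : ℝ) < n := by exact_mod_cast hn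
  set u := ∫ ω, G.beta W lam ρ B (fun t => act t ω) n ∂P with hu
  set v := ∫ ω, G.totalInfo W lam (fun t => act t ω) n ∂P with hv
  set c := 32 * G.alignment.toReal * (G.maxGap θstar + 4 * B) with hc
  have hu0 : 0 ≤ u := integral_nonneg fun ω => beta_nonneg
  have hv0 : 0 ≤ v := integral_nonneg fun ω => totalInfo_nonneg hW hlam n
  have hc0 : 0 ≤ c := by positivity
  have hvsum : v = ∑ t ∈ Finset.Icc 1 n,
      ∫ ω, G.infoGain W lam (fun s => act s ω) t (act t ω) ∂P := by
    rw [hv]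
    unfold totalInfo
    exact integral_finsetSum _ fun t ht => (hrun.integral_infoGain hB hW hlam hL ht).1
  have hsum : G.regret P n θstar act ≤
      ∑ t ∈ Finset.Icc 1 n, ∫ ω, G.gapEst {θstar} (act t ω) ∂P := by
    refine ciSup_le fun a => ?_
    have hfc : Continuous fun b => inner ℝ (G.feat a - G.feat b) θstar :=
      (continuous_const.sub hB.continuous_feat).inner continuous_const
    rw [integral_finsetSum _ fun t ht => hrun.integrable_comp_act ht hfc]
    refine Finset.sum_le_sum fun t ht => ?_
    exact integral_mono (hrun.integrable_comp_act ht hfc) (hrun.integrable_comp_act ht hgc)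
      fun ω => le_gapEst hB hsub rfl _ _
  have hmain : G.regret P n θstar act ≤
      (n : ℝ) ^ (2 / 3 : ℝ) * (c * u * v) ^ (1 / 3 : ℝ) + e := by
    refine le_rpow_of_forall_weights hu0 hv0 hc0 hnpos fun s k hs0 hk0 => hsum.trans ?_
    refine (Finset.sum_le_sum fun t ht => hrun.integral_gapEst_le hB hW hcov hfin hlam hL hρ hs ht
      (hM t ht) hs0 hk0).trans ?_
    rw [Finset.sum_add_distrib, ← Finset.sum_div, Finset.sum_add_distrib, Finset.sum_add_distrib,
      ← Finset.mul_sum, ← Finset.mul_sum, ← hvsum, Finset.sum_const, Finset.sum_const, Nat.card_Icc,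
      Nat.add_sub_cancel, nsmul_eq_mul, nsmul_eq_mul]
    refine add_le_add (le_of_eq ?_) he
    ring
  refine hmain.trans (add_le_add_left ?_ e)
  rw [integral_mul_const, ← hv]
  refine mul_le_mul_of_nonneg_left (Real.rpow_le_rpow (by positivity) ?_ (by norm_num))
    (by positivity)
  have hX : 0 ≤ G.alignment.toReal * u * (v * (G.maxGap θstar + 4 * B)) := by positivity
  rw [hc]
  linarith

omit [IsProbabilityMeasure P] in
/-- A bound on the gap of the sampling distribution that does not need the confidence set to
contain the true parameter. -/
lemma IDSRun.integral_gapEst_le_sqrt (hrun : G.IDSRun P n W lam ρ B θ₀ θstar act fb θhat μ)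
    (hB : G.Bounded θ₀ L B) (hW : G.ValidBasis W) (hcov : G.ParetoCovers)
    (hfin : G.alignment ≠ ∞) (hlam : 0 < lam) (hL : L ≤ lam) (hρ : 0 ≤ ρ)
    (hs : θstar ∈ G.params) (ht : t ∈ Finset.Icc 1 n) (ω : Ω) :
    ∫ a, G.gapEst {θstar} a ∂(μ t ω) ≤ 10 * B * √(G.alignment.toReal * lam) * √t := by
  have ht' := Finset.mem_Icc.1 ht
  have hμ := hrun.ids t ht ω
  have := hμ.1
  have hhat := (hrun.estimate t ht ω).1
  have hsub : {θstar} ⊆ G.params := Set.singleton_subset_iff.2 hs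
  have hgc : Continuous (G.gapEst {θstar}) :=
    continuous_gapEst hB hsub (Set.singleton_nonempty _)
  set E := G.confSet W lam ρ B (fun s => act s ω) t (θhat t ω) with hE
  have hEc : Continuous (G.gapEst E) :=
    continuous_gapEst hB confSet_subset ⟨_, mem_confSet_self hhat⟩
  have hst : 1 ≤ √(t : ℝ) := Real.one_le_sqrt.2 (by exact_mod_cast ht'.1)
  have h1 := (integral_gapEst_le_of_isIDS hB hW hcov hfin hlam hL hs hhat hμ).1
  rw [← hE] at h1
  have hi := hEc.integrable_of_compactSpace (μ t ω)
  have h2 : ∫ a, G.gapEst {θstar} a ∂(μ t ω) ≤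
      ∫ a, (2 * √t * G.gapEst E a + 2 * B * √(G.alignment.toReal * lam)) ∂(μ t ω) :=
    integral_mono (hgc.integrable_of_compactSpace _)
      ((hi.const_mul _).add (integrable_const _))
      fun a => gapEst_true_le hB hcov hfin hlam hL hρ ht'.1 hs hhat a
  rw [integral_add (hi.const_mul _) (integrable_const _), integral_const_mul, integral_const] at h2
  simp only [probReal_univ, one_smul] at h2
  have hB0 := hB.nonneg
  -- Writing `q` for this product, `2√t * 4q + 2q ≤ 10 q √t` because `√t ≥ 1`.
  have hq : 0 ≤ B * √(G.alignment.toReal * lam) := by positivity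
  have h3 := mul_le_mul_of_nonneg_left h1 (by positivity : 0 ≤ 2 * √(t : ℝ))
  nlinarith [mul_le_mul_of_nonneg_left hst hq]

omit [CompactSpace A] [Nonempty A] in
/-- The logarithmic factors of the explicit bound. -/
lemma IDSRun.integral_beta_le (hrun : G.IDSRun P n W lam ρ B θ₀ θstar act fb θhat μ)
    (hn : 1 ≤ n) (hr : 1 ≤ r) (hB : G.Bounded θ₀ L B) (hW : G.ValidBasis W) (hlam : 0 < lam)
    (hL : L ≤ lam) :
    ∫ ω, G.beta W lam ρ B (fun t => act t ω) n ∂P ≤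
      (10 * ρ ^ 2 + 4 * (lam * B ^ 2)) * (r * Real.log (1 + n)) := by
  have hn' : n ∈ Finset.Icc 1 n := Finset.mem_Icc.2 ⟨hn, le_rfl⟩
  have hnpos : (1 : ℝ) ≤ n := by exact_mod_cast hn
  have hr' : (1 : ℝ) ≤ r := by exact_mod_cast hr
  have hlog2 : 1 / 2 ≤ Real.log (1 + n) := by
    have h1 : Real.log 2 ≤ Real.log (1 + n) := Real.log_le_log two_pos (by linarith)
    linarith [Real.log_two_gt_d9]
  have hlogn : Real.log n ≤ Real.log (1 + n) := Real.log_le_log (by linarith) (by linarith)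
  have hlogn0 : 0 ≤ Real.log n := Real.log_natCast_nonneg n
  have h1 : ∀ ω, G.beta W lam ρ B (fun t => act t ω) n ≤
      (10 * ρ ^ 2 + 4 * (lam * B ^ 2)) * (r * Real.log (1 + n)) := by
    intro ω
    refine (beta_le hB hW hlam hL hn).trans ?_
    have h2 : (4 + (r : ℝ)) * Real.log n ≤ 5 * r * Real.log (1 + n) :=
      mul_le_mul (by linarith) hlogn hlogn0 (by positivity)
    have h3 : 1 / 2 ≤ r * Real.log (1 + n) := by nlinarith
    have h4 := mul_le_mul_of_nonneg_left h2 (by positivity : 0 ≤ 2 * ρ ^ 2)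
    have h5 := mul_le_mul_of_nonneg_left h3 (by positivity : 0 ≤ 4 * (lam * B ^ 2))
    linarith
  calc _ ≤ ∫ _ω, (10 * ρ ^ 2 + 4 * (lam * B ^ 2)) * (r * Real.log (1 + n)) ∂P :=
        integral_mono (hrun.integrable_beta hB hW hlam hL hn') (integrable_const _) h1
    _ = _ := by simp

end Regret

end LinearPM

/-! ### The main theorem -/

theorem mainTheorem2 :
    ∃ C : ℝ, ∃ K : ℝ → ℝ → ℝ → ℝ → ℝ,
      ∀ (A : Type*) [TopologicalSpace A] [CompactSpace A] [Nonempty A]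
        [MeasurableSpace A] [BorelSpace A]
        (Ω : Type*) [MeasurableSpace Ω] (P : Measure Ω) [IsProbabilityMeasure P]
        (d m r n : ℕ) (G : LinearPM A d m) (W : Euc r →L[ℝ] Euc d)
        (L B lam ρ : ℝ) (θ₀ θstar : Euc d)
        (act : ℕ → Ω → A) (fb : ℕ → Ω → Euc m)
        (θhat : ℕ → Ω → Euc d) (μ : ℕ → Ω → Measure A),
        1 ≤ n → 0 ≤ ρ → 0 < lam → L ≤ lam →
        G.Bounded θ₀ L B → G.ValidBasis W →
        (Finite A ∨ G.ParetoCovers) → G.GloballyObservable →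
        θstar ∈ G.params →
        G.IDSRun P n W lam ρ B θ₀ θstar act fb θhat μ →
        G.alignment ≠ ∞ ∧
        G.regret P n θstar act ≤
          (n : ℝ) ^ (2 / 3 : ℝ) *
            (54 * G.alignment.toReal
              * (∫ ω, G.beta W lam ρ B (fun t => act t ω) n ∂P)
              * (∫ ω, G.totalInfo W lam (fun t => act t ω) n
                  * (G.maxGap θstar + 4 * B) ∂P)) ^ (1 / 3 : ℝ)
            + C * G.maxGap θstar ∧
        G.regret P n θstar act ≤
          K ρ lam B (G.maxGap θstar) *
            (G.alignment.toReal ^ (1 / 3 : ℝ) * r * Real.log (1 + n) * (n : ℝ) ^ (2 / 3 : ℝ)) := by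
  -- `C = 2` bounds `∑ 1/t²`. In `K`, the doubling of `54` to `108` and the factor `2` of the second
  -- summand both pay for `r log (1 + n) ≥ 1/2`.
  refine ⟨2, fun ρ lam B D =>
    (108 * (10 * ρ ^ 2 + 4 * (lam * B ^ 2)) * (D + 4 * B)) ^ (1 / 3 : ℝ) +
      2 * (2 * D + 30 * B * √lam), ?_⟩
  intro A _ _ _ _ _ Ω _ P _ d m r n G W L B lam ρ θ₀ θstar act fb θhat μ hn hρ hlam hL hB hW hcov
    hG hs hrun
  replace hcov : G.ParetoCovers :=
    hcov.elim (fun _ => LinearPM.paretoCovers_of_finite hB.convex_params) id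
  have hfin := LinearPM.alignment_ne_top hB hG
  have hΔ := LinearPM.maxGap_nonneg hB θstar
  have hB0 := hB.nonneg
  have hsub : {θstar} ⊆ G.params := Set.singleton_subset_iff.2 hs
  have hgc : Continuous (G.gapEst {θstar}) :=
    LinearPM.continuous_gapEst hB hsub (Set.singleton_nonempty _)
  have hfirst := hrun.regret_le hn hB hW hcov hfin hlam hL hρ hs (M := fun _ => G.maxGap θstar)
    (e := 2 * G.maxGap θstar)
    (fun t ht ω => by
      have := (hrun.ids t ht ω).1
      calc _ ≤ ∫ _a, G.maxGap θstar ∂(μ t ω) :=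
            integral_mono (hgc.integrable_of_compactSpace _) (integrable_const _)
              fun a => LinearPM.gapEst_singleton_le_maxGap hB θstar a
        _ = _ := by simp)
    (by
      rw [← Finset.mul_sum, mul_comm]
      exact mul_le_mul_of_nonneg_right (sum_one_div_sq_le n) hΔ)
  refine ⟨hfin, hfirst, ?_⟩
  set α := G.alignment.toReal with hα
  have hα0 : 0 ≤ α := ENNReal.toReal_nonneg
  -- Here the additive term carries `√α`, which the bound `2 Δ_max` lacks.
  have hsecond := hrun.regret_le hn hB hW hcov hfin hlam hL hρ hs
    (M := fun t => 10 * B * √(α * lam) * √t) (e := 30 * B * √(α * lam))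
    (fun t ht ω => hrun.integral_gapEst_le_sqrt hB hW hcov hfin hlam hL hρ hs ht ω)
    (by
      simp_rw [mul_assoc (10 * B * √(α * lam))]
      rw [← Finset.mul_sum]
      have hq : 0 ≤ 10 * B * √(α * lam) := by positivity
      calc _ ≤ 10 * B * √(α * lam) * 3 := mul_le_mul_of_nonneg_left (sum_sqrt_div_sq_le n) hq
        _ = _ := by ring)
  rcases Nat.eq_zero_or_pos r with rfl | hr
  · have h0 : α = 0 := by rw [hα, LinearPM.alignment_eq_zero_of_rank_zero hB hW hG]; simp
    rw [← hα, h0] at hsecond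
    norm_num at hsecond ⊢
    exact hsecond
  set Δ := G.maxGap θstar with hΔdef
  set ℓ := r * Real.log (1 + n) with hℓ
  set K₁ := 10 * ρ ^ 2 + 4 * (lam * B ^ 2) with hK₁
  have hnpos : (1 : ℝ) ≤ n := by exact_mod_cast hn
  have hr' : (1 : ℝ) ≤ r := by exact_mod_cast hr
  have hℓ2 : 1 / 2 ≤ ℓ := by
    have h1 : Real.log 2 ≤ Real.log (1 + n) := Real.log_le_log two_pos (by linarith)
    have h2 := Real.log_two_gt_d9
    rw [hℓ]
    nlinarith
  have hn23 : 1 ≤ (n : ℝ) ^ (2 / 3 : ℝ) := Real.one_le_rpow hnpos (by norm_num)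
  have hα3 : 0 ≤ α ^ (1 / 3 : ℝ) := Real.rpow_nonneg hα0 _
  have hK₁0 : 0 ≤ K₁ := by positivity
  have hu := hrun.integral_beta_le hn hr hB hW hlam hL
  have hu0 : 0 ≤ ∫ ω, G.beta W lam ρ B (fun t => act t ω) n ∂P :=
    integral_nonneg fun ω => LinearPM.beta_nonneg
  have hv : ∫ ω, G.totalInfo W lam (fun t => act t ω) n * (Δ + 4 * B) ∂P ≤ ℓ * (Δ + 4 * B) := by
    have h1 : ∀ ω, G.totalInfo W lam (fun t => act t ω) n * (Δ + 4 * B) ≤ ℓ * (Δ + 4 * B) :=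
      fun ω => by
        have := LinearPM.totalInfo_le (act := fun t => act t ω) hB hW hlam hL n
        exact mul_le_mul_of_nonneg_right (by linarith) (by positivity)
    -- Without integrability the integral is `0` by convention, and the bound is trivial.
    by_cases hi : Integrable (fun ω => G.totalInfo W lam (fun t => act t ω) n * (Δ + 4 * B)) P
    · calc _ ≤ ∫ _ω, ℓ * (Δ + 4 * B) ∂P := integral_mono hi (integrable_const _) h1
        _ = _ := by simp
    · rw [integral_undef hi]
      positivity
  have hv0 : 0 ≤ ∫ ω, G.totalInfo W lam (fun t => act t ω) n * (Δ + 4 * B) ∂P :=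
    integral_nonneg fun ω => mul_nonneg (LinearPM.totalInfo_nonneg hW hlam n) (by positivity)
  set u := ∫ ω, G.beta W lam ρ B (fun t => act t ω) n ∂P
  set v := ∫ ω, G.totalInfo W lam (fun t => act t ω) n * (Δ + 4 * B) ∂P
  have hmain : (54 * α * u * v) ^ (1 / 3 : ℝ) ≤
      (108 * K₁ * (Δ + 4 * B)) ^ (1 / 3 : ℝ) * (α ^ (1 / 3 : ℝ) * ℓ) := by
    have h1 : 54 * α * u * v ≤ (108 * K₁ * (Δ + 4 * B)) * (α * ℓ ^ 3) := by
      calc 54 * α * u * v = 54 * α * (u * v) := by ring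
        _ ≤ 54 * α * ((K₁ * ℓ) * (ℓ * (Δ + 4 * B))) := by gcongr
        _ = 54 * α * K₁ * (Δ + 4 * B) * ℓ ^ 2 * 1 := by ring
        _ ≤ 54 * α * K₁ * (Δ + 4 * B) * ℓ ^ 2 * (2 * ℓ) := by gcongr; linarith
        _ = _ := by ring
    refine (Real.rpow_le_rpow (by positivity) h1 (by norm_num)).trans (le_of_eq ?_)
    rw [Real.mul_rpow (by positivity) (by positivity), Real.mul_rpow hα0 (by positivity),
      ← Real.rpow_natCast ℓ, ← Real.rpow_mul (by linarith)]
    norm_num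
  -- For `α ≥ 1` the first bound suffices, as `1 ≤ α^{1/3}`; for `α ≤ 1` the second does, as `√α ≤
  -- α^{1/3}`.
  have hextra : G.regret P n θstar act ≤
      (n : ℝ) ^ (2 / 3 : ℝ) * (54 * α * u * v) ^ (1 / 3 : ℝ) +
        (2 * Δ + 30 * B * √lam) * α ^ (1 / 3 : ℝ) := by
    have hq1 : 0 ≤ 2 * Δ * α ^ (1 / 3 : ℝ) := by positivity
    have hq2 : 0 ≤ 30 * B * √lam * α ^ (1 / 3 : ℝ) := by positivity
    rcases le_total 1 α with h1 | h1
    · have h2 : 1 ≤ α ^ (1 / 3 : ℝ) := Real.one_le_rpow h1 (by norm_num)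
      have h3 : 2 * Δ * 1 ≤ 2 * Δ * α ^ (1 / 3 : ℝ) := by gcongr
      linarith
    · have h2 : √α ≤ α ^ (1 / 3 : ℝ) := by
        rw [Real.sqrt_eq_rpow]
        rcases hα0.eq_or_lt with h0 | h0
        · rw [← h0]; norm_num
        · exact Real.rpow_le_rpow_of_exponent_ge h0 h1 (by norm_num)
      have h3 : 30 * B * √(α * lam) ≤ 30 * B * √lam * α ^ (1 / 3 : ℝ) := by
        rw [Real.sqrt_mul hα0]
        calc 30 * B * (√α * √lam) = 30 * B * √lam * √α := by ring
          _ ≤ _ := by gcongr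
      linarith
  refine hextra.trans ?_
  have h1 : (n : ℝ) ^ (2 / 3 : ℝ) * (54 * α * u * v) ^ (1 / 3 : ℝ) ≤ (n : ℝ) ^ (2 / 3 : ℝ) *
      ((108 * K₁ * (Δ + 4 * B)) ^ (1 / 3 : ℝ) * (α ^ (1 / 3 : ℝ) * ℓ)) := by gcongr
  have h2 : (2 * Δ + 30 * B * √lam) * α ^ (1 / 3 : ℝ) * 1 ≤
      (2 * Δ + 30 * B * √lam) * α ^ (1 / 3 : ℝ) * (2 * ℓ * (n : ℝ) ^ (2 / 3 : ℝ)) := by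
    gcongr
    nlinarith
  calc _ ≤ (n : ℝ) ^ (2 / 3 : ℝ) *
        ((108 * K₁ * (Δ + 4 * B)) ^ (1 / 3 : ℝ) * (α ^ (1 / 3 : ℝ) * ℓ)) +
      (2 * Δ + 30 * B * √lam) * α ^ (1 / 3 : ℝ) * (2 * ℓ * (n : ℝ) ^ (2 / 3 : ℝ)) := by linarith
    _ = _ := by rw [hℓ]; ring

end
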